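/- For $\tau$ in the complex upper half-plane let $\Lambda_\tau=\mathbb{Z}\tau+\mathbb{Z}$ and $$G(z,\tau)=-\log\left|\frac{\theta_1(z,\tau)}{\eta(\tau)}\right|^2+\frac{2\pi\,\mathrm{Im}(z)^2}{\mathrm{Im}(\tau)},$$ where $\theta_1(z,\tau)=-i\sum_{n\in\mathbb{Z}}(-1)^n e^{\pi i(n+1/2)^2\tau+(2n+1)\pi i z}$ and $\eta$ is the Dedekind eta function. For an integer $\ell\ge 0$ the two-point modular graph function is the average $$D_\ell(\tau)=\iint_{\mathbb{C}/\Lambda_\tau}G(z,\tau)^\ell\,d\mu(z),\qquad d\mu(z)=\frac{i\,dz\,d\overline z}{2\,\mathrm{Im}(\tau)}.$$ For $k\ge 2$, $r\ge 0$ put $$Z(k,r)=\sum_{j\ge 0}\ \sum_{\substack{(r_1,\dots,r_j)\in\{1,2\}^j\\ r_1+\cdots+r_j=r}}2^{\#\{i:\,r_i=1\}}\,\zeta(r_1,\dots,r_j,k),\qquad \zeta(k_1,\dots,k_m)=\sum_{0<n_1<\cdots<n_m}n_1^{-k_1}\cdots n_m^{-k_m},$$ and let $d_\ell(Y)$ be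 the Laurent polynomial $$d_\ell(Y)=\left(\frac Y6\right)^{\ell}{}_2F_1\left(1,-\ell;\tfrac32;\tfrac32\right)+\sum_{\substack{a+b+c+m=\ell\\ a,b,c\ge 0,\ m\ge 2}}\frac{\ell!\,(2a+b)!}{a!\,b!\,c!}\,\frac{(-1)^b}{2^{2a+b}\,6^c}\,Z(2a+b+3,m-2)\,Y^{c-a-1}.$$ Then for every integer $\ell\ge 0$: 1. the integral defining $D_\ell(\tau)$ converges absolutely for every $\tau$ in the upper half-plane, and, with $Y=2\pi\,\mathrm{Im}(\tau)$, $$D_\ell(\tau)=d_\ell(Y)+O\left(Y^{\max(\ell-2,0)}e^{-Y}\right)\qquad\text{as } Y\to+\infty,$$ uniformly in $\mathrm{Re}(\tau)$; 2. all coefficients of $d_\ell(Y)$ belong to the ring $\mathbb{Q}[\zeta(3),\zeta(5),\zeta(7),\dots]$ generated over $\mathbb{Q}$ by the odd Riemann zeta values $\zeta(2n+1)$, $n\ge 1$. -/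

import Mathlib

open UpperHalfPlane Filter MeasureTheory Asymptotics
open scoped LaurentPolynomial

noncomputable section

/-- The odd Jacobi theta function
`θ₁(z, τ) = -i ∑_{n ∈ ℤ} (-1)ⁿ exp(πi (n + 1/2)² τ + (2n + 1) πi z)`. -/
def jacobiThetaOne (z : ℂ) (τ : ℍ) : ℂ :=
  -Complex.I * ∑' n : ℤ, (-1 : ℂ) ^ n *
    Complex.exp (Real.pi * Complex.I * ((n : ℂ) + 1 / 2) ^ 2 * (τ : ℂ)
      + (2 * (n : ℂ) + 1) * Real.pi * Complex.I * z)

/-- The Green's function of the torus `ℂ / (ℤτ + ℤ)`. (At the lattice points, a null set, the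
true value is `+∞`; Lean's `log 0 = 0` is used there.) -/
def torusGreen (z : ℂ) (τ : ℍ) : ℝ :=
  -Real.log (‖jacobiThetaOne z τ / ModularForm.eta (τ : ℂ)‖ ^ 2)
    + 2 * Real.pi * z.im ^ 2 / τ.im

/-- The function `G(z, τ)ˡ` in the real coordinates `(u, v)`, `z = uτ + v`. -/
def torusGreenPow (l : ℕ) (τ : ℍ) (p : ℝ × ℝ) : ℝ :=
  torusGreen ((p.1 : ℂ) * (τ : ℂ) + (p.2 : ℂ)) τ ^ l

/-- The unit square, which parametrizes `ℂ / (ℤτ + ℤ)` through `(u, v) ↦ uτ + v`. In these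
coordinates the normalized invariant measure `(i/2) dz dz̄ / Im τ` is Lebesgue measure `du dv`. -/
def unitSquare : Set (ℝ × ℝ) := Set.Ico (0 : ℝ) 1 ×ˢ Set.Ico (0 : ℝ) 1

/-- The two-point modular graph function `D_l(τ)`: the average of `G(z, τ)ˡ` over the torus. -/
def modularGraphD (l : ℕ) (τ : ℍ) : ℝ :=
  ∫ p in unitSquare, torusGreenPow l τ p

/-- The multiple zeta value
`ζ(k₁, …, k_r) = ∑_{0 < n₁ < ⋯ < n_r} n₁^{-k₁} ⋯ n_r^{-k_r}` (convergent for positive `kᵢ` with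
`k_r ≥ 2`). -/
def multiZeta {r : ℕ} (k : Fin r → ℕ) : ℝ :=
  ∑' n : {n : Fin r → ℕ // StrictMono n ∧ ∀ i, 0 < n i}, ∏ i, ((n.1 i : ℝ) ^ k i)⁻¹

/-- `Z(k, r)`: the sum, over all `j ≥ 0` and all `e ∈ {1, 2}ʲ` with `e₁ + ⋯ + e_j = r`, of
`2^{#{i : eᵢ = 1}} ζ(e₁, …, e_j, k)`. (Such `e` exist only for `j ≤ r`.) -/
def specialZ (k r : ℕ) : ℝ :=
  ∑ j ∈ Finset.range (r + 1),
    ∑ e ∈ (Fintype.piFinset fun _ : Fin j => ({1, 2} : Finset ℕ)) with ∑ i, e i = r,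
      2 ^ (Finset.univ.filter fun i => e i = 1).card
        * multiZeta (Fin.snoc (α := fun _ => ℕ) e k)

/-- The Laurent polynomial `d_l(Y)`, given by
`(Y/6)ˡ ₂F₁(1, -l; 3/2; 3/2)` plus the sum over `a + b + c + m = l`, `m ≥ 2`, of
`l! (2a+b)! / (a! b! c!) · (-1)ᵇ / (2^{2a+b} 6ᶜ) · Z(2a+b+3, m-2) · Y^{c-a-1}`.
The tuple `p` is `(a, b, c, m)`. -/
def laurentD (l : ℕ) : ℝ[T;T⁻¹] :=
  LaurentPolynomial.C ((1 / 6 : ℝ) ^ l * ₂F₁ (1 : ℝ) (-(l : ℝ)) (3 / 2) (3 / 2 : ℝ))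
      * LaurentPolynomial.T (l : ℤ)
    + ∑ p ∈ Finset.Nat.antidiagonalTuple 4 l with 2 ≤ p 3,
        LaurentPolynomial.C
          ((l.factorial : ℝ) * ((2 * p 0 + p 1).factorial : ℝ)
              / (((p 0).factorial : ℝ) * ((p 1).factorial : ℝ) * ((p 2).factorial : ℝ))
            * ((-1) ^ p 1 / (2 ^ (2 * p 0 + p 1) * 6 ^ p 2))
            * specialZ (2 * p 0 + p 1 + 3) (p 3 - 2))
          * LaurentPolynomial.T ((p 2 : ℤ) - (p 0 : ℤ) - 1)

/-- The value `∑ₙ cₙ yⁿ` of a real Laurent polynomial at `y`. -/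
def laurentValue (f : ℝ[T;T⁻¹]) (y : ℝ) : ℝ :=
  f.coeff.sum fun n c => c * y ^ n

/-- The ring `ℚ[ζ(3), ζ(5), ζ(7), …]`, as a subring of `ℝ`. -/
def oddZetaRing : Subalgebra ℚ ℝ :=
  Algebra.adjoin ℚ {x : ℝ | ∃ n : ℕ, 1 ≤ n ∧ (x : ℂ) = riemannZeta (2 * (n : ℂ) + 1)}

end

/-! Asymptotics. Write z = uτ + v, w = exp(2πiz), q = exp(2πiτ), Y = 2π Im τ. The Jacobi triple
product turns G into Y(u² - u + 1/6) plus the sum of g(qᵏw) and g(qᵏ·q/w) over k ≥ 0, where g(w) =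
-log|1 - w|² (`torusGreen_eq`). For fixed u average over v. Each g has mean zero over its circle.
Only the k = 0 factors matter: the remaining ones are O(e^{-Y}), and since |w|·|q/w| = e^{-Y}, mixed
products of the two leading factors are O(e^{-Y}) on average as well
(`exists_abs_integral_greenFluct_pow_sub_le`). So the circle average of Gˡ is the quadratic main
term to the power l plus two mirror-image collar terms, built from the moments of g on the circles
of radius e^{-uY} and e^{-(1-u)Y}.

These moments are explicit. From (1 - w)^{-X} = ∑ (X)ₙ wⁿ/n! and Parseval, the moment of order j on
the circle of radius r is j! ∑ₙ [Xʲ] ((X)ₙ/n!)² r^{2n}, and ((X)ₙ/n!)² is X²/n² times ∏_{k<n} (1 +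
X/k)² (`hasSum_integral_logGreen_pow`). Extending each collar integral from (0, 1) to (0, ∞) costs
O(Y^{l-2}e^{-Y}), and integrating termwise against powers of u gives sums ∑ n^{-k} [Xʳ] ∏_{i<n} (1 +
X/i)². Expanding the square as 1 + 2X/i + X²/i² identifies these with Z(k, r)
(`specialZ_eq_poisedZeta`). The main term integrates to the hypergeometric value.

Arithmetic. Individual Z(k, r) need not be treated; only the combinations at fixed a and c occur.
Their generating function is a very well-poised series ∑ ((s)ₙ/n!)² (2n + s)/((n + x)(n + y)) with s
= x + y. It equals an infinite product (`tendsto_poised_product`), the limit of partial fraction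
expansions, and the product is (x + y)/(xy) times the exponential of S(x + y) - S(x) - S(y), where S
contains odd zeta values only (`tendsto_exp_oddZetaSeries`). On the lines x = (1/2 - i)t, y = (1/2 +
i)t with i a natural number all Taylor coefficients therefore lie in the ring, and a Vandermonde
inversion in i² isolates the combinations which occur in the Laurent polynomial
(`poisedZeta_combination_mem`). -/

noncomputable section

/-! ### A very well-poised summation from partial fractions. -/

/-- The rising factorial `s (s + 1) ⋯ (s + n - 1)`. -/
def risingProd (s : ℝ) (n : ℕ) : ℝ := ∏ i ∈ Finset.range n, (s + i)

lemma risingProd_succ (s : ℝ) (n : ℕ) : risingProd s (n + 1) = risingProd s n * (s + n) := by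
  simp [risingProd, Finset.prod_range_succ]

lemma risingProd_add (s : ℝ) (m n : ℕ) :
    risingProd s (m + n) = risingProd s m * risingProd (s + m) n := by
  simp [risingProd, Finset.prod_range_add, add_assoc]

lemma risingProd_pos {s : ℝ} (hs : 0 < s) (n : ℕ) : 0 < risingProd s n :=
  Finset.prod_pos fun i _ => by positivity

lemma risingProd_succ' (s : ℝ) (n : ℕ) : risingProd s (n + 1) = s * risingProd (s + 1) n := by
  rw [add_comm n 1, risingProd_add]; simp [risingProd]

lemma risingProd_one (n : ℕ) : risingProd 1 n = n.factorial := by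
  induction n with
  | zero => simp [risingProd]
  | succ n ih => rw [risingProd_succ, ih, Nat.factorial_succ]; push_cast; ring

/-- The weights of the terminating well-poised sum, as a product. -/
def poisedWeight (s : ℝ) (N n : ℕ) : ℝ :=
  ∏ i ∈ Finset.range n, (((N : ℝ) + i + 1) * (N - i) / ((N + i + 1 + s) * (N - i - s)))

/-- This cross-multiplied closed form is what the Lagrange coefficients are compared with in
`poised_partial_fractions`. -/
lemma poisedWeight_eq {s : ℝ} (hs : -1 < s) (hs0 : s < 0) {N n : ℕ} (hn : n ≤ N) :
    poisedWeight s N n * (((N - n).factorial : ℝ) * (risingProd (1 - s) N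
        * risingProd s (N + n + 1)))
      = (N + n).factorial * (risingProd s (N + 1) * risingProd (1 - s) (N - n)) := by
  induction n with
  | zero => simp only [poisedWeight, Finset.prod_range_zero, Nat.sub_zero, add_zero]; ring
  | succ n ih =>
    have ih := ih (by omega)
    obtain ⟨d, rfl⟩ : ∃ d, N = n + 1 + d := ⟨N - (n + 1), by omega⟩
    have e1 : n + 1 + d - n = d + 1 := by omega
    have e2 : n + 1 + d - (n + 1) = d := by omega
    rw [e1] at ih
    rw [e2]
    rw [show n + 1 + d + (n + 1) + 1 = (n + 1 + d + n + 1) + 1 by ring, risingProd_succ s (_ + 1),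
      show n + 1 + d + (n + 1) = (n + 1 + d + n) + 1 by ring, Nat.factorial_succ, poisedWeight,
      Finset.prod_range_succ, ← poisedWeight]
    rw [risingProd_succ (1 - s) d, Nat.factorial_succ] at ih
    have h1 : (((n + 1 + d : ℕ) : ℝ) + n + 1 + s) ≠ 0 := by 
      push_cast; have : (0 : ℝ) ≤ d := d.cast_nonneg
      have : (0 : ℝ) ≤ n := n.cast_nonneg
      intro h; linarith
    have h2 : (((n + 1 + d : ℕ) : ℝ) - n - s) ≠ 0 := by
      push_cast; have : (0 : ℝ) ≤ d := d.cast_nonneg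
      intro h; linarith
    have h3 : ((d : ℝ) + 1) ≠ 0 := by positivity
    have h4 : (1 - s + d) ≠ 0 := by
      have : (0 : ℝ) ≤ d := d.cast_nonneg
      intro h; linarith
    have h5 : (((n + 1 + d : ℕ) : ℝ) - n) = d + 1 := by push_cast; ring
    have h6 : s + ((n + 1 + d + n + 1 : ℕ) : ℝ) = ((n + 1 + d : ℕ) : ℝ) + n + 1 + s := by
      push_cast; ring
    rw [h6]
    rw [h5] at h2 ⊢
    have h7 : ((n + 1 + d + n + 1 : ℕ) : ℝ) = ((n + 1 + d : ℕ) : ℝ) + n + 1 := by push_cast; ring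
    rw [Nat.cast_mul, h7]
    generalize ((n + 1 + d : ℕ) : ℝ) + n + 1 = p at *
    generalize risingProd (1 - s) (n + 1 + d) = A at *
    generalize risingProd s (n + 1 + d + n + 1) = B at *
    push_cast at ih
    field_simp
    linear_combination p * ih

lemma neg_one_pow_mul_prod_range (f : ℕ → ℝ) (n : ℕ) :
    (-1) ^ n * ∏ i ∈ Finset.range n, f i = ∏ i ∈ Finset.range n, -f i := by
  rw [Finset.prod_neg, Finset.card_range]

/-- At the n-th interpolation node each factor of the numerator polynomial splits as (k + 1 + n)(k +
1 - n - s). This evaluates the second halves; `prod_range_add_one_add` evaluates the first. -/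
lemma prod_range_add_one_sub_sub (s : ℝ) {N n : ℕ} (hn : n ≤ N) :
    ∏ k ∈ Finset.range N, ((k : ℝ) + 1 - n - s)
      = (-1) ^ n * risingProd s n * risingProd (1 - s) (N - n) := by
  obtain ⟨d, rfl⟩ := Nat.exists_eq_add_of_le hn
  rw [Finset.prod_range_add, Nat.add_sub_cancel_left, risingProd, risingProd,
    ← Finset.prod_range_reflect, neg_one_pow_mul_prod_range]
  congr 1
  · refine Finset.prod_congr rfl fun k hk => ?_
    have : k + 1 ≤ n := Finset.mem_range.mp hk
    rw [show n - 1 - k = n - (k + 1) by omega]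
    push_cast [this]
    ring
  · exact Finset.prod_congr rfl fun k _ => by push_cast; ring

/-- Differences of nodes split as (k - n)(k + n + s); this and `prod_range_erase_add` evaluate the
two halves of the inverse nodal weight. -/
lemma prod_range_erase_sub {N n : ℕ} (hn : n ≤ N) :
    ∏ k ∈ (Finset.range (N + 1)).erase n, ((k : ℝ) - n)
      = (-1) ^ n * n.factorial * (N - n).factorial := by
  have h : (Finset.range (N + 1)).erase n
      = Finset.range n ∪ Finset.Ico (n + 1) (N + 1) := by
    ext k; simp; omega
  rw [h, Finset.prod_union (Finset.disjoint_left.mpr fun k => by simp; omega),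
    Finset.prod_Ico_eq_prod_range, ← Finset.prod_range_reflect]
  congr 1
  · rw [← risingProd_one, risingProd, neg_one_pow_mul_prod_range]
    refine Finset.prod_congr rfl fun k hk => ?_
    have : k + 1 ≤ n := Finset.mem_range.mp hk
    rw [show n - 1 - k = n - (k + 1) by omega]
    push_cast [this]
    ring
  · rw [← risingProd_one, risingProd, Nat.add_sub_add_right]
    exact Finset.prod_congr rfl fun k _ => by push_cast; ring

lemma prod_range_add_one_add (N n : ℕ) :
    (∏ k ∈ Finset.range N, ((k : ℝ) + 1 + n)) * n.factorial = (N + n).factorial := by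
  rw [← risingProd_one, ← risingProd_one, add_comm N n, risingProd_add, mul_comm]
  congr 1
  exact Finset.prod_congr rfl fun k _ => by ring

lemma prod_range_erase_add (s : ℝ) {N n : ℕ} (hn : n ≤ N) :
    risingProd s n * ((2 * n + s) * ∏ k ∈ (Finset.range (N + 1)).erase n, ((k : ℝ) + n + s))
      = risingProd s (N + n + 1) := by
  have := Finset.mul_prod_erase (Finset.range (N + 1)) (fun k : ℕ => (k : ℝ) + n + s)
    (Finset.mem_range.mpr (Nat.lt_succ_of_le hn))
  rw [show (2 * n + s : ℝ) = n + n + s by ring, this, show N + n + 1 = n + (N + 1) by ring,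
    risingProd_add]
  congr 1
  exact Finset.prod_congr rfl fun k _ => by ring

open Polynomial in
/-- Partial fractions of the terminating well-poised product. -/
lemma poised_partial_fractions {x y : ℝ} (hs : -1 < x + y) (hs0 : x + y < 0) (hx : |x| < 1 / 2)
    (hy : |y| < 1 / 2) (hx0 : x ≠ 0) (hy0 : y ≠ 0) (N : ℕ) :
    (x + y) / (x * y) * ∏ k ∈ Finset.range N,
        (((k : ℝ) + 1 + (x + y)) * (k + 1 - x) * (k + 1 - y)
          / ((k + 1 - (x + y)) * (k + 1 + x) * (k + 1 + y)))
      = ∑ n ∈ Finset.range (N + 1), (risingProd (x + y) n / n.factorial) ^ 2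
          * poisedWeight (x + y) N n * ((2 * n + (x + y)) / ((n + x) * (n + y))) := by
  set s := x + y with hsdef
  have hxx := abs_lt.mp hx
  have hyy := abs_lt.mp hy
  have posx : ∀ k : ℕ, (k : ℝ) + x ≠ 0 := by
    intro k
    rcases Nat.eq_zero_or_pos k with rfl | h
    · simpa using hx0
    · have : (1 : ℝ) ≤ k := by exact_mod_cast h
      intro h; linarith
  have posy : ∀ k : ℕ, (k : ℝ) + y ≠ 0 := by
    intro k
    rcases Nat.eq_zero_or_pos k with rfl | h
    · simpa using hy0
    · have : (1 : ℝ) ≤ k := by exact_mod_cast h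
      intro h; linarith
  -- For fixed s the product is a rational function of the single variable xy, because (n + x)(n +
  -- y) = xy - v n. Lagrange interpolation at the points v n is its partial fraction expansion.
  let v : ℕ → ℝ := fun n => -((n : ℝ) ^ 2 + n * s)
  have hv : ∀ n k : ℕ, v n - v k = ((k : ℝ) - n) * (k + n + s) := fun n k => by
    simp only [v]; ring
  have hinj : Set.InjOn v (Finset.range (N + 1)) := by
    intro n _ k _ h
    by_contra hne
    have h0 : v n - v k = 0 := by rw [h, sub_self]
    rw [hv] at h0
    rcases mul_eq_zero.mp h0 with h1 | h1
    · exact hne (by exact_mod_cast (sub_eq_zero.mp h1).symm)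
    · have : (1 : ℝ) ≤ k + n := by
        have : 1 ≤ k + n := by omega
        exact_mod_cast this
      linarith
  -- At xy the factors become (k + 1 - x)(k + 1 - y); the degree N is below the number N + 1 of
  -- nodes, so F is its own interpolant.
  let F : ℝ[X] := ∏ k ∈ Finset.range N, (X + C (((k : ℝ) + 1) ^ 2 - (k + 1) * s))
  have hFdeg : F.degree < (Finset.range (N + 1)).card := by
    have : F.degree = N := by
      simp only [F, degree_prod, degree_X_add_C]; simp
    rw [this, Finset.card_range]; exact_mod_cast Nat.lt_succ_self N
  have hFev : ∀ e, F.eval e = ∏ k ∈ Finset.range N, (e + (((k : ℝ) + 1) ^ 2 - (k + 1) * s)) := by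
    intro e; simp only [F, eval_prod]; simp
  have hnode : ∀ n : ℕ, x * y - v n = (n + x) * (n + y) := fun n => by
    simp only [v, hsdef]; ring
  have key := Lagrange.eval_interpolate_not_at_node (s := Finset.range (N + 1)) (v := v)
    (r := fun i => F.eval (v i)) (x := x * y) (fun i _ h => by
      have := hnode i
      rw [h, sub_self] at this
      exact mul_ne_zero (posx i) (posy i) this.symm)
  rw [← Lagrange.eq_interpolate hinj hFdeg, Lagrange.eval_nodal, hFev] at key
  have hcoef : ∀ n ∈ Finset.range (N + 1), risingProd s (N + 1)
      * (Lagrange.nodalWeight (Finset.range (N + 1)) v n * F.eval (v n))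
      = risingProd (1 - s) N * ((risingProd s n / n.factorial) ^ 2
          * poisedWeight s N n * (2 * n + s)) := by
    intro n hn
    have hn' : n ≤ N := Nat.lt_succ_iff.mp (Finset.mem_range.mp hn)
    have e1 : F.eval (v n) * n.factorial
        = (N + n).factorial * ((-1) ^ n * risingProd s n * risingProd (1 - s) (N - n)) := by
      rw [← prod_range_add_one_add, ← prod_range_add_one_sub_sub s hn', hFev, mul_right_comm,
        ← Finset.prod_mul_distrib]
      congr 1
      refine Finset.prod_congr rfl fun k _ => ?_
      simp only [v]; ring
    have e2 : Lagrange.nodalWeight (Finset.range (N + 1)) v n * (((-1) ^ n * n.factorial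
        * (N - n).factorial) * ∏ k ∈ (Finset.range (N + 1)).erase n, ((k : ℝ) + n + s)) = 1 := by
      rw [← prod_range_erase_sub hn', ← Finset.prod_mul_distrib, Lagrange.nodalWeight,
        ← Finset.prod_mul_distrib]
      refine Finset.prod_eq_one fun k hk => ?_
      rw [← hv]
      refine inv_mul_cancel₀ (sub_ne_zero.mpr fun h => (Finset.mem_erase.mp hk).1 ?_)
      exact (hinj hn (Finset.mem_erase.mp hk).2 h).symm
    have e3 := prod_range_erase_add s hn'
    have e4 := poisedWeight_eq hs hs0 hn'
    have hf : (n.factorial : ℝ) ≠ 0 := by exact_mod_cast n.factorial_ne_zero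
    generalize Lagrange.nodalWeight (Finset.range (N + 1)) v n = nw at *
    generalize ∏ k ∈ (Finset.range (N + 1)).erase n, ((k : ℝ) + n + s) = D at *
    generalize ((-1 : ℝ)) ^ n = σ at *
    field_simp
    linear_combination (risingProd s (N + 1) * nw * n.factorial) * e1
      - (nw * σ * n.factorial * risingProd s n) * e4
      - (nw * σ * n.factorial * risingProd s n * poisedWeight s N n * (N - n).factorial
        * risingProd (1 - s) N) * e3
      + (risingProd s n ^ 2 * poisedWeight s N n * risingProd (1 - s) N * (2 * n + s)) * e2
  have hA : risingProd (1 - s) N ≠ 0 := (risingProd_pos (by linarith) N).ne'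
  have hprod : ∏ i ∈ Finset.range (N + 1), (x * y - v i)
      = x * y * ∏ k ∈ Finset.range N, (((k : ℝ) + 1 + x) * (k + 1 + y)) := by
    rw [Finset.prod_range_succ', hnode, mul_comm]
    congr 1
    · simp
    · exact Finset.prod_congr rfl fun k _ => by rw [hnode]; push_cast; ring
  have hnum : ∏ k ∈ Finset.range N, (x * y + (((k : ℝ) + 1) ^ 2 - (k + 1) * s))
      = ∏ k ∈ Finset.range N, (((k : ℝ) + 1 - x) * (k + 1 - y)) :=
    Finset.prod_congr rfl fun k _ => by simp only [hsdef]; ring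
  have hden0 : ∏ k ∈ Finset.range N, (((k : ℝ) + 1 + x) * (k + 1 + y)) ≠ 0 :=
    Finset.prod_ne_zero_iff.mpr fun k _ => mul_ne_zero
      (by simpa using posx (k + 1)) (by simpa using posy (k + 1))
  have hR1 : s * ∏ k ∈ Finset.range N, ((k : ℝ) + 1 + s) = risingProd s (N + 1) := by
    rw [risingProd_succ']
    congr 1
    exact Finset.prod_congr rfl fun k _ => by ring
  have hR2 : ∏ k ∈ Finset.range N, ((k : ℝ) + 1 - s) = risingProd (1 - s) N :=
    Finset.prod_congr rfl fun k _ => by ring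
  have hsum : risingProd s (N + 1) * ∑ i ∈ Finset.range (N + 1),
      Lagrange.nodalWeight (Finset.range (N + 1)) v i * (x * y - v i)⁻¹ * F.eval (v i)
      = risingProd (1 - s) N * ∑ n ∈ Finset.range (N + 1), (risingProd s n / n.factorial) ^ 2
          * poisedWeight s N n * ((2 * n + s) / ((n + x) * (n + y))) := by
    rw [Finset.mul_sum, Finset.mul_sum]
    refine Finset.sum_congr rfl fun n hn => ?_
    rw [hnode]
    linear_combination ((n + x) * (n + y))⁻¹ * hcoef n hn
  rw [hnum, hprod] at key
  have hL : ∏ k ∈ Finset.range N, (((k : ℝ) + 1 + s) * (k + 1 - x) * (k + 1 - y)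
          / ((k + 1 - s) * (k + 1 + x) * (k + 1 + y)))
      = ((∏ k ∈ Finset.range N, ((k : ℝ) + 1 + s))
          * ∏ k ∈ Finset.range N, (((k : ℝ) + 1 - x) * (k + 1 - y)))
        / (risingProd (1 - s) N * ∏ k ∈ Finset.range N, (((k : ℝ) + 1 + x) * (k + 1 + y))) := by
    rw [← hR2, ← Finset.prod_mul_distrib, ← Finset.prod_mul_distrib, ← Finset.prod_div_distrib]
    exact Finset.prod_congr rfl fun k _ => by ring
  rw [hL, key]
  generalize ∏ k ∈ Finset.range N, (((k : ℝ) + 1 + x) * (k + 1 + y)) = D at *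
  generalize (∑ i ∈ Finset.range (N + 1), Lagrange.nodalWeight (Finset.range (N + 1)) v i
    * (x * y - v i)⁻¹ * F.eval (v i)) = S₁ at *
  generalize (∑ n ∈ Finset.range (N + 1), (risingProd s n / n.factorial) ^ 2
    * poisedWeight s N n * ((2 * n + s) / ((n + x) * (n + y)))) = S₂ at *
  field_simp
  rw [hR1, hsum]

/-- In each factor the denominator exceeds the numerator by -s(2i + 1 + s), which is positive for -1
< s < 0. This bound dominates the passage to the limit and is one reason for restricting to negative
s. -/
lemma poisedWeight_mem {s : ℝ} (hs : -1 < s) (hs0 : s < 0) {N n : ℕ} (hn : n ≤ N) :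
    0 ≤ poisedWeight s N n ∧ poisedWeight s N n ≤ 1 := by
  have h : ∀ i ∈ Finset.range n, 0 ≤ ((N : ℝ) + i + 1) * (N - i) / ((N + i + 1 + s) * (N - i - s))
      ∧ ((N : ℝ) + i + 1) * (N - i) / ((N + i + 1 + s) * (N - i - s)) ≤ 1 := by
    intro i hi
    have hi' : (i : ℝ) + 1 ≤ N := by
      have : i + 1 ≤ N := by have := Finset.mem_range.mp hi; omega
      exact_mod_cast this
    have hi0 : (0 : ℝ) ≤ i := i.cast_nonneg
    have h1 : 0 < ((N : ℝ) + i + 1 + s) * (N - i - s) :=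
      mul_pos (by linarith) (by linarith)
    refine ⟨div_nonneg (mul_nonneg (by linarith) (by linarith)) h1.le, ?_⟩
    rw [div_le_one h1]
    nlinarith [mul_nonneg hi0 (neg_nonneg.mpr hs0.le)]
  exact ⟨Finset.prod_nonneg fun i hi => (h i hi).1,
    Finset.prod_le_one (fun i hi => (h i hi).1) fun i hi => (h i hi).2⟩

lemma tendsto_poisedWeight (s : ℝ) (n : ℕ) :
    Tendsto (fun N => poisedWeight s N n) atTop (nhds 1) := by
  have h : ∀ a b : ℝ, Tendsto (fun N : ℕ => ((N : ℝ) + a) / (N + b)) atTop (nhds 1) := by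
    intro a b
    have hb : Tendsto (fun N : ℕ => (N : ℝ) + b) atTop atTop :=
      tendsto_atTop_add_const_right _ _ tendsto_natCast_atTop_atTop
    have h1 : Tendsto (fun N : ℕ => 1 + (a - b) / ((N : ℝ) + b)) atTop (nhds (1 + 0)) :=
      tendsto_const_nhds.add (hb.const_div_atTop (a - b))
    rw [add_zero] at h1
    refine h1.congr' ?_
    filter_upwards [hb.eventually_gt_atTop 0] with N hN
    field_simp
    ring
  have : (1 : ℝ) = ∏ i ∈ Finset.range n, (1 * 1 : ℝ) := by simp
  rw [this]
  refine tendsto_finsetProd _ fun i _ => ?_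
  refine ((h (i + 1) (i + 1 + s)).mul (h (-i) (-i - s))).congr fun N => ?_
  rw [div_mul_div_comm]
  congr 1 <;> ring

/-- Pull out the factor s, of absolute value below 1; the rest is a product of factors s + 1 + i ≤ 1
+ i. -/
lemma abs_risingProd_div_factorial_le {s : ℝ} (hs : -1 < s) (hs0 : s < 0) (n : ℕ) :
    |risingProd s (n + 1) / (n + 1).factorial| ≤ 1 / (n + 1) := by
  have h : |risingProd s (n + 1)| ≤ n.factorial := by
    rw [risingProd_succ', ← risingProd_one, abs_mul, abs_of_neg hs0,
      abs_of_pos (risingProd_pos (by linarith) n)]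
    have : risingProd (s + 1) n ≤ risingProd 1 n :=
      Finset.prod_le_prod (fun i _ => by have : (0 : ℝ) ≤ i := i.cast_nonneg; linarith)
        fun i _ => by linarith
    have h2 := (risingProd_pos (s := s + 1) (by linarith) n)
    nlinarith
  rw [abs_div, Nat.abs_cast, Nat.factorial_succ, div_le_div_iff₀ (by positivity) (by positivity)]
  push_cast
  nlinarith [show (0 : ℝ) < n + 1 by positivity]

lemma summable_poised {x y : ℝ} (hs : -1 < x + y) (hs0 : x + y < 0) (hx : |x| < 1 / 2)
    (hy : |y| < 1 / 2) :
    Summable fun n : ℕ => |(risingProd (x + y) n / n.factorial) ^ 2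
      * ((2 * n + (x + y)) / ((n + x) * (n + y)))| := by
  rw [← summable_nat_add_iff 1]
  have hxx := abs_lt.mp hx
  have hyy := abs_lt.mp hy
  refine Summable.of_nonneg_of_le (fun n => abs_nonneg _) (fun n => ?_)
    (((summable_nat_add_iff 1).mpr (Real.summable_one_div_nat_pow.mpr one_lt_two)).mul_left 8)
  have h1 := abs_risingProd_div_factorial_le hs hs0 n
  have hn : (0 : ℝ) ≤ n := n.cast_nonneg
  have h3 : |(2 * ((n + 1 : ℕ) : ℝ) + (x + y)) / ((((n + 1 : ℕ) : ℝ) + x) * (((n + 1 : ℕ) : ℝ) + y))|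
      ≤ 8 := by
    push_cast
    rw [abs_of_nonneg (div_nonneg (by linarith) (mul_nonneg (by linarith) (by linarith))),
      div_le_iff₀ (mul_pos (by linarith) (by linarith))]
    nlinarith [mul_le_mul (show (n : ℝ) + 1 / 2 ≤ n + 1 + x by linarith)
      (show (n : ℝ) + 1 / 2 ≤ n + 1 + y by linarith) (by linarith) (by linarith)]
  rw [abs_mul, abs_pow, mul_comm (8 : ℝ)]
  refine mul_le_mul ?_ h3 (abs_nonneg _) (by positivity)
  calc _ ≤ (1 / ((n : ℝ) + 1)) ^ 2 := pow_le_pow_left₀ (abs_nonneg _) h1 2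
    _ = _ := by push_cast; rw [div_pow, one_pow]

/-- A nonterminating very well-poised `₅F₄` summation. -/
theorem tendsto_poised_product {x y : ℝ} (hs : -1 < x + y) (hs0 : x + y < 0) (hx : |x| < 1 / 2)
    (hy : |y| < 1 / 2) (hx0 : x ≠ 0) (hy0 : y ≠ 0) :
    Tendsto (fun N : ℕ => (x + y) / (x * y) * ∏ k ∈ Finset.range N,
        (((k : ℝ) + 1 + (x + y)) * (k + 1 - x) * (k + 1 - y)
          / ((k + 1 - (x + y)) * (k + 1 + x) * (k + 1 + y)))) atTop
      (nhds (∑' n : ℕ, (risingProd (x + y) n / n.factorial) ^ 2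
          * ((2 * n + (x + y)) / ((n + x) * (n + y))))) := by
  simp_rw [poised_partial_fractions hs hs0 hx hy hx0 hy0]
  have h : ∀ N, ∑ n ∈ Finset.range (N + 1), (risingProd (x + y) n / n.factorial) ^ 2
          * poisedWeight (x + y) N n * ((2 * n + (x + y)) / ((n + x) * (n + y)))
      = ∑' n : ℕ, if n ≤ N then (risingProd (x + y) n / n.factorial) ^ 2
          * poisedWeight (x + y) N n * ((2 * n + (x + y)) / ((n + x) * (n + y))) else 0 := by
    intro N
    rw [tsum_eq_sum (s := Finset.range (N + 1)) (fun n hn => if_neg fun h => hn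
      (Finset.mem_range.mpr (Nat.lt_succ_of_le h)))]
    exact Finset.sum_congr rfl fun n hn =>
      (if_pos (Nat.lt_succ_iff.mp (Finset.mem_range.mp hn))).symm
  simp_rw [h]
  refine tendsto_tsum_of_dominated_convergence (summable_poised hs hs0 hx hy) (fun n => ?_)
    (Eventually.of_forall fun N n => ?_)
  · have := ((tendsto_poisedWeight (x + y) n).const_mul
      ((risingProd (x + y) n / n.factorial) ^ 2)).mul_const
      ((2 * n + (x + y)) / ((n + x) * (n + y)))
    rw [mul_one] at this
    refine this.congr' ?_
    filter_upwards [eventually_ge_atTop n] with N hN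
    rw [if_pos hN]
  · split_ifs with hn
    · obtain ⟨h0, h1⟩ := poisedWeight_mem hs hs0 hn
      rw [Real.norm_eq_abs, mul_right_comm, abs_mul, abs_of_nonneg h0]
      exact mul_le_of_le_one_right (abs_nonneg _) h1
    · rw [norm_zero]; exact abs_nonneg _

lemma hasSum_of_eq {ι E : Type*} [AddCommMonoid E] [TopologicalSpace E] {f g : ι → E} {a b : E}
    (h : HasSum f a) (hf : ∀ i, f i = g i) (hab : a = b) : HasSum g b := by
  rw [← hab, ← funext hf]; exact h

/-! ### The infinite product as an exponential of odd zeta values. -/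

/-- The value `ζ(k)` of the Riemann zeta function as a real series. -/
def zetaReal (k : ℕ) : ℝ := ∑' n : ℕ, 1 / ((n : ℝ) + 1) ^ k

lemma summable_one_div_add_one_pow {k : ℕ} (hk : 1 < k) :
    Summable fun n : ℕ => 1 / ((n : ℝ) + 1) ^ k := by
  simpa using (summable_nat_add_iff 1).mpr (Real.summable_one_div_nat_pow.mpr hk)

lemma zetaReal_odd_mem (j : ℕ) : zetaReal (2 * j + 3) ∈ oddZetaRing := by
  refine Algebra.subset_adjoin ⟨j + 1, by omega, ?_⟩
  have h := zeta_nat_eq_tsum_of_gt_one (k := 2 * j + 3) (by omega)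
  have e : (2 * ((j + 1 : ℕ) : ℂ) + 1) = ((2 * j + 3 : ℕ) : ℂ) := by push_cast; ring
  rw [e, h, zetaReal, Complex.ofReal_tsum]
  have hs : Summable fun n : ℕ => 1 / (n : ℂ) ^ (2 * j + 3) := by
    have := Real.summable_one_div_nat_pow.mpr (show 1 < 2 * j + 3 by omega)
    refine (Complex.ofRealCLM.summable this).congr fun n => ?_
    simp
  rw [hs.tsum_eq_zero_add]
  simp

/-- The odd power series `∑ 2 ζ(2j+3) x^(2j+3) / (2j+3)`. -/
def oddZetaSeries (x : ℝ) : ℝ := ∑' j : ℕ, 2 / (2 * j + 3 : ℝ) * zetaReal (2 * j + 3) * x ^ (2 * j + 3)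

lemma summable_oddZeta_double {x : ℝ} (hx : |x| < 1) :
    Summable fun p : ℕ × ℕ => 2 / (2 * p.1 + 3 : ℝ) * (x / ((p.2 : ℝ) + 1)) ^ (2 * p.1 + 3) := by
  have h1 : Summable fun j : ℕ => 2 * |x| ^ j :=
    (summable_geometric_of_lt_one (abs_nonneg x) hx).mul_left 2
  have h2 := summable_one_div_add_one_pow (k := 2) one_lt_two
  refine Summable.of_norm_bounded (h1.mul_of_nonneg h2 (fun j => by positivity)
    (fun j => by positivity)) fun ⟨j, k⟩ => ?_
  simp only [norm_mul, Real.norm_eq_abs, abs_pow, div_pow, abs_div]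
  rw [abs_of_pos (show (0 : ℝ) < 2 * j + 3 by positivity),
    abs_of_pos (show (0 : ℝ) < (k : ℝ) + 1 by positivity), abs_two]
  have e1 : (2 : ℝ) / (2 * j + 3) ≤ 2 := by
    rw [div_le_iff₀ (by positivity)]; nlinarith [(j.cast_nonneg : (0 : ℝ) ≤ j)]
  have e2 : |x| ^ (2 * j + 3) ≤ |x| ^ j :=
    pow_le_pow_of_le_one (abs_nonneg x) hx.le (by omega)
  have e3 : 1 / ((k : ℝ) + 1) ^ (2 * j + 3) ≤ 1 / ((k : ℝ) + 1) ^ 2 :=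
    one_div_le_one_div_of_le (by positivity) (pow_le_pow_right₀ (by
      have : (0 : ℝ) ≤ k := k.cast_nonneg
      linarith) (by omega))
  calc 2 / (2 * j + 3 : ℝ) * (|x| ^ (2 * j + 3) / ((k : ℝ) + 1) ^ (2 * j + 3))
      = 2 / (2 * j + 3 : ℝ) * |x| ^ (2 * j + 3) * (1 / ((k : ℝ) + 1) ^ (2 * j + 3)) := by ring
    _ ≤ 2 * |x| ^ j * (1 / ((k : ℝ) + 1) ^ 2) := by gcongr

lemma hasSum_log_ratio {x : ℝ} (hx : |x| < 1) (k : ℕ) :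
    HasSum (fun j : ℕ => 2 / (2 * j + 3 : ℝ) * (x / ((k : ℝ) + 1)) ^ (2 * j + 3))
      (Real.log (1 + x / (k + 1)) - Real.log (1 - x / (k + 1)) - 2 * (x / (k + 1))) := by
  have h1 : |x / ((k : ℝ) + 1)| < 1 := by
    rw [abs_div, abs_of_pos (show (0 : ℝ) < (k : ℝ) + 1 by positivity),
      div_lt_one (by positivity)]
    have : (0 : ℝ) ≤ k := k.cast_nonneg
    linarith
  have h := (hasSum_nat_add_iff' 1).mpr (Real.hasSum_log_sub_log_of_abs_lt_one h1)
  simp only [Finset.range_one, Finset.sum_singleton, Nat.cast_zero, mul_zero, zero_add, pow_one,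
    div_one, mul_one] at h
  refine hasSum_of_eq h (fun j => ?_) rfl
  push_cast
  rw [show 2 * ((j : ℝ) + 1) + 1 = 2 * j + 3 by ring, show 2 * (j + 1) + 1 = 2 * j + 3 by ring]
  ring

/-- One absolutely convergent double series is summed in both orders. The term 2x/(k + 1) is removed
because the harmonic series diverges; this is why the series begins with ζ(3). -/
lemma hasSum_oddZetaSeries {x : ℝ} (hx : |x| < 1) :
    HasSum (fun k : ℕ => Real.log (1 + x / (k + 1)) - Real.log (1 - x / (k + 1)) - 2 * (x / (k + 1)))
      (oddZetaSeries x) ∧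
    HasSum (fun j : ℕ => 2 / (2 * j + 3 : ℝ) * zetaReal (2 * j + 3) * x ^ (2 * j + 3))
      (oddZetaSeries x) := by
  have hS := summable_oddZeta_double hx
  have hrow : ∀ j : ℕ, HasSum (fun k : ℕ => 2 / (2 * j + 3 : ℝ) * (x / ((k : ℝ) + 1)) ^ (2 * j + 3))
      (2 / (2 * j + 3 : ℝ) * zetaReal (2 * j + 3) * x ^ (2 * j + 3)) := by
    intro j
    have := ((summable_one_div_add_one_pow (show 1 < 2 * j + 3 by omega)).hasSum.mul_left
      (2 / (2 * j + 3 : ℝ) * x ^ (2 * j + 3)))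
    exact hasSum_of_eq this (fun k => by rw [div_pow]; ring) (by simp only [zetaReal]; ring)
  have h1 := hS.hasSum.prod_fiberwise hrow
  have hT : oddZetaSeries x = ∑' p : ℕ × ℕ, 2 / (2 * p.1 + 3 : ℝ)
      * (x / ((p.2 : ℝ) + 1)) ^ (2 * p.1 + 3) := h1.tsum_eq
  rw [← hT] at h1
  refine ⟨?_, h1⟩
  rw [hT]
  have h2 := (Equiv.prodComm ℕ ℕ).hasSum_iff.mpr hS.hasSum
  exact h2.prod_fiberwise (hasSum_log_ratio hx)

/-- The removed linear terms cancel, their arguments being x + y, x and y, so exponentials of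
partial sums are exactly the finite products. -/
lemma tendsto_exp_oddZetaSeries {x y : ℝ} (hs : |x + y| < 1) (hx : |x| < 1) (hy : |y| < 1) :
    Tendsto (fun N : ℕ => ∏ k ∈ Finset.range N,
        (((k : ℝ) + 1 + (x + y)) * (k + 1 - x) * (k + 1 - y)
          / ((k + 1 - (x + y)) * (k + 1 + x) * (k + 1 + y)))) atTop
      (nhds (Real.exp (oddZetaSeries (x + y) - oddZetaSeries x - oddZetaSeries y))) := by
  have h := (((hasSum_oddZetaSeries hs).1.sub (hasSum_oddZetaSeries hx).1).sub
    (hasSum_oddZetaSeries hy).1).tendsto_sum_nat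
  refine ((Real.continuous_exp.tendsto _).comp h).congr fun N => ?_
  rw [Function.comp_apply, Real.exp_sum]
  refine Finset.prod_congr rfl fun k _ => ?_
  have pos : ∀ z : ℝ, |z| < 1 → 0 < 1 + z / ((k : ℝ) + 1) ∧ 0 < 1 - z / ((k : ℝ) + 1) := by
    intro z hz
    have hk : (1 : ℝ) ≤ (k : ℝ) + 1 := by
      have : (0 : ℝ) ≤ k := k.cast_nonneg
      linarith
    have : |z / ((k : ℝ) + 1)| < 1 := by
      rw [abs_div, abs_of_pos (by linarith : (0 : ℝ) < (k : ℝ) + 1), div_lt_one (by linarith)]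
      linarith
    have := abs_lt.mp this
    constructor <;> linarith
  obtain ⟨a1, a2⟩ := pos _ hs
  obtain ⟨b1, b2⟩ := pos _ hx
  obtain ⟨c1, c2⟩ := pos _ hy
  have hk : (k : ℝ) + 1 ≠ 0 := by positivity
  have e : Real.log (1 + (x + y) / (k + 1)) - Real.log (1 - (x + y) / (k + 1))
        - 2 * ((x + y) / (k + 1))
        - (Real.log (1 + x / (k + 1)) - Real.log (1 - x / (k + 1)) - 2 * (x / (k + 1)))
        - (Real.log (1 + y / (k + 1)) - Real.log (1 - y / (k + 1)) - 2 * (y / (k + 1)))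
      = Real.log ((1 + (x + y) / (k + 1)) * (1 - x / (k + 1)) * (1 - y / (k + 1))
        / ((1 - (x + y) / (k + 1)) * (1 + x / (k + 1)) * (1 + y / (k + 1)))) := by
    rw [Real.log_div (by positivity) (by positivity), Real.log_mul (by positivity) (by positivity),
      Real.log_mul (by positivity) (by positivity), Real.log_mul (by positivity) (by positivity),
      Real.log_mul (by positivity) (by positivity)]
    ring
  rw [e, Real.exp_log (by positivity)]
  have f : ∀ z : ℝ, 1 + z / ((k : ℝ) + 1) = (k + 1 + z) / (k + 1) := fun z => by field_simp
  have g : ∀ z : ℝ, 1 - z / ((k : ℝ) + 1) = (k + 1 - z) / (k + 1) := fun z => by field_simp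
  rw [g] at a2
  rw [f] at b1 c1
  have hk' : (0 : ℝ) < k + 1 := by positivity
  have a3 := (div_pos_iff_of_pos_right hk').mp a2
  have b3 := (div_pos_iff_of_pos_right hk').mp b1
  have c3 := (div_pos_iff_of_pos_right hk').mp c1
  simp only [f, g]
  field_simp

/-! ### Taylor coefficients in the ring of odd zeta values. -/

/-- Real functions analytic at `0` whose derivatives there lie in the ring of odd zeta values. -/
def OddZetaTaylor (f : ℝ → ℝ) : Prop :=
  AnalyticAt ℝ f 0 ∧ ∀ n, iteratedDeriv n f 0 ∈ oddZetaRing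

lemma taylor_of_hasSum {c : ℕ → ℝ} {f : ℝ → ℝ}
    (h : ∀ᶠ t in nhds (0 : ℝ), HasSum (fun n => c n * t ^ n) (f t)) :
    AnalyticAt ℝ f 0 ∧ ∀ n, iteratedDeriv n f 0 = n.factorial * c n := by
  have hp : HasFPowerSeriesAt f (FormalMultilinearSeries.ofScalars ℝ c) 0 := by
    rw [hasFPowerSeriesAt_iff]
    filter_upwards [h] with t ht
    simpa [FormalMultilinearSeries.coeff_ofScalars, mul_comm] using ht
  refine ⟨hp.analyticAt, fun n => ?_⟩
  have := hp.eq_formalMultilinearSeries hp.analyticAt.hasFPowerSeriesAt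
  have h2 := congrArg (fun p => FormalMultilinearSeries.coeff p n) this
  simp only [FormalMultilinearSeries.coeff_ofScalars] at h2
  rw [h2]
  have : (n.factorial : ℝ) ≠ 0 := by exact_mod_cast n.factorial_ne_zero
  field_simp

/-- Since (e^f)' = e^f f', the Leibniz rule expresses each derivative at 0 through lower ones with
natural number coefficients. The condition f 0 = 0 makes the initial value 1. -/
lemma OddZetaTaylor.exp {f : ℝ → ℝ} (hf : OddZetaTaylor f) (h0 : f 0 = 0) :
    OddZetaTaylor fun t => Real.exp (f t) := by
  have hE : AnalyticAt ℝ (fun t => Real.exp (f t)) 0 := hf.1.rexp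
  refine ⟨hE, fun n => ?_⟩
  induction n using Nat.strong_induction_on with
  | _ n ih =>
    cases n with
    | zero => simp [h0, oddZetaRing.one_mem]
    | succ n =>
      have hd : deriv (fun t => Real.exp (f t)) =ᶠ[nhds 0] (fun t => Real.exp (f t)) * deriv f := by
        filter_upwards [hf.1.eventually_analyticAt] with t ht
        simpa using (ht.differentiableAt.hasDerivAt.exp).deriv
      rw [iteratedDeriv_succ', hd.iteratedDeriv_eq, iteratedDeriv_mul hE.contDiffAt
        hf.1.deriv.contDiffAt]
      refine sum_mem fun i hi => ?_
      refine mul_mem (mul_mem (natCast_mem _ _) (ih i (by simpa using hi))) ?_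
      rw [← iteratedDeriv_succ']
      exact hf.2 _

lemma abs_mul_lt_of_lt {K t δ : ℝ} (hK : 0 < K) (a : ℝ) (ha : |a| ≤ K) (ht : |t| < δ / K) :
    |a * t| < δ := by
  rw [abs_mul]
  rw [lt_div_iff₀ hK] at ht
  nlinarith [abs_nonneg t, abs_nonneg a]

lemma ratCast_mem_oddZetaRing (r : ℚ) : (r : ℝ) ∈ oddZetaRing := by
  simpa using oddZetaRing.algebraMap_mem r

lemma oddZetaTaylor_series (α β : ℚ) :
    OddZetaTaylor fun t => oddZetaSeries t - oddZetaSeries (α * t) - oddZetaSeries (β * t) := by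
  let c : ℕ → ℝ := fun n => if 3 ≤ n ∧ Odd n then
    2 / (n : ℝ) * zetaReal n * (1 - α ^ n - β ^ n) else 0
  let K : ℝ := 1 + |(α : ℝ)| + |(β : ℝ)|
  have hK : 0 < K := by positivity
  have hsum : ∀ᶠ t in nhds (0 : ℝ), HasSum (fun n => c n * t ^ n)
      (oddZetaSeries t - oddZetaSeries (α * t) - oddZetaSeries (β * t)) := by
    filter_upwards [Metric.ball_mem_nhds (0 : ℝ) (show 0 < 1 / K by positivity)] with t ht
    rw [mem_ball_zero_iff, Real.norm_eq_abs] at ht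
    have k1 : |t| < 1 := by
      simpa using abs_mul_lt_of_lt hK 1 (by simp only [K, abs_one]; linarith [abs_nonneg (α : ℝ), abs_nonneg (β : ℝ)]) ht
    have k2 := abs_mul_lt_of_lt hK α (by simp only [K]; linarith [abs_nonneg (α : ℝ), abs_nonneg (β : ℝ)]) ht
    have k3 := abs_mul_lt_of_lt hK β (by simp only [K]; linarith [abs_nonneg (α : ℝ), abs_nonneg (β : ℝ)]) ht
    have hinj : Function.Injective fun j : ℕ => 2 * j + 3 := fun a b hab => by
      simp only at hab; omega
    refine (hinj.hasSum_iff ?_).mp (hasSum_of_eq (((hasSum_oddZetaSeries k1).2.sub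
      (hasSum_oddZetaSeries k2).2).sub (hasSum_oddZetaSeries k3).2) (fun j => ?_) rfl)
    · intro n hn
      have : ¬ (3 ≤ n ∧ Odd n) := by
        rintro ⟨h3, m, hm⟩
        exact hn ⟨m - 1, by simp only; omega⟩
      simp only [c, if_neg this, zero_mul]
    · have : 3 ≤ 2 * j + 3 ∧ Odd (2 * j + 3) := ⟨by omega, j + 1, by ring⟩
      simp only [Function.comp_apply, c, if_pos this]
      push_cast
      ring
  obtain ⟨h1, h2⟩ := taylor_of_hasSum hsum
  refine ⟨h1, fun n => ?_⟩
  rw [h2]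
  refine mul_mem (natCast_mem _ _) ?_
  simp only [c]
  split_ifs with hn
  · obtain ⟨h3, m, rfl⟩ := hn
    obtain ⟨j, rfl⟩ : ∃ j, m = j + 1 := ⟨m - 1, by omega⟩
    refine mul_mem (mul_mem ?_ (zetaReal_odd_mem j)) ?_
    · have := ratCast_mem_oddZetaRing (2 / ((2 * (j + 1) + 1 : ℕ) : ℚ))
      push_cast at this ⊢
      exact this
    · exact_mod_cast ratCast_mem_oddZetaRing (1 - α ^ (2 * (j + 1) + 1) - β ^ (2 * (j + 1) + 1))
  · exact zero_mem _

/-! ### Generating functions of harmonic products. -/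

open Polynomial in
/-- The polynomial `∏_{0 < k ≤ n} (1 + X / k)²`. -/
def harmonicPoly (n : ℕ) : ℝ[X] := ∏ k ∈ Finset.range n, (1 + C (1 / ((k : ℝ) + 1)) * X) ^ 2

/-- The coefficients of `harmonicPoly`. -/
def harmonicCoeff (n r : ℕ) : ℝ := (harmonicPoly n).coeff r

/-- The sum `∑_{n ≥ 1} n^{-k} [X^r] ∏_{0 < i < n} (1 + X / i)²`. -/
def poisedZeta (k r : ℕ) : ℝ := ∑' n : ℕ, harmonicCoeff n r / ((n : ℝ) + 1) ^ k

lemma harmonicPoly_succ (n : ℕ) : harmonicPoly (n + 1)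
    = harmonicPoly n * (1 + Polynomial.C (1 / ((n : ℝ) + 1)) * Polynomial.X) ^ 2 := by
  simp [harmonicPoly, Finset.prod_range_succ]

lemma eval_harmonicPoly (n : ℕ) (s : ℝ) :
    (harmonicPoly n).eval s = ∏ k ∈ Finset.range n, (1 + s / (k + 1)) ^ 2 := by
  simp only [harmonicPoly, Polynomial.eval_prod]
  exact Finset.prod_congr rfl fun k _ => by simp; ring

lemma harmonicCoeff_nonneg (n r : ℕ) : 0 ≤ harmonicCoeff n r := by
  have hmul : ∀ p q : Polynomial ℝ, (∀ i, 0 ≤ p.coeff i) → (∀ i, 0 ≤ q.coeff i) →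
      ∀ i, 0 ≤ (p * q).coeff i := fun p q hp hq i => by
    rw [Polynomial.coeff_mul]
    exact Finset.sum_nonneg fun x _ => mul_nonneg (hp _) (hq _)
  have hlin : ∀ n : ℕ, ∀ i,
      0 ≤ (1 + Polynomial.C (1 / ((n : ℝ) + 1)) * Polynomial.X : Polynomial ℝ).coeff i := by
    intro n i
    rw [Polynomial.coeff_add, Polynomial.coeff_C_mul, Polynomial.coeff_one, Polynomial.coeff_X]
    split_ifs <;> positivity
  unfold harmonicCoeff
  induction n generalizing r with
  | zero => simp only [harmonicPoly, Finset.prod_range_zero, Polynomial.coeff_one]; split_ifs <;> simp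
  | succ n ih =>
    rw [harmonicPoly_succ, sq]
    exact hmul _ _ ih (hmul _ _ (hlin n) (hlin n)) r

/-- With h = 1/(n + 1) one has (1 + h/8)⁴ ≤ 1 + h, and the product of the factors 1 + 1/k
telescopes. The resulting growth √(n + 1) is slow enough for convergence against n^{-2}. -/
lemma eval_harmonicPoly_le (n : ℕ) : (harmonicPoly n).eval (1 / 8) ≤ √((n : ℝ) + 1) := by
  refine Real.le_sqrt_of_sq_le ?_
  induction n with
  | zero => simp [harmonicPoly]
  | succ n ih =>
    rw [harmonicPoly_succ, Polynomial.eval_mul, mul_pow]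
    have hn : (0 : ℝ) < n + 1 := by positivity
    set h : ℝ := 1 / ((n : ℝ) + 1) with hh
    have h0 : 0 < h := by positivity
    have h1 : h ≤ 1 := by
      rw [hh, div_le_one hn]; have : (0 : ℝ) ≤ n := n.cast_nonneg
      linarith
    have e : (((1 + Polynomial.C h * Polynomial.X : Polynomial ℝ) ^ 2).eval (1 / 8)) ^ 2 ≤ 1 + h := by
      simp only [Polynomial.eval_pow, Polynomial.eval_add, Polynomial.eval_one, Polynomial.eval_mul,
        Polynomial.eval_C, Polynomial.eval_X]
      have : (1 + h * (1 / 8)) ^ 2 ≤ 1 + 17 / 64 * h := by nlinarith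
      calc ((1 + h * (1 / 8)) ^ 2) ^ 2 ≤ (1 + 17 / 64 * h) ^ 2 := by gcongr
        _ ≤ 1 + h := by nlinarith
    calc _ ≤ ((n : ℝ) + 1) * (1 + h) := by gcongr
      _ = _ := by rw [hh]; field_simp; push_cast; ring

/-- The coefficients are nonnegative, so each single term is at most the value of the polynomial at
1/8. -/
lemma harmonicCoeff_le (n r : ℕ) : harmonicCoeff n r ≤ 8 ^ r * √((n : ℝ) + 1) := by
  have h : harmonicCoeff n r * (1 / 8) ^ r ≤ (harmonicPoly n).eval (1 / 8) := by
    rw [Polynomial.eval_eq_sum_range]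
    by_cases hr : r ≤ (harmonicPoly n).natDegree
    · exact Finset.single_le_sum (f := fun i => (harmonicPoly n).coeff i * (1 / 8 : ℝ) ^ i)
        (fun i _ => mul_nonneg (harmonicCoeff_nonneg n i) (by positivity))
        (Finset.mem_range.mpr (Nat.lt_succ_of_le hr))
    · rw [harmonicCoeff, Polynomial.coeff_eq_zero_of_natDegree_lt (not_le.mp hr), zero_mul]
      exact Finset.sum_nonneg fun i _ => mul_nonneg (harmonicCoeff_nonneg n i) (by positivity)
  have h2 := h.trans (eval_harmonicPoly_le n)
  rw [one_div, inv_pow, ← div_eq_mul_inv, div_le_iff₀ (by positivity)] at h2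
  linarith

lemma sqrt_div_eq_rpow (n k : ℕ) :
    √((n : ℝ) + 1) / ((n : ℝ) + 1) ^ (k + 2) = (((n + 1 : ℕ) : ℝ) ^ ((k : ℝ) + 3 / 2))⁻¹ := by
  have hn : (0 : ℝ) < n + 1 := by positivity
  rw [Real.sqrt_eq_rpow, ← Real.rpow_natCast, ← Real.rpow_sub hn, ← Real.rpow_neg (by positivity)]
  push_cast
  congr 1; ring

lemma summable_sqrt_div (k : ℕ) :
    Summable fun n : ℕ => √((n : ℝ) + 1) / ((n : ℝ) + 1) ^ (k + 2) := by
  simp_rw [sqrt_div_eq_rpow]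
  have : Summable fun n : ℕ => ((n : ℝ) ^ ((k : ℝ) + 3 / 2))⁻¹ :=
    Real.summable_nat_rpow_inv.mpr (by have : (0 : ℝ) ≤ k := k.cast_nonneg
                                       linarith)
  exact (summable_nat_add_iff 1).mpr this

lemma summable_harmonicCoeff_div (k r : ℕ) :
    Summable fun n : ℕ => harmonicCoeff n r / ((n : ℝ) + 1) ^ (k + 2) := by
  refine Summable.of_nonneg_of_le (fun n => div_nonneg (harmonicCoeff_nonneg n r) (by positivity))
    (fun n => ?_) ((summable_sqrt_div k).mul_left (8 ^ r))
  rw [← mul_div_assoc]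
  exact div_le_div_of_nonneg_right (harmonicCoeff_le n r) (by positivity)

lemma hasSum_harmonicCoeff (n : ℕ) (t : ℝ) :
    HasSum (fun r => harmonicCoeff n r * t ^ r) ((harmonicPoly n).eval t) := by
  rw [Polynomial.eval_eq_sum_range]
  refine hasSum_sum_of_ne_finset_zero fun r hr => ?_
  rw [harmonicCoeff, Polynomial.coeff_eq_zero_of_natDegree_lt (by simpa using hr), zero_mul]

lemma risingProd_succ_div_factorial_sq (s : ℝ) (n : ℕ) :
    (risingProd s (n + 1) / (n + 1).factorial) ^ 2
      = s ^ 2 / ((n : ℝ) + 1) ^ 2 * (harmonicPoly n).eval s := by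
  have h : risingProd (s + 1) n = n.factorial * ∏ k ∈ Finset.range n, (1 + s / (k + 1)) := by
    rw [← risingProd_one, risingProd, risingProd, ← Finset.prod_mul_distrib]
    refine Finset.prod_congr rfl fun k _ => ?_
    have : (k : ℝ) + 1 ≠ 0 := by positivity
    field_simp
    ring
  have hf : (n.factorial : ℝ) ≠ 0 := by exact_mod_cast n.factorial_ne_zero
  rw [risingProd_succ', h, eval_harmonicPoly, Finset.prod_pow, Nat.factorial_succ]
  push_cast
  field_simp

/-- The Taylor coefficients of the well-poised sum along the line `(α t, β t)`. -/
def poisedTaylorCoeff (α β : ℝ) (p : ℕ) : ℝ :=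
  ∑ x ∈ Finset.HasAntidiagonal.antidiagonal p, (-1) ^ x.2 * (α ^ x.2 + β ^ x.2) * poisedZeta (x.2 + 3) x.1

/-- Expand the polynomial in t and the two fractions geometrically. The triple series is absolutely
convergent, as 8ʳ against |t|ʳ ≤ 16^{-r} leaves 2^{-r}; hence it may be regrouped by total degree in
t. -/
lemma hasSum_poisedTaylor {α β t : ℝ} (ht : |t| ≤ 1 / 16) (hα : |α * t| ≤ 1 / 2)
    (hβ : |β * t| ≤ 1 / 2) :
    HasSum (fun p => poisedTaylorCoeff α β p * t ^ p)
      (∑' n : ℕ, 1 / ((n : ℝ) + 1) ^ 2 * (harmonicPoly n).eval t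
        * (1 / (n + 1 + α * t) + 1 / (n + 1 + β * t))) := by
  let F : ℕ × (ℕ × ℕ) → ℝ := fun q => harmonicCoeff q.1 q.2.1 / ((q.1 : ℝ) + 1) ^ (q.2.2 + 3)
    * ((-1) ^ q.2.2 * (α ^ q.2.2 + β ^ q.2.2)) * t ^ (q.2.1 + q.2.2)
  have hF : Summable F := by
    have g2 : Summable fun r : ℕ => (1 / 2 : ℝ) ^ r :=
      summable_geometric_of_lt_one (by norm_num) (by norm_num)
    refine Summable.of_norm_bounded ((summable_sqrt_div 1).mul_of_nonneg
      (g2.mul_of_nonneg (g2.mul_left 2) (fun _ => by positivity) (fun _ => by positivity))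
      (fun _ => by positivity) (fun _ => by positivity)) fun ⟨n, r, k⟩ => ?_
    simp only [F]
    have e1 : |harmonicCoeff n r / ((n : ℝ) + 1) ^ (k + 3)|
        ≤ 8 ^ r * (√((n : ℝ) + 1) / ((n : ℝ) + 1) ^ (1 + 2)) := by
      rw [abs_of_nonneg (div_nonneg (harmonicCoeff_nonneg n r) (by positivity)), ← mul_div_assoc]
      refine div_le_div₀ (by positivity) (harmonicCoeff_le n r) (by positivity) ?_
      refine pow_le_pow_right₀ ?_ (by omega)
      have : (0 : ℝ) ≤ n := n.cast_nonneg
      linarith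
    have e2 : |(-1) ^ k * (α ^ k + β ^ k) * t ^ k| ≤ 2 * (1 / 2) ^ k := by
      rw [mul_assoc, abs_mul, abs_pow, abs_neg, abs_one, one_pow, one_mul, add_mul, ← mul_pow,
        ← mul_pow]
      refine (abs_add_le _ _).trans ?_
      rw [abs_pow, abs_pow, two_mul]
      gcongr
    have e3 : |t ^ r| ≤ (1 / 16) ^ r := by rw [abs_pow]; gcongr
    calc ‖harmonicCoeff n r / ((n : ℝ) + 1) ^ (k + 3) * ((-1) ^ k * (α ^ k + β ^ k)) * t ^ (r + k)‖
        = |harmonicCoeff n r / ((n : ℝ) + 1) ^ (k + 3)| * |t ^ r|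
            * |(-1) ^ k * (α ^ k + β ^ k) * t ^ k| := by
          rw [Real.norm_eq_abs, ← abs_mul, ← abs_mul]; congr 1; ring
      _ ≤ (8 ^ r * (√((n : ℝ) + 1) / ((n : ℝ) + 1) ^ (1 + 2))) * (1 / 16) ^ r
            * (2 * (1 / 2) ^ k) := by gcongr
      _ = _ := by
        have : (1 / 16 : ℝ) ^ r = (1 / 8) ^ r * (1 / 2) ^ r := by rw [← mul_pow]; norm_num
        have h8 : (8 : ℝ) ^ r * (1 / 8) ^ r = 1 := by rw [← mul_pow]; norm_num
        rw [this]
        linear_combination (√((n : ℝ) + 1) / ((n : ℝ) + 1) ^ (1 + 2) * (1 / 2) ^ r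
          * (2 * (1 / 2) ^ k)) * h8
  have geo : ∀ a : ℝ, |a * t| ≤ 1 / 2 → ∀ n : ℕ,
      HasSum (fun k : ℕ => (-1) ^ k * a ^ k * t ^ k / ((n : ℝ) + 1) ^ (k + 1))
        (1 / (n + 1 + a * t)) := by
    intro a ha n
    have hn : (0 : ℝ) ≤ n := n.cast_nonneg
    have hlt : |-(a * t) / ((n : ℝ) + 1)| < 1 := by
      rw [abs_div, abs_neg, abs_of_pos (by positivity : (0 : ℝ) < (n : ℝ) + 1),
        div_lt_one (by positivity)]
      linarith
    have hne : (n : ℝ) + 1 + a * t ≠ 0 := by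
      have := neg_abs_le (a * t)
      intro h; linarith
    refine hasSum_of_eq ((hasSum_geometric_of_abs_lt_one hlt).mul_left (1 / ((n : ℝ) + 1)))
      (fun k => ?_) ?_
    · rw [div_pow, neg_pow, mul_pow, pow_succ]; field_simp
    · have : (n : ℝ) + 1 ≠ 0 := by positivity
      field_simp
      rw [div_eq_one_iff_eq]
      · ring
      · intro h; apply hne; linear_combination h
  have inner : ∀ n : ℕ, HasSum (fun x : ℕ × ℕ => F (n, x))
      (1 / ((n : ℝ) + 1) ^ 2 * (harmonicPoly n).eval t
        * (1 / (n + 1 + α * t) + 1 / (n + 1 + β * t))) := by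
    intro n
    have h1 := (hasSum_harmonicCoeff n t).mul_left (1 / ((n : ℝ) + 1) ^ 2)
    have h2 := (geo α hα n).add (geo β hβ n)
    refine hasSum_of_eq (h1.mul h2 ?_) (fun ⟨r, k⟩ => ?_) rfl
    · refine (hF.comp_injective (Prod.mk_right_injective n)).congr fun ⟨r, k⟩ => ?_
      simp only [F, Function.comp_apply]
      field_simp
      ring
    · simp only [F]
      field_simp
      ring
  have total := hF.hasSum.prod_fiberwise inner
  have hsw := ((Equiv.prodComm (ℕ × ℕ) ℕ).hasSum_iff.mpr hF.hasSum).prod_fiberwise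
    (g := fun x : ℕ × ℕ => (-1) ^ x.2 * (α ^ x.2 + β ^ x.2) * poisedZeta (x.2 + 3) x.1
      * t ^ (x.1 + x.2)) (fun ⟨r, k⟩ => by
        refine hasSum_of_eq ((summable_harmonicCoeff_div (k + 1) r).hasSum.mul_right
          ((-1) ^ k * (α ^ k + β ^ k) * t ^ (r + k))) (fun n => ?_) ?_
        · simp only [F, Function.comp_apply, Equiv.prodComm_apply, Prod.swap_prod_mk]
          ring
        · simp only [poisedZeta]; ring)
  rw [← total.tsum_eq] at hsw
  have := (Finset.HasAntidiagonal.sigmaAntidiagonalEquivProd (A := ℕ)).hasSum_iff.mpr hsw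
  refine HasSum.sigma this fun p => ?_
  have e : poisedTaylorCoeff α β p * t ^ p
      = ∑ x : Finset.HasAntidiagonal.antidiagonal p, (-1) ^ x.1.2 * (α ^ x.1.2 + β ^ x.1.2)
        * poisedZeta (x.1.2 + 3) x.1.1 * t ^ (x.1.1 + x.1.2) := by
    rw [poisedTaylorCoeff, Finset.sum_mul, ← Finset.sum_attach]
    refine Finset.sum_congr rfl fun x _ => ?_
    rw [Finset.HasAntidiagonal.mem_antidiagonal.mp x.2]
  rw [e]
  exact hasSum_fintype _

lemma oddZetaSeries_zero : oddZetaSeries 0 = 0 := by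
  simp [oddZetaSeries]

/-- On the line (αt, βt) with α + β = 1 the parameter s is t. The zeroth term of the well-poised
series is 1/(αβt), in the others 2n + t is the sum of the two denominators; multiply by αβt. -/
lemma poised_sum_eq {α β t : ℝ} (h : α + β = 1) (hα : α ≠ 0) (hβ : β ≠ 0) (ht : -(1 / 16) < t)
    (ht0 : t < 0) (hαt : |α * t| < 1 / 2) (hβt : |β * t| < 1 / 2) :
    1 + α * β * t ^ 3 * (∑' n : ℕ, 1 / ((n : ℝ) + 1) ^ 2 * (harmonicPoly n).eval t
        * (1 / (n + 1 + α * t) + 1 / (n + 1 + β * t)))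
      = Real.exp (oddZetaSeries t - oddZetaSeries (α * t) - oddZetaSeries (β * t)) := by
  have hs : α * t + β * t = t := by rw [← add_mul, h, one_mul]
  have hA := tendsto_poised_product (x := α * t) (y := β * t) (by rw [hs]; linarith)
    (by rw [hs]; linarith) hαt hβt (mul_ne_zero hα ht0.ne) (mul_ne_zero hβ ht0.ne)
  have hB := (tendsto_exp_oddZetaSeries (x := α * t) (y := β * t)
    (by rw [hs, abs_lt]; constructor <;> linarith) (by linarith) (by linarith)).const_mul
      ((α * t + β * t) / (α * t * (β * t)))
  have key := tendsto_nhds_unique hB hA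
  have hsum := (summable_poised (x := α * t) (y := β * t) (by rw [hs]; linarith)
    (by rw [hs]; linarith) hαt hβt).of_abs
  rw [hsum.tsum_eq_zero_add] at key
  rw [hs] at key
  have e : ∀ n : ℕ, (risingProd t (n + 1) / (n + 1).factorial) ^ 2
      * ((2 * ((n + 1 : ℕ) : ℝ) + t) / ((((n + 1 : ℕ) : ℝ) + α * t) * (((n + 1 : ℕ) : ℝ) + β * t)))
      = t ^ 2 * (1 / ((n : ℝ) + 1) ^ 2 * (harmonicPoly n).eval t
        * (1 / (n + 1 + α * t) + 1 / (n + 1 + β * t))) := by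
    intro n
    have hn : (0 : ℝ) ≤ n := n.cast_nonneg
    have p1 : (n : ℝ) + 1 + α * t ≠ 0 := by
      have := (abs_lt.mp hαt).1
      intro h; linarith
    have p2 : (n : ℝ) + 1 + β * t ≠ 0 := by
      have := (abs_lt.mp hβt).1
      intro h; linarith
    rw [risingProd_succ_div_factorial_sq]
    push_cast
    rw [div_add_div _ _ p1 p2]
    have : 2 * ((n : ℝ) + 1) + t = 1 * (n + 1 + β * t) + (n + 1 + α * t) * 1 := by
      linear_combination -hs
    rw [this]
    ring
  simp_rw [e] at key
  rw [tsum_mul_left] at key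
  have z0 : (risingProd t 0 / (Nat.factorial 0 : ℕ)) ^ 2
      * ((2 * ((0 : ℕ) : ℝ) + t) / ((((0 : ℕ) : ℝ) + α * t) * (((0 : ℕ) : ℝ) + β * t)))
      = t / (α * t * (β * t)) := by simp [risingProd]
  rw [z0] at key
  have ht' := ht0.ne
  generalize (∑' n : ℕ, 1 / ((n : ℝ) + 1) ^ 2 * (harmonicPoly n).eval t
        * (1 / (n + 1 + α * t) + 1 / (n + 1 + β * t))) = S at *
  generalize Real.exp (oddZetaSeries t - oddZetaSeries (α * t) - oddZetaSeries (β * t)) = E at *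
  field_simp at key
  rw [key]
  ring

/-- Both sides of `poised_sum_eq` are analytic at 0 and agree for small negative t, hence near 0, so
their Taylor coefficients agree. Rationality of α and β permits the final division by αβ inside the
ring. -/
lemma poisedTaylorCoeff_mem (α β : ℚ) (h : α + β = 1) (hα : α ≠ 0) (hβ : β ≠ 0) (p : ℕ) :
    poisedTaylorCoeff α β p ∈ oddZetaRing := by
  let K : ℝ := 1 + |(α : ℝ)| + |(β : ℝ)|
  have hK : 0 < K := by positivity
  have hE : OddZetaTaylor fun t => Real.exp
      (oddZetaSeries t - oddZetaSeries (α * t) - oddZetaSeries (β * t)) :=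
    (oddZetaTaylor_series α β).exp (by simp [oddZetaSeries_zero])
  have hsmall : ∀ t : ℝ, |t| < 1 / 16 / K → |t| < 1 / 16 ∧ |α * t| < 1 / 2 ∧ |β * t| < 1 / 2 := by
    intro t ht
    have k1 := abs_mul_lt_of_lt hK 1 (by
      simp only [K, abs_one]; linarith [abs_nonneg (α : ℝ), abs_nonneg (β : ℝ)]) ht
    have k2 := abs_mul_lt_of_lt hK α (by
      simp only [K]; linarith [abs_nonneg (α : ℝ), abs_nonneg (β : ℝ)]) ht
    have k3 := abs_mul_lt_of_lt hK β (by
      simp only [K]; linarith [abs_nonneg (α : ℝ), abs_nonneg (β : ℝ)]) ht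
    rw [one_mul] at k1
    exact ⟨k1, by linarith, by linarith⟩
  let g : ℝ → ℝ := fun t => 1 + α * β * t ^ 3 * (∑' n : ℕ, 1 / ((n : ℝ) + 1) ^ 2
    * (harmonicPoly n).eval t * (1 / (n + 1 + α * t) + 1 / (n + 1 + β * t)))
  let c : ℕ → ℝ := fun n => match n with
    | 0 => 1
    | 1 => 0
    | 2 => 0
    | n + 3 => α * β * poisedTaylorCoeff α β n
  have hg : ∀ᶠ t in nhds (0 : ℝ), HasSum (fun n => c n * t ^ n) (g t) := by
    filter_upwards [Metric.ball_mem_nhds (0 : ℝ) (show 0 < 1 / 16 / K by positivity)] with t ht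
    rw [mem_ball_zero_iff, Real.norm_eq_abs] at ht
    obtain ⟨h1, h2, h3⟩ := hsmall t ht
    have := (hasSum_poisedTaylor h1.le h2.le h3.le).mul_left (α * β * t ^ 3)
    rw [← hasSum_nat_add_iff' 3]
    refine hasSum_of_eq this (fun n => ?_) ?_
    · simp only [c]; ring
    · simp only [Finset.sum_range_succ, Finset.sum_range_zero, c, g]; ring
  obtain ⟨hga, hgd⟩ := taylor_of_hasSum hg
  have hfreq : ∃ᶠ t in nhdsWithin (0 : ℝ) {0}ᶜ, g t = Real.exp
      (oddZetaSeries t - oddZetaSeries (α * t) - oddZetaSeries (β * t)) := by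
    have hle : nhdsWithin (0 : ℝ) (Set.Iio 0) ≤ nhdsWithin (0 : ℝ) {0}ᶜ :=
      nhdsWithin_mono _ fun t ht => ne_of_lt ht
    refine Frequently.filter_mono (Eventually.frequently ?_) hle
    filter_upwards [self_mem_nhdsWithin, mem_nhdsWithin_of_mem_nhds
      (Metric.ball_mem_nhds (0 : ℝ) (show 0 < 1 / 16 / K by positivity))] with t ht0 ht
    rw [mem_ball_zero_iff, Real.norm_eq_abs] at ht
    obtain ⟨h1, h2, h3⟩ := hsmall t ht
    exact poised_sum_eq (by exact_mod_cast h) (by exact_mod_cast hα) (by exact_mod_cast hβ)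
      (abs_lt.mp h1).1 ht0 h2 h3
  have heq : g =ᶠ[nhds 0] fun t => Real.exp
      (oddZetaSeries t - oddZetaSeries (α * t) - oddZetaSeries (β * t)) := (hga.frequently_eq_iff_eventually_eq hE.1).mp hfreq
  have h1 := hE.2 (p + 3)
  rw [← heq.iteratedDeriv_eq, hgd] at h1
  have hq : (((p + 3).factorial * (α * β) : ℚ) : ℝ) ≠ 0 := by
    exact_mod_cast mul_ne_zero (by exact_mod_cast (p + 3).factorial_ne_zero) (mul_ne_zero hα hβ)
  have h2 := mul_mem (ratCast_mem_oddZetaRing ((p + 3).factorial * (α * β))⁻¹) h1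
  have h3 : (((((p + 3).factorial * (α * β))⁻¹ : ℚ)) : ℝ) * ((p + 3).factorial * c (p + 3))
      = poisedTaylorCoeff α β p := by
    simp only [c]
    push_cast at hq ⊢
    field_simp
  rwa [h3] at h2

/-- The Vandermonde matrix on the nodes 0², 1², …, p² has a rational inverse. -/
lemma mem_of_sum_pow_sq_mem {p : ℕ} (c : Fin (p + 1) → ℝ)
    (h : ∀ i : ℕ, ∑ a, c a * ((i : ℝ) ^ 2) ^ (a : ℕ) ∈ oddZetaRing) (a : Fin (p + 1)) :
    c a ∈ oddZetaRing := by
  let v : Fin (p + 1) → ℚ := fun i => ((i : ℕ) : ℚ) ^ 2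
  have hinj : Function.Injective v := fun i j hij => by
    have : (i : ℕ) = (j : ℕ) := by
      have := (sq_eq_sq₀ (Nat.cast_nonneg _) (Nat.cast_nonneg _)).mp hij
      exact_mod_cast this
    exact Fin.ext this
  have hdet : IsUnit (Matrix.vandermonde v).det :=
    isUnit_iff_ne_zero.mpr (Matrix.det_vandermonde_ne_zero_iff.mpr hinj)
  obtain ⟨N, hN⟩ : ∃ N : Fin (p + 1) → Fin (p + 1) → ℚ,
      ∀ a b : Fin (p + 1), ∑ i, N a i * v i ^ (b : ℕ) = if a = b then 1 else 0 := by
    refine ⟨fun a i => (Matrix.vandermonde v)⁻¹ a i, fun a b => ?_⟩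
    have := congrFun (congrFun (Matrix.nonsing_inv_mul _ hdet) a) b
    rwa [Matrix.mul_apply, Matrix.one_apply] at this
  have hc : c a = ∑ i : Fin (p + 1), (N a i : ℝ)
      * ∑ b, c b * ((((i : ℕ) : ℝ)) ^ 2) ^ (b : ℕ) := by
    simp_rw [Finset.mul_sum]
    rw [Finset.sum_comm]
    have : ∀ b, ∑ i : Fin (p + 1), (N a i : ℝ) * (c b * ((((i : ℕ) : ℝ)) ^ 2) ^ (b : ℕ))
        = c b * if a = b then 1 else 0 := by
      intro b
      have h2 := congrArg (fun q : ℚ => (q : ℝ)) (hN a b)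
      simp only [v] at h2
      push_cast at h2
      rw [show ((if a = b then (1 : ℚ) else 0 : ℚ) : ℝ) = if a = b then 1 else 0 by
        split_ifs <;> simp] at h2
      rw [← h2, Finset.mul_sum]
      exact Finset.sum_congr rfl fun i _ => by ring
    simp_rw [this]
    simp
  rw [hc]
  exact sum_mem fun i _ => mul_mem (ratCast_mem_oddZetaRing _) (h i)

lemma sum_range_two_mul (f : ℕ → ℝ) (n : ℕ) :
    ∑ m ∈ Finset.range (2 * n), f m = ∑ a ∈ Finset.range n, (f (2 * a) + f (2 * a + 1)) := by
  induction n with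
  | zero => simp
  | succ n ih =>
    rw [show 2 * (n + 1) = 2 * n + 1 + 1 by ring, Finset.sum_range_succ, Finset.sum_range_succ, ih,
      Finset.sum_range_succ]
    ring

lemma half_sub_pow_add_half_add_pow (x : ℝ) {k p : ℕ} (hk : k ≤ p) :
    (1 / 2 - x) ^ k + (1 / 2 + x) ^ k
      = ∑ a : Fin (p + 1), 2 * (k.choose (2 * a)) * (1 / 2) ^ (k - 2 * a) * (x ^ 2) ^ (a : ℕ) := by
  have hpow : ∀ z : ℝ, (z + 1 / 2) ^ k
      = ∑ m ∈ Finset.range (2 * (p + 1)), z ^ m * (1 / 2) ^ (k - m) * (k.choose m) := by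
    intro z
    rw [add_pow]
    refine Finset.sum_subset (fun m hm => ?_) fun m _ hm => ?_
    · have := Finset.mem_range.mp hm
      exact Finset.mem_range.mpr (by omega)
    · rw [Nat.choose_eq_zero_of_lt (by simpa using hm)]; simp
  rw [show 1 / 2 - x = -x + 1 / 2 by ring, show 1 / 2 + x = x + 1 / 2 by ring, hpow, hpow,
    ← Finset.sum_add_distrib, sum_range_two_mul, Finset.sum_range]
  refine Finset.sum_congr rfl fun a _ => ?_
  rw [(even_two_mul (a : ℕ)).neg_pow, (odd_two_mul_add_one (a : ℕ)).neg_pow, pow_mul]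
  ring

/-- For α = 1/2 - i and β = 1/2 + i the sum αᵏ + βᵏ is a polynomial in i², whose coefficients are
then separated by varying i. Half-integers are never 0, as `poisedTaylorCoeff_mem` demands. -/
lemma poisedZeta_combination_mem (a p : ℕ) :
    ∑ x ∈ Finset.HasAntidiagonal.antidiagonal p, (-1 : ℝ) ^ x.2 * (x.2.choose (2 * a))
      * (1 / 2) ^ (x.2 - 2 * a) * poisedZeta (x.2 + 3) x.1 ∈ oddZetaRing := by
  by_cases ha : p < a
  · rw [Finset.sum_eq_zero]
    · exact zero_mem _
    · intro x hx
      have := Finset.HasAntidiagonal.mem_antidiagonal.mp hx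
      rw [Nat.choose_eq_zero_of_lt (by omega)]
      simp
  have h := mem_of_sum_pow_sq_mem (p := p) (fun a => 2 * ∑ x ∈ Finset.HasAntidiagonal.antidiagonal p,
    (-1 : ℝ) ^ x.2 * (x.2.choose (2 * a)) * (1 / 2) ^ (x.2 - 2 * a) * poisedZeta (x.2 + 3) x.1)
    (fun i => ?_) ⟨a, by omega⟩
  · have h2 := mul_mem (ratCast_mem_oddZetaRing (1 / 2)) h
    push_cast at h2
    rwa [← mul_assoc, one_div_mul_cancel two_ne_zero, one_mul] at h2
  · have h2 := poisedTaylorCoeff_mem (1 / 2 - i) (1 / 2 + i) (by ring) ?_ (by positivity) p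
    · convert h2 using 1
      push_cast
      rw [poisedTaylorCoeff]
      simp_rw [Finset.mul_sum, Finset.sum_mul]
      rw [Finset.sum_comm]
      refine Finset.sum_congr rfl fun x hx => ?_
      have := Finset.HasAntidiagonal.mem_antidiagonal.mp hx
      rw [half_sub_pow_add_half_add_pow _ (show x.2 ≤ p by omega), Finset.mul_sum, Finset.sum_mul]
      refine Finset.sum_congr rfl fun b _ => ?_
      ring
    · intro h0
      have : (2 * i : ℚ) = 1 := by linarith
      have : 2 * i = 1 := by exact_mod_cast this
      omega

/-! ### Multiple zeta values as coefficients of harmonic products. -/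

open Classical in
/-- The strictly increasing `j`-tuples with entries in `{1, …, n}`. -/
def strictTuples (j n : ℕ) : Finset (Fin j → ℕ) :=
  (Fintype.piFinset fun _ : Fin j => Finset.Icc 1 n).filter StrictMono

lemma mem_strictTuples {j n : ℕ} {m : Fin j → ℕ} :
    m ∈ strictTuples j n ↔ StrictMono m ∧ (∀ i, 0 < m i) ∧ ∀ i, m i ≤ n := by
  simp only [strictTuples, Finset.mem_filter, Fintype.mem_piFinset, Finset.mem_Icc]
  constructor
  · rintro ⟨h, hm⟩; exact ⟨hm, fun i => (h i).1, fun i => (h i).2⟩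
  · rintro ⟨hm, h1, h2⟩; exact ⟨fun i => ⟨h1 i, h2 i⟩, hm⟩

lemma strictMono_snoc {j N : ℕ} {m : Fin j → ℕ} (hm : m ∈ strictTuples j N) :
    StrictMono (Fin.snoc (α := fun _ => ℕ) m (N + 1)) := by
  obtain ⟨h1, _, h3⟩ := mem_strictTuples.mp hm
  intro a b hab
  induction b using Fin.lastCases with
  | last =>
    induction a using Fin.lastCases with
    | last => exact absurd hab (lt_irrefl _)
    | cast a => simpa using Nat.lt_succ_of_le (h3 a)
  | cast b =>
    induction a using Fin.lastCases with
    | last => exact absurd hab (not_lt.mpr (Fin.le_last _))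
    | cast a => simpa using h1 (by simpa using hab)

lemma snoc_pos {j N : ℕ} {m : Fin j → ℕ} (hm : m ∈ strictTuples j N) (i : Fin (j + 1)) :
    0 < (Fin.snoc (α := fun _ => ℕ) m (N + 1)) i := by
  induction i using Fin.lastCases with
  | last => simp
  | cast i => simpa using (mem_strictTuples.mp hm).2.1 i

lemma init_mem_strictTuples {j : ℕ} {m : Fin (j + 1) → ℕ} (hm : StrictMono m) (h0 : ∀ i, 0 < m i) :
    Fin.init m ∈ strictTuples j (m (Fin.last j) - 1) := by
  refine mem_strictTuples.mpr ⟨fun a b hab => hm (by simpa using hab), fun i => h0 _, fun i => ?_⟩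
  have : m i.castSucc < m (Fin.last j) := hm (Fin.castSucc_lt_last i)
  simp only [Fin.init]; omega

/-- Sort the tuples by their largest entry N + 1; the other entries form a tuple bounded by N. The
shift matches the denominators n + 1 of `poisedZeta`. -/
lemma sum_strictTuples_succ {E : Type*} [AddCommMonoid E] (j n : ℕ) (F : (Fin (j + 1) → ℕ) → E) :
    ∑ m ∈ strictTuples (j + 1) n, F m
      = ∑ N ∈ Finset.range n, ∑ m ∈ strictTuples j N, F (Fin.snoc (α := fun _ => ℕ) m (N + 1)) := by
  rw [Finset.sum_sigma']
  refine Finset.sum_bij' (fun m _ => ⟨m (Fin.last j) - 1, Fin.init m⟩)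
    (fun x _ => Fin.snoc (α := fun _ => ℕ) x.2 (x.1 + 1)) ?_ ?_ ?_ ?_ ?_
  · intro m hm
    obtain ⟨h1, h2, h3⟩ := mem_strictTuples.mp hm
    refine Finset.mem_sigma.mpr ⟨Finset.mem_range.mpr ?_, init_mem_strictTuples h1 h2⟩
    have := h2 (Fin.last j)
    have := h3 (Fin.last j)
    simp only
    omega
  · intro x hx
    obtain ⟨h1, h2⟩ := Finset.mem_sigma.mp hx
    refine mem_strictTuples.mpr ⟨strictMono_snoc h2, snoc_pos h2, fun i => ?_⟩
    have h1 := Finset.mem_range.mp h1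
    induction i using Fin.lastCases with
    | last => simpa using h1
    | cast i =>
      have := (mem_strictTuples.mp h2).2.2 i
      simp only [Fin.snoc_castSucc]
      omega
  · intro m hm
    have := (mem_strictTuples.mp hm).2.1 (Fin.last j)
    simp only
    rw [Nat.sub_add_cancel this]
    exact Fin.snoc_init_self m
  · intro x _
    simp
  · intro m hm
    have := (mem_strictTuples.mp hm).2.1 (Fin.last j)
    simp only
    rw [Nat.sub_add_cancel this, Fin.snoc_init_self]

open Polynomial in
/-- The polynomial `2X/k + X²/k²`. -/
def harmonicStep (k : ℕ) : ℝ[X] := ∑ x ∈ ({1, 2} : Finset ℕ),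
  C ((if x = 1 then 2 else 1) * ((k : ℝ) ^ x)⁻¹) * X ^ x

lemma one_add_harmonicStep (n : ℕ) : 1 + harmonicStep (n + 1)
    = (1 + Polynomial.C (1 / ((n : ℝ) + 1)) * Polynomial.X) ^ 2 := by
  have h : (Polynomial.C (((n : ℝ) + 1) ^ 2)⁻¹ : Polynomial ℝ) = Polynomial.C (1 / ((n : ℝ) + 1)) ^ 2 := by
    rw [← Polynomial.C_pow]; congr 1; rw [one_div, inv_pow]
  simp only [harmonicStep]
  rw [Finset.sum_pair (by norm_num)]
  simp only [if_true, Polynomial.C_mul, Nat.cast_add, Nat.cast_one, pow_one]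
  norm_num
  rw [h]
  ring_nf
  simp [Polynomial.C_ofNat]
  try ring

lemma sum_strictTuples_eq_zero {E : Type*} [AddCommMonoid E] {j n : ℕ} (h : n < j)
    (F : (Fin j → ℕ) → E) : ∑ m ∈ strictTuples j n, F m = 0 := by
  induction j generalizing n with
  | zero => omega
  | succ j ih =>
    rw [sum_strictTuples_succ]
    refine Finset.sum_eq_zero fun N hN => ih ?_ _
    have := Finset.mem_range.mp hN
    omega

/-- Expanding the product of factors 1 + `harmonicStep k` means choosing a set of indices k, that
is, a strictly increasing tuple. The induction separates tuples by whether n + 1 is used. -/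
lemma harmonicPoly_eq_sum (n : ℕ) : harmonicPoly n
    = ∑ j ∈ Finset.range (n + 1), ∑ m ∈ strictTuples j n, ∏ i, harmonicStep (m i) := by
  have hz : ∀ n, ∑ m ∈ strictTuples 0 n, ∏ i, harmonicStep (m i) = 1 := by
    intro n
    have : strictTuples 0 n = Finset.univ := by
      ext m
      simp only [mem_strictTuples, Finset.mem_univ, iff_true]
      exact ⟨Subsingleton.strictMono m, fun i => i.elim0, fun i => i.elim0⟩
    rw [this]; simp
  induction n with
  | zero =>
    rw [zero_add, Finset.sum_range_one, hz]
    simp [harmonicPoly]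
  | succ n ih =>
    have hrec : ∀ j, ∑ m ∈ strictTuples (j + 1) (n + 1), ∏ i, harmonicStep (m i)
        = ∑ m ∈ strictTuples (j + 1) n, ∏ i, harmonicStep (m i)
          + (∑ m ∈ strictTuples j n, ∏ i, harmonicStep (m i)) * harmonicStep (n + 1) := by
      intro j
      rw [sum_strictTuples_succ, Finset.sum_range_succ, ← sum_strictTuples_succ j n (fun m =>
        ∏ i, harmonicStep (m i)), Finset.sum_mul]
      congr 1
      refine Finset.sum_congr rfl fun m _ => ?_
      rw [Fin.prod_univ_castSucc]
      simp
    have hshift : ∑ j ∈ Finset.range (n + 1), ∑ m ∈ strictTuples (j + 1) n, ∏ i, harmonicStep (m i)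
        + 1 = ∑ j ∈ Finset.range (n + 1), ∑ m ∈ strictTuples j n, ∏ i, harmonicStep (m i) := by
      have h1 := Finset.sum_range_succ' (fun j => ∑ m ∈ strictTuples j n, ∏ i, harmonicStep (m i))
        (n + 1)
      rw [Finset.sum_range_succ, sum_strictTuples_eq_zero (Nat.lt_succ_self n), add_zero, hz] at h1
      exact h1.symm
    rw [harmonicPoly_succ, ← one_add_harmonicStep, ih, Finset.sum_range_succ' _ (n + 1), hz]
    simp_rw [hrec]
    rw [Finset.sum_add_distrib, ← Finset.sum_mul, ← hshift]
    ring

/-- The truncated multiple zeta value, over entries at most `n`. -/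
def truncZeta {j : ℕ} (e : Fin j → ℕ) (n : ℕ) : ℝ :=
  ∑ m ∈ strictTuples j n, ∏ i, ((m i : ℝ) ^ e i)⁻¹

lemma truncZeta_nonneg {j : ℕ} (e : Fin j → ℕ) (n : ℕ) : 0 ≤ truncZeta e n :=
  Finset.sum_nonneg fun m _ => Finset.prod_nonneg fun i _ => by positivity

lemma coeff_sum_prod_harmonicStep (j n r : ℕ) :
    (∑ m ∈ strictTuples j n, ∏ i, harmonicStep (m i)).coeff r
      = ∑ e ∈ (Fintype.piFinset fun _ : Fin j => ({1, 2} : Finset ℕ)) with ∑ i, e i = r,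
        2 ^ (Finset.univ.filter fun i => e i = 1).card * truncZeta e n := by
  have h : ∀ m : Fin j → ℕ, ∏ i, harmonicStep (m i)
      = ∑ e ∈ Fintype.piFinset fun _ : Fin j => ({1, 2} : Finset ℕ),
        Polynomial.C (2 ^ (Finset.univ.filter fun i => e i = 1).card * ∏ i, ((m i : ℝ) ^ e i)⁻¹)
          * Polynomial.X ^ (∑ i, e i) := by
    intro m
    simp only [harmonicStep]
    rw [Finset.prod_univ_sum]
    refine Finset.sum_congr rfl fun e _ => ?_
    rw [Finset.prod_mul_distrib, Finset.prod_pow_eq_pow_sum, ← map_prod, Finset.prod_mul_distrib,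
      Finset.prod_ite]
    simp
  simp_rw [h]
  rw [Finset.sum_comm, Polynomial.finsetSum_coeff, Finset.sum_filter]
  refine Finset.sum_congr rfl fun e _ => ?_
  rw [← Finset.sum_mul, ← map_sum, Polynomial.coeff_C_mul, Polynomial.coeff_X_pow, truncZeta,
    ← Finset.mul_sum]
  by_cases hr : ∑ i, e i = r
  · simp [hr]
  · simp [hr, Ne.symm hr]

/-- Tuples longer than n do not exist, and those longer than r have exponent sum above r. So the
cutoff n may be traded for the cutoff r, which is uniform in n. -/
lemma harmonicCoeff_eq_sum (n r : ℕ) : harmonicCoeff n r = ∑ j ∈ Finset.range (r + 1),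
    ∑ e ∈ (Fintype.piFinset fun _ : Fin j => ({1, 2} : Finset ℕ)) with ∑ i, e i = r,
        2 ^ (Finset.univ.filter fun i => e i = 1).card * truncZeta e n := by
  simp_rw [← coeff_sum_prod_harmonicStep]
  rw [harmonicCoeff, harmonicPoly_eq_sum, Polynomial.finsetSum_coeff]
  have h1 : ∀ j, j ∉ Finset.range (n + 1) →
      (∑ m ∈ strictTuples j n, ∏ i, harmonicStep (m i)).coeff r = 0 := by
    intro j hj
    rw [sum_strictTuples_eq_zero (by simpa using hj), Polynomial.coeff_zero]
  have h2 : ∀ j, j ∉ Finset.range (r + 1) →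
      (∑ m ∈ strictTuples j n, ∏ i, harmonicStep (m i)).coeff r = 0 := by
    intro j hj
    rw [coeff_sum_prod_harmonicStep, Finset.filter_false_of_mem, Finset.sum_empty]
    intro e he hsum
    have : ∑ i : Fin j, 1 ≤ ∑ i, e i := Finset.sum_le_sum fun i _ => by
      have := Fintype.mem_piFinset.mp he i
      simp at this; omega
    simp at this hj
    omega
  rw [Finset.sum_subset (Finset.subset_union_left (s₂ := Finset.range (r + 1)))
    (fun j _ hj => h1 j hj), ← Finset.sum_subset (Finset.subset_union_right
      (s₁ := Finset.range (n + 1))) (fun j _ hj => h2 j hj)]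

/-- The left side is one of the nonnegative terms of `harmonicCoeff_eq_sum`, up to a power of 2.
This yields convergence of the multiple zeta values in `multiZeta_snoc` without a separate estimate.
-/
lemma truncZeta_le {j : ℕ} {e : Fin j → ℕ} (he : ∀ i, e i = 1 ∨ e i = 2) (n : ℕ) :
    truncZeta e n ≤ harmonicCoeff n (∑ i, e i) := by
  rw [harmonicCoeff_eq_sum]
  have hj : j ≤ ∑ i, e i := by
    have : ∑ i : Fin j, 1 ≤ ∑ i, e i := Finset.sum_le_sum fun i _ => by
      rcases he i with h | h <;> omega
    simpa using this
  have hnn : ∀ (j' : ℕ) (e' : Fin j' → ℕ),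
      0 ≤ 2 ^ (Finset.univ.filter fun i => e' i = 1).card * truncZeta e' n :=
    fun j' e' => mul_nonneg (by positivity) (truncZeta_nonneg e' n)
  refine le_trans ?_ (Finset.single_le_sum (fun j' _ => Finset.sum_nonneg fun e' _ => hnn j' e')
    (Finset.mem_range.mpr (Nat.lt_succ_of_le hj)))
  refine le_trans ?_ (Finset.single_le_sum (fun e' _ => hnn j e') (a := e) ?_)
  · exact le_mul_of_one_le_left (truncZeta_nonneg e n) (one_le_pow₀ one_le_two)
  · exact Finset.mem_filter.mpr ⟨Fintype.mem_piFinset.mpr fun i => by simpa using he i, rfl⟩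

/-- A nonempty strictly increasing tuple is determined by its last entry and the other ones. -/
def strictTupleEquiv (j : ℕ) : {n : Fin (j + 1) → ℕ // StrictMono n ∧ ∀ i, 0 < n i}
    ≃ Σ N : ℕ, strictTuples j N where
  toFun n := ⟨n.1 (Fin.last j) - 1, ⟨Fin.init n.1, init_mem_strictTuples n.2.1 n.2.2⟩⟩
  invFun x := ⟨Fin.snoc (α := fun _ => ℕ) x.2.1 (x.1 + 1), strictMono_snoc x.2.2, snoc_pos x.2.2⟩
  left_inv n := by
    apply Subtype.ext
    simp only
    rw [Nat.sub_add_cancel (n.2.2 (Fin.last j)), Fin.snoc_init_self]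
  right_inv x := by
    exact Sigma.subtype_ext (by simp) (by simp)

lemma multiZeta_snoc {j : ℕ} {e : Fin j → ℕ} (he : ∀ i, e i = 1 ∨ e i = 2) (k : ℕ) :
    HasSum (fun N : ℕ => truncZeta e N / ((N : ℝ) + 1) ^ (k + 2))
      (multiZeta (Fin.snoc (α := fun _ => ℕ) e (k + 2))) := by
  have hs : Summable fun N : ℕ => truncZeta e N / ((N : ℝ) + 1) ^ (k + 2) :=
    Summable.of_nonneg_of_le (fun N => div_nonneg (truncZeta_nonneg e N) (by positivity))
      (fun N => div_le_div_of_nonneg_right (truncZeta_le he N) (by positivity))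
      (summable_harmonicCoeff_div k _)
  let F : (Σ N : ℕ, strictTuples j N) → ℝ := fun x =>
    (∏ i, ((x.2.1 i : ℝ) ^ e i)⁻¹) * (((x.1 : ℝ) + 1) ^ (k + 2))⁻¹
  have hinner : ∀ N, ∑' m : strictTuples j N, F ⟨N, m⟩
      = truncZeta e N / ((N : ℝ) + 1) ^ (k + 2) := by
    intro N
    rw [tsum_fintype, truncZeta, Finset.sum_div]
    exact Finset.sum_coe_sort (strictTuples j N)
      (fun m => (∏ i, ((m i : ℝ) ^ e i)⁻¹) / ((N : ℝ) + 1) ^ (k + 2))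
  have hF : Summable F := by
    rw [summable_sigma_of_nonneg (fun x => mul_nonneg (Finset.prod_nonneg fun i _ => by positivity)
      (by positivity))]
    exact ⟨fun N => (hasSum_fintype _).summable, hs.congr fun N => (hinner N).symm⟩
  have : multiZeta (Fin.snoc (α := fun _ => ℕ) e (k + 2)) = ∑' x, F x := by
    rw [multiZeta, ← (strictTupleEquiv j).symm.tsum_eq]
    refine tsum_congr fun x => ?_
    rw [Fin.prod_univ_castSucc]
    simp [F, strictTupleEquiv]
  rw [this, hF.tsum_sigma' (fun N => (hasSum_fintype _).summable)]
  simp_rw [hinner]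
  exact hs.hasSum

theorem specialZ_eq_poisedZeta (k r : ℕ) : specialZ (k + 2) r = poisedZeta (k + 2) r := by
  have h : HasSum (fun n : ℕ => harmonicCoeff n r / ((n : ℝ) + 1) ^ (k + 2)) (specialZ (k + 2) r) := by
    refine hasSum_of_eq (hasSum_sum fun j _ => hasSum_sum fun e he =>
      (multiZeta_snoc (e := e) (fun i => ?_) k).mul_left
        (2 ^ (Finset.univ.filter fun i => e i = 1).card)) (fun n => ?_) rfl
    · have := Fintype.mem_piFinset.mp (Finset.mem_filter.mp he).1 i
      simpa using this
    · rw [harmonicCoeff_eq_sum, Finset.sum_div]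
      refine Finset.sum_congr rfl fun j _ => ?_
      rw [Finset.sum_div]
      exact Finset.sum_congr rfl fun e _ => by ring
  exact h.tsum_eq.symm

/-! ### Arithmetic of the Laurent coefficients. -/

lemma coeff_C_mul_T (a : ℝ) (m n : ℤ) :
    (LaurentPolynomial.C a * LaurentPolynomial.T m : ℝ[T;T⁻¹]).coeff n = if m = n then a else 0 := by
  rw [← LaurentPolynomial.single_eq_C_mul_T]
  exact Finsupp.single_apply

lemma coeff_sum_laurent {ι : Type*} (s : Finset ι) (f : ι → ℝ[T;T⁻¹]) (n : ℤ) :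
    (∑ i ∈ s, f i).coeff n = ∑ i ∈ s, (f i).coeff n := by
  simp

lemma risingProd_eq_ascPochhammer (s : ℝ) (n : ℕ) : risingProd s n = (ascPochhammer ℝ n).eval s := by
  induction n with
  | zero => simp [risingProd]
  | succ n ih => rw [risingProd_succ, ascPochhammer_succ_eval, ih]

/-- The rising factorial of -l of length n is (-1)ⁿ n! times a binomial coefficient, so the series
stops at n = l. -/
lemma hypergeometric_neg_nat_eq_sum (l : ℕ) (z : ℝ) : ₂F₁ (1 : ℝ) (-(l : ℝ)) (3 / 2) z
    = ∑ n ∈ Finset.range (l + 1), (-1) ^ n * (l.choose n) * ((n.factorial : ℝ)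
      / risingProd (3 / 2) n) * z ^ n := by
  have hneg : ∀ n : ℕ, (ascPochhammer ℝ n).eval (-(l : ℝ))
      = (-1) ^ n * (n.factorial * l.choose n) := by
    intro n
    rw [ascPochhammer_eval_neg_eq_descPochhammer, descPochhammer_eval_eq_descFactorial,
      Nat.descFactorial_eq_factorial_mul_choose]
    push_cast
    ring
  rw [ordinaryHypergeometric_eq_tsum]
  simp only
  rw [tsum_eq_sum (s := Finset.range (l + 1))]
  · refine Finset.sum_congr rfl fun n _ => ?_
    have hf : (n.factorial : ℝ) ≠ 0 := by exact_mod_cast n.factorial_ne_zero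
    rw [hneg, ← risingProd_eq_ascPochhammer, ← risingProd_eq_ascPochhammer, risingProd_one,
      smul_eq_mul]
    field_simp
  · intro n hn
    rw [hneg, Nat.choose_eq_zero_of_lt (by simpa using hn)]
    simp

/-- The exponent c - a - 1 depends on a and c only. For fixed a and c the terms, with k = 2a + b and
r = m - 2, form a rational multiple of the combination in `poisedZeta_combination_mem` of degree r +
k = l - 2 - c + a. -/
lemma laurentD_term_group_mem (l a c : ℕ) (n : ℤ) :
    ∑ p ∈ (Finset.Nat.antidiagonalTuple 4 l).filter fun p => 2 ≤ p 3 ∧ p 0 = a ∧ p 2 = c,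
      (if (p 2 : ℤ) - (p 0 : ℤ) - 1 = n then
        (l.factorial : ℝ) * ((2 * p 0 + p 1).factorial : ℝ)
              / (((p 0).factorial : ℝ) * ((p 1).factorial : ℝ) * ((p 2).factorial : ℝ))
            * ((-1) ^ p 1 / (2 ^ (2 * p 0 + p 1) * 6 ^ p 2))
            * specialZ (2 * p 0 + p 1 + 3) (p 3 - 2) else 0) ∈ oddZetaRing := by
  by_cases hn : (c : ℤ) - a - 1 = n
  swap
  · rw [Finset.sum_eq_zero]
    · exact zero_mem _
    · intro p hp
      obtain ⟨-, -, h0, h2⟩ := Finset.mem_filter.mp hp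
      rw [h0, h2, if_neg hn]
  by_cases hl : a + c + 2 ≤ l
  swap
  · rw [Finset.sum_eq_zero]
    · exact zero_mem _
    · intro p hp
      obtain ⟨h, h3, h0, h2⟩ := Finset.mem_filter.mp hp
      have := Finset.Nat.mem_antidiagonalTuple.mp h
      rw [Fin.sum_univ_four] at this
      omega
  have key := poisedZeta_combination_mem a (l - 2 - c + a)
  have hq := mul_mem (ratCast_mem_oddZetaRing
    ((l.factorial * (2 * a).factorial : ℚ) / (a.factorial * c.factorial) / (2 ^ (2 * a) * 6 ^ c))) key
  convert hq using 1
  rw [Finset.mul_sum]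
  refine Finset.sum_of_injOn (fun p => (p 3 - 2, 2 * a + p 1)) ?_ ?_ ?_ ?_
  · intro p hp p' hp' h
    simp only [Finset.coe_filter, Set.mem_ofPred_eq, Prod.mk.injEq] at hp hp' h
    ext i; fin_cases i <;> simp <;> omega
  · intro p hp
    simp only [Finset.coe_filter, Set.mem_ofPred_eq] at hp
    have := Finset.Nat.mem_antidiagonalTuple.mp hp.1
    rw [Fin.sum_univ_four] at this
    simp only [Finset.mem_coe, Finset.HasAntidiagonal.mem_antidiagonal]
    omega
  · intro x hx hx'
    have hx := Finset.HasAntidiagonal.mem_antidiagonal.mp hx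
    -- Pairs not coming from a tuple would need b < 0; their binomial coefficient vanishes.
    have : x.2 < 2 * a := by
      by_contra h
      apply hx'
      refine ⟨![a, x.2 - 2 * a, c, x.1 + 2], ?_, ?_⟩
      · simp only [Finset.coe_filter, Set.mem_ofPred_eq, Finset.Nat.mem_antidiagonalTuple,
          Fin.sum_univ_four]
        simp
        omega
      · ext
        · simp
        · simp; omega
    rw [Nat.choose_eq_zero_of_lt this]
    simp
  · intro p hp
    obtain ⟨-, h3, h0, h2⟩ := Finset.mem_filter.mp hp
    rw [h0, h2, if_pos hn, specialZ_eq_poisedZeta (2 * a + p 1 + 1),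
      Nat.choose_eq_factorial_div_factorial (show 2 * a ≤ 2 * a + p 1 by omega), Nat.add_sub_cancel_left,
      Nat.cast_div (Nat.factorial_mul_factorial_dvd_factorial_add _ _) (by positivity), pow_add (-1 : ℝ),
      (even_two_mul a).neg_one_pow, pow_add (2 : ℝ), div_pow]
    push_cast
    have : ∀ m : ℕ, (m.factorial : ℝ) ≠ 0 := fun m => by exact_mod_cast m.factorial_ne_zero
    have h1 := this a
    have h2 := this (2 * a)
    have h3 := this c
    have h4 := this (p 1)
    field_simp
    rw [one_pow, mul_one]

theorem laurentD_coeff_mem (l : ℕ) (n : ℤ) : (laurentD l).coeff n ∈ oddZetaRing := by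
  rw [laurentD, AddMonoidAlgebra.coeff_add, Finsupp.add_apply, coeff_C_mul_T, coeff_sum_laurent]
  refine add_mem ?_ ?_
  · split_ifs with h
    · rw [hypergeometric_neg_nat_eq_sum]
      refine mul_mem ?_ (sum_mem fun k _ => ?_)
      · simpa using ratCast_mem_oddZetaRing ((1 / 6) ^ l)
      · have := ratCast_mem_oddZetaRing ((-1) ^ k * (l.choose k) * ((k.factorial : ℚ)
          / ∏ i ∈ Finset.range k, (3 / 2 + (i : ℚ))) * (3 / 2) ^ k)
        push_cast at this
        exact this
    · exact zero_mem _
  · simp_rw [coeff_C_mul_T]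
    rw [← Finset.sum_fiberwise_of_maps_to (s := _) (t := Finset.range (l + 1) ×ˢ Finset.range (l + 1))
      (g := fun p => (p 0, p 2))]
    · refine sum_mem fun y _ => ?_
      have := laurentD_term_group_mem l y.1 y.2 n
      rw [Finset.filter_filter]
      simpa only [Prod.ext_iff] using this
    · intro p hp
      have := Finset.Nat.mem_antidiagonalTuple.mp (Finset.mem_filter.mp hp).1
      rw [Fin.sum_univ_four] at this
      simp
      omega

/-! ### Gaussian binomials and the Jacobi triple product. -/

/-- The finite product `(1 - q) (1 - q²) ⋯ (1 - qⁿ)`. -/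
def qFactorial (q : ℂ) (n : ℕ) : ℂ := ∏ i ∈ Finset.range n, (1 - q ^ (i + 1))

/-- Gaussian binomial coefficients, by the Pascal recursion. -/
def gaussBinom (q : ℂ) : ℕ → ℕ → ℂ
  | _, 0 => 1
  | 0, _ + 1 => 0
  | M + 1, j + 1 => gaussBinom q M (j + 1) + q ^ (M - j) * gaussBinom q M j

lemma gaussBinom_zero_right (q : ℂ) (M : ℕ) : gaussBinom q M 0 = 1 := by
  cases M <;> rfl

lemma gaussBinom_eq_zero (q : ℂ) {M j : ℕ} (h : M < j) : gaussBinom q M j = 0 := by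
  induction M generalizing j with
  | zero => obtain ⟨j, rfl⟩ : ∃ i, j = i + 1 := ⟨j - 1, by omega⟩
            rfl
  | succ M ih =>
    obtain ⟨j, rfl⟩ : ∃ i, j = i + 1 := ⟨j - 1, by omega⟩
    rw [gaussBinom, ih (by omega), ih (by omega)]
    ring

lemma qFactorial_succ (q : ℂ) (n : ℕ) :
    qFactorial q (n + 1) = qFactorial q n * (1 - q ^ (n + 1)) := by
  simp [qFactorial, Finset.prod_range_succ]

lemma gaussBinom_mul (q : ℂ) {M j : ℕ} (h : j ≤ M) :
    gaussBinom q M j * (qFactorial q j * qFactorial q (M - j)) = qFactorial q M := by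
  induction M generalizing j with
  | zero =>
    obtain rfl : j = 0 := by omega
    simp [gaussBinom_zero_right, qFactorial]
  | succ M ih =>
    cases j with
    | zero => simp [gaussBinom_zero_right, qFactorial]
    | succ j =>
      have h1 := ih (j := j) (by omega)
      have e0 : M + 1 - (j + 1) = M - j := by omega
      rw [gaussBinom, e0, qFactorial_succ q j, qFactorial_succ q M]
      rcases Nat.lt_or_ge j M with hj | hj
      · have h2 := ih (j := j + 1) (by omega)
        obtain ⟨d, rfl⟩ : ∃ d, M = j + 1 + d := ⟨M - (j + 1), by omega⟩
        have e1 : j + 1 + d - j = d + 1 := by omega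
        have e2 : j + 1 + d - (j + 1) = d := by omega
        rw [e1, qFactorial_succ q d] at h1 ⊢
        rw [e2, qFactorial_succ q j] at h2
        have e3 : q ^ (d + 1) * q ^ (j + 1) = q ^ (j + 1 + d + 1) := by ring
        linear_combination (1 - q ^ (d + 1)) * h2 + q ^ (d + 1) * (1 - q ^ (j + 1)) * h1
          - qFactorial q (j + 1 + d) * e3
      · obtain rfl : j = M := by omega
        rw [gaussBinom_eq_zero q (Nat.lt_succ_self j)]
        simp only [Nat.sub_self, pow_zero] at h1 ⊢
        linear_combination (1 - q ^ (j + 1)) * h1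

lemma q_binomial (q t : ℂ) (M : ℕ) : ∏ k ∈ Finset.range M, (1 + t * q ^ k)
    = ∑ j ∈ Finset.range (M + 1), gaussBinom q M j * q ^ (j.choose 2) * t ^ j := by
  induction M with
  | zero => simp [gaussBinom_zero_right]
  | succ M ih =>
    rw [Finset.prod_range_succ, ih, Finset.sum_range_succ' _ (M + 1)]
    have hstep : ∀ j ∈ Finset.range (M + 1),
        gaussBinom q (M + 1) (j + 1) * q ^ ((j + 1).choose 2) * t ^ (j + 1)
        = gaussBinom q M (j + 1) * q ^ ((j + 1).choose 2) * t ^ (j + 1)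
          + gaussBinom q M j * q ^ (j.choose 2) * t ^ j * (t * q ^ M) := by
      intro j hj
      have hj' : j ≤ M := Nat.lt_succ_iff.mp (Finset.mem_range.mp hj)
      have hc : (j + 1).choose 2 = j + j.choose 2 := by
        rw [Nat.choose_succ_succ' j 1, Nat.choose_one_right]
      have hq : q ^ M = q ^ (M - j) * q ^ j := by rw [← pow_add, Nat.sub_add_cancel hj']
      rw [gaussBinom, hc, pow_add, hq]
      ring
    rw [Finset.sum_congr rfl hstep, Finset.sum_add_distrib, ← Finset.sum_mul]
    have hs := Finset.sum_range_succ' (fun j => gaussBinom q M j * q ^ (j.choose 2) * t ^ j) (M + 1)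
    rw [Finset.sum_range_succ, gaussBinom_eq_zero q (Nat.lt_succ_self M), zero_mul, zero_mul,
      add_zero] at hs
    rw [gaussBinom_zero_right] at hs ⊢
    linear_combination hs

/-- The terms of the theta series `∑ (-1)ⁿ p^(n²+n) xⁿ`. -/
def thetaTerm (p x : ℂ) (n : ℤ) : ℂ := (-1) ^ n * p ^ (n ^ 2 + n) * x ^ n

/-- This is the q-binomial theorem with 2N factors and t = -x p^(2 - 2N), q = p². The shift centres
the product: its lower half, reflected, gives the factors with x⁻¹ after a monomial is pulled out.
-/
lemma finite_triple_product {p x : ℂ} (hp : p ≠ 0) (hx : x ≠ 0) (N : ℕ) :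
    ∏ k ∈ Finset.range N, ((1 - (p ^ 2) ^ (k + 1) * x) * (1 - (p ^ 2) ^ k * x⁻¹))
      = ∑ j ∈ Finset.range (2 * N + 1), gaussBinom (p ^ 2) (2 * N) j
          * thetaTerm p x ((j : ℤ) - N) := by
  have h1 : ∏ k ∈ Finset.range (2 * N), (1 + (-x * p ^ (2 - 2 * N : ℤ)) * (p ^ 2) ^ k)
      = (∏ k ∈ Finset.range N, ((1 - (p ^ 2) ^ (k + 1) * x) * (1 - (p ^ 2) ^ k * x⁻¹)))
        * ((-x) ^ N * p ^ (-(N * (N - 1) : ℤ))) := by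
    have hpow : (-x) ^ N * p ^ (-(N * (N - 1) : ℤ))
        = ∏ k ∈ Finset.range N, (-x * p ^ (-(2 * k : ℤ))) := by
      rw [Finset.prod_mul_distrib, Finset.prod_const, Finset.card_range]
      congr 1
      induction N with
      | zero => simp
      | succ N ih =>
        rw [Finset.prod_range_succ, ← ih, ← zpow_add₀ hp]
        congr 1; push_cast; ring
    rw [two_mul, Finset.prod_range_add, ← Finset.prod_range_reflect
      (fun k => 1 + (-x * p ^ (2 - 2 * N : ℤ)) * (p ^ 2) ^ k) N, hpow, ← Finset.prod_mul_distrib,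
      ← Finset.prod_mul_distrib]
    refine Finset.prod_congr rfl fun k hk => ?_
    have hk' : k + 1 ≤ N := Finset.mem_range.mp hk
    have a1 : p ^ (2 - 2 * N : ℤ) * (p ^ 2) ^ (N - 1 - k) = p ^ (-(2 * k : ℤ)) := by
      rw [← pow_mul, ← zpow_natCast p, ← zpow_add₀ hp]
      congr 1
      rw [show N - 1 - k = N - (k + 1) by omega]
      push_cast [hk']
      ring
    have a2 : p ^ (2 - 2 * N : ℤ) * (p ^ 2) ^ (N + k) = (p ^ 2) ^ (k + 1) := by
      rw [← pow_mul, ← pow_mul, ← zpow_natCast p, ← zpow_natCast p, ← zpow_add₀ hp]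
      congr 1
      push_cast
      ring
    have a3 : p ^ (-(2 * k : ℤ)) * (p ^ 2) ^ k = 1 := by
      rw [← pow_mul, ← zpow_natCast p, ← zpow_add₀ hp]
      simp
    rw [mul_assoc, mul_assoc, a1, a2]
    have hxx : x * x⁻¹ = 1 := mul_inv_cancel₀ hx
    linear_combination (-(1 - (p ^ 2) ^ (k + 1) * x) * x * x⁻¹) * a3
      - (1 - (p ^ 2) ^ (k + 1) * x) * hxx
  have h2 := q_binomial (p ^ 2) (-x * p ^ (2 - 2 * N : ℤ)) (2 * N)
  rw [h1] at h2
  have hne : (-x) ^ N * p ^ (-(N * (N - 1) : ℤ)) ≠ 0 :=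
    mul_ne_zero (pow_ne_zero _ (neg_ne_zero.mpr hx)) (zpow_ne_zero _ hp)
  apply mul_right_cancel₀ hne
  rw [h2, Finset.sum_mul]
  refine Finset.sum_congr rfl fun j _ => ?_
  rw [thetaTerm, mul_assoc, mul_assoc]
  congr 1
  have hch : ((p ^ 2) ^ (j.choose 2) : ℂ) = p ^ ((j : ℤ) * (j - 1)) := by
    rw [← pow_mul, ← zpow_natCast p]
    congr 1
    rw [Nat.choose_two_right, Nat.mul_div_cancel' (Nat.even_mul_pred_self j).two_dvd]
    cases j with
    | zero => simp
    | succ j => push_cast; simp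
  have hx1 : (-x) ^ N = (-1 : ℂ) ^ (N : ℤ) * x ^ (N : ℤ) := by
    rw [neg_pow, zpow_natCast, zpow_natCast]
  have hx2 : (-x * p ^ (2 - 2 * N : ℤ)) ^ j
      = (-1 : ℂ) ^ (j : ℤ) * x ^ (j : ℤ) * p ^ ((2 - 2 * N : ℤ) * j) := by
    rw [mul_pow, neg_pow, zpow_natCast, zpow_natCast, zpow_mul, zpow_natCast]
  have hm1 : (-1 : ℂ) ^ (j : ℤ) = (-1) ^ ((j : ℤ) - N) * (-1) ^ (N : ℤ) := by
    rw [← zpow_add₀ (by norm_num)]; simp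
  have hxz : x ^ (j : ℤ) = x ^ ((j : ℤ) - N) * x ^ (N : ℤ) := by
    rw [← zpow_add₀ hx]; simp
  have hpz : p ^ ((j : ℤ) * (j - 1)) * p ^ ((2 - 2 * N : ℤ) * j)
      = p ^ (((j : ℤ) - N) ^ 2 + (j - N)) * p ^ (-(N * (N - 1) : ℤ)) := by
    rw [← zpow_add₀ hp, ← zpow_add₀ hp]
    congr 1; ring
  rw [hch, hx1, hx2, hm1, hxz]
  linear_combination ((-1 : ℂ) ^ ((j : ℤ) - N) * (-1) ^ (N : ℤ) * (x ^ ((j : ℤ) - N) * x ^ (N : ℤ)))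
    * hpz

lemma summable_pow_succ {q : ℂ} (hq : ‖q‖ < 1) : Summable fun n : ℕ => ‖-q ^ (n + 1)‖ := by
  simpa using (summable_nat_add_iff 1).mpr (summable_geometric_of_lt_one (norm_nonneg _) hq)

lemma tendsto_qFactorial {q : ℂ} (hq : ‖q‖ < 1) :
    Tendsto (qFactorial q) atTop (nhds (∏' n : ℕ, (1 - q ^ (n + 1)))) :=
  (ModularForm.multipliable_one_sub_pow hq).hasProd.tendsto_prod_nat

lemma one_sub_pow_ne_zero {q : ℂ} (hq : ‖q‖ < 1) (n : ℕ) : 1 - q ^ (n + 1) ≠ 0 := by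
  intro h
  have h1 : ‖q ^ (n + 1)‖ = 1 := by rw [← sub_eq_zero.mp h, norm_one]
  rw [norm_pow] at h1
  exact (pow_lt_one₀ (norm_nonneg q) hq (Nat.succ_ne_zero n)).ne h1

lemma tprod_one_sub_pow_ne_zero {q : ℂ} (hq : ‖q‖ < 1) : ∏' n : ℕ, (1 - q ^ (n + 1)) ≠ 0 :=
  tprod_one_add_ne_zero_of_summable (f := fun n => -q ^ (n + 1))
    (fun n => by simpa [← sub_eq_add_neg] using one_sub_pow_ne_zero hq n)
    (summable_pow_succ hq)

lemma qFactorial_ne_zero {q : ℂ} (hq : ‖q‖ < 1) (n : ℕ) : qFactorial q n ≠ 0 :=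
  Finset.prod_ne_zero_iff.mpr fun i _ => one_sub_pow_ne_zero hq i

/-- The factorials converge to a nonzero limit, so they and their inverses are bounded. This gives
the domination for the limit in `tendsto_triple_product`. -/
lemma exists_norm_gaussBinom_le {q : ℂ} (hq : ‖q‖ < 1) : ∃ C, ∀ M j, ‖gaussBinom q M j‖ ≤ C := by
  have h1 := (tendsto_qFactorial hq).norm.bddAbove_range
  have h2 := ((tendsto_qFactorial hq).inv₀ (tprod_one_sub_pow_ne_zero hq)).norm.bddAbove_range
  obtain ⟨A, hA⟩ := h1
  obtain ⟨B, hB⟩ := h2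
  have hA' : ∀ n, ‖qFactorial q n‖ ≤ A := fun n => hA ⟨n, rfl⟩
  have hB' : ∀ n, ‖(qFactorial q n)⁻¹‖ ≤ B := fun n => hB ⟨n, rfl⟩
  have hA0 : 0 ≤ A := (norm_nonneg _).trans (hA' 0)
  have hB0 : 0 ≤ B := (norm_nonneg _).trans (hB' 0)
  refine ⟨A * (B * B), fun M j => ?_⟩
  rcases Nat.lt_or_ge M j with h | h
  · rw [gaussBinom_eq_zero q h, norm_zero]; positivity
  · have := gaussBinom_mul q h
    rw [← eq_mul_inv_iff_mul_eq₀ (mul_ne_zero (qFactorial_ne_zero hq _) (qFactorial_ne_zero hq _))]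
      at this
    rw [this, mul_inv, norm_mul, norm_mul]
    exact mul_le_mul (hA' _) (mul_le_mul (hB' _) (hB' _) (norm_nonneg _) hB0) (by positivity) hA0

lemma tendsto_gaussBinom {q : ℂ} (hq : ‖q‖ < 1) (n : ℤ) :
    Tendsto (fun N : ℕ => gaussBinom q (2 * N) (N + n).toNat) atTop
      (nhds (∏' n : ℕ, (1 - q ^ (n + 1)))⁻¹) := by
  set Q := ∏' n : ℕ, (1 - q ^ (n + 1)) with hQ
  have hQ0 : Q ≠ 0 := tprod_one_sub_pow_ne_zero hq
  have ha : Tendsto (fun N : ℕ => ((N : ℤ) + n).toNat) atTop atTop :=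
    tendsto_atTop.mpr fun b => by
      filter_upwards [eventually_ge_atTop (b + n.natAbs)] with N hN; omega
  have hb : Tendsto (fun N : ℕ => 2 * N - ((N : ℤ) + n).toNat) atTop atTop :=
    tendsto_atTop.mpr fun b => by
      filter_upwards [eventually_ge_atTop (b + n.natAbs)] with N hN; omega
  have hc : Tendsto (fun N : ℕ => 2 * N) atTop atTop :=
    tendsto_atTop.mpr fun b => by
      filter_upwards [eventually_ge_atTop b] with N hN; omega
  have hT := tendsto_qFactorial hq
  have := (hT.comp hc).mul (((hT.comp ha).mul (hT.comp hb)).inv₀ (mul_ne_zero hQ0 hQ0))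
  rw [← hQ, show Q * (Q * Q)⁻¹ = Q⁻¹ by field_simp] at this
  refine this.congr' ?_
  filter_upwards [eventually_ge_atTop n.natAbs] with N hN
  have h : ((N : ℤ) + n).toNat ≤ 2 * N := by omega
  simp only [Function.comp_apply]
  rw [eq_comm, eq_mul_inv_iff_mul_eq₀ (mul_ne_zero (qFactorial_ne_zero hq _) (qFactorial_ne_zero hq _))]
  exact gaussBinom_mul q h

/-- The Jacobi triple product. -/
theorem tendsto_triple_product {p x : ℂ} (hp : p ≠ 0) (hp1 : ‖p‖ < 1) (hx : x ≠ 0)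
    (hsum : Summable fun n => ‖thetaTerm p x n‖) :
    Tendsto (fun N : ℕ => ∏ k ∈ Finset.range N,
        ((1 - (p ^ 2) ^ (k + 1) * x) * (1 - (p ^ 2) ^ k * x⁻¹))) atTop
      (nhds ((∏' n : ℕ, (1 - (p ^ 2) ^ (n + 1)))⁻¹ * ∑' n, thetaTerm p x n)) := by
  have hq : ‖p ^ 2‖ < 1 := by
    rw [norm_pow]; exact pow_lt_one₀ (norm_nonneg _) hp1 two_ne_zero
  obtain ⟨C, hC⟩ := exists_norm_gaussBinom_le hq
  have hfin : ∀ N : ℕ, ∏ k ∈ Finset.range N,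
      ((1 - (p ^ 2) ^ (k + 1) * x) * (1 - (p ^ 2) ^ k * x⁻¹))
      = ∑' n : ℤ, if n.natAbs ≤ N then gaussBinom (p ^ 2) (2 * N) (N + n).toNat * thetaTerm p x n
        else 0 := by
    intro N
    rw [finite_triple_product hp hx, tsum_eq_sum (s := Finset.Icc (-N : ℤ) N)
      (fun n hn => if_neg fun h => hn (by rw [Finset.mem_Icc]; omega))]
    refine Finset.sum_bij' (fun (j : ℕ) _ => (j : ℤ) - N) (fun (n : ℤ) _ => (N + n).toNat)
      ?_ ?_ ?_ ?_ ?_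
    · intro j hj
      have := Finset.mem_range.mp hj
      rw [Finset.mem_Icc]; omega
    · intro n hn
      rw [Finset.mem_Icc] at hn
      rw [Finset.mem_range]; omega
    · intro j hj
      simp
    · intro n hn
      rw [Finset.mem_Icc] at hn
      omega
    · intro j hj
      have := Finset.mem_range.mp hj
      rw [if_pos (by omega)]
      congr 2
      omega
  simp_rw [hfin]
  rw [← tsum_mul_left]
  refine tendsto_tsum_of_dominated_convergence (hsum.mul_left C) (fun n => ?_)
    (Eventually.of_forall fun N n => ?_)
  · refine ((tendsto_gaussBinom hq n).mul_const (thetaTerm p x n)).congr' ?_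
    filter_upwards [eventually_ge_atTop n.natAbs] with N hN
    rw [if_pos hN]
  · split_ifs
    · rw [norm_mul]
      exact mul_le_mul_of_nonneg_right (hC _ _) (norm_nonneg _)
    · rw [norm_zero]
      exact mul_nonneg ((norm_nonneg _).trans (hC 0 0)) (norm_nonneg _)

/-! ### The product formula for the Green's function. -/

/-- The function `-log |1 - w|²`. -/
def logGreen (w : ℂ) : ℝ := -Real.log (‖1 - w‖ ^ 2)

lemma one_sub_ne_zero_of_norm_lt {w : ℂ} (h : ‖w‖ < 1) : 1 - w ≠ 0 := by
  intro h0
  rw [← sub_eq_zero.mp h0, norm_one] at h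
  exact lt_irrefl _ h

lemma abs_logGreen_le {w : ℂ} (h : ‖w‖ < 1) : |logGreen w| ≤ 2 * ‖w‖ / (1 - ‖w‖) := by
  have h1 : 1 - ‖w‖ ≤ ‖1 - w‖ := by simpa using norm_sub_norm_le (1 : ℂ) w
  have h2 : ‖1 - w‖ ≤ 1 + ‖w‖ := by simpa using norm_sub_le (1 : ℂ) w
  have hpos : 0 < 1 - ‖w‖ := by linarith
  have hn : 0 < ‖1 - w‖ := by linarith
  have h3 : Real.log ‖1 - w‖ ≤ ‖w‖ := by
    have := Real.log_le_sub_one_of_pos hn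
    linarith
  have h4 : -(‖w‖ / (1 - ‖w‖)) ≤ Real.log ‖1 - w‖ := by
    have := Real.one_sub_inv_le_log_of_pos hn
    have h5 : ‖1 - w‖⁻¹ ≤ (1 - ‖w‖)⁻¹ := inv_anti₀ hpos h1
    have h6 : ‖w‖ / (1 - ‖w‖) = (1 - ‖w‖)⁻¹ - 1 := by field_simp; ring
    linarith
  have h7 : ‖w‖ ≤ ‖w‖ / (1 - ‖w‖) := by
    rw [le_div_iff₀ hpos]; nlinarith [norm_nonneg w]
  rw [logGreen, Real.log_pow, abs_neg, abs_mul, mul_div_assoc]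
  push_cast
  rw [abs_two]
  gcongr
  rw [abs_le]
  constructor <;> linarith

lemma norm_pow_mul_le {q w : ℂ} (hq : ‖q‖ < 1) (k : ℕ) : ‖q ^ k * w‖ ≤ ‖w‖ := by
  rw [norm_mul, norm_pow]
  exact mul_le_of_le_one_left (norm_nonneg w) (pow_le_one₀ (norm_nonneg q) hq.le)

lemma abs_logGreen_pow_mul_le {q w : ℂ} (hq : ‖q‖ < 1) (hw : ‖w‖ < 1) (k : ℕ) :
    |logGreen (q ^ k * w)| ≤ 2 * ‖w‖ / (1 - ‖w‖) * ‖q‖ ^ k := by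
  have h := norm_pow_mul_le (w := w) hq k
  refine (abs_logGreen_le (h.trans_lt hw)).trans ?_
  rw [div_mul_eq_mul_div]
  refine div_le_div₀ (by positivity) (by rw [norm_mul, norm_pow]; exact le_of_eq (by ring))
    (by linarith) (by linarith)

lemma summable_logGreen_pow_mul {q w : ℂ} (hq : ‖q‖ < 1) (hw : ‖w‖ < 1) :
    Summable fun k : ℕ => logGreen (q ^ k * w) :=
  Summable.of_norm_bounded ((summable_geometric_of_lt_one (norm_nonneg q) hq).mul_left
    (2 * ‖w‖ / (1 - ‖w‖))) fun k => abs_logGreen_pow_mul_le hq hw k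

lemma summable_norm_pow_mul {q : ℂ} (hq : ‖q‖ < 1) (w : ℂ) : Summable fun k : ℕ => ‖-(q ^ k * w)‖ := by
  simp_rw [norm_neg, norm_mul, norm_pow]
  exact (summable_geometric_of_lt_one (norm_nonneg q) hq).mul_right _

lemma tendsto_prod_one_sub_pow_mul {q : ℂ} (hq : ‖q‖ < 1) (w : ℂ) :
    Tendsto (fun N : ℕ => ∏ k ∈ Finset.range N, (1 - q ^ k * w)) atTop
      (nhds (∏' k : ℕ, (1 - q ^ k * w))) := by
  have := (multipliable_one_add_of_summable (summable_norm_pow_mul hq w)).hasProd.tendsto_prod_nat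
  simpa only [← sub_eq_add_neg] using this

lemma tprod_one_sub_pow_mul_ne_zero {q w : ℂ} (hq : ‖q‖ < 1) (hw : ‖w‖ < 1) :
    ∏' k : ℕ, (1 - q ^ k * w) ≠ 0 :=
  tprod_one_add_ne_zero_of_summable (f := fun k => -(q ^ k * w))
    (fun k => by
      simpa only [← sub_eq_add_neg] using
        one_sub_ne_zero_of_norm_lt ((norm_pow_mul_le hq k).trans_lt hw))
    (summable_norm_pow_mul hq w)

lemma tsum_logGreen_pow_mul {q w : ℂ} (hq : ‖q‖ < 1) (hw : ‖w‖ < 1) :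
    ∑' k : ℕ, logGreen (q ^ k * w) = -Real.log (‖∏' k : ℕ, (1 - q ^ k * w)‖ ^ 2) := by
  refine tendsto_nhds_unique (summable_logGreen_pow_mul hq hw).hasSum.tendsto_sum_nat ?_
  have h := ((tendsto_prod_one_sub_pow_mul hq w).norm.pow 2).log
    (pow_ne_zero 2 (norm_ne_zero_iff.mpr (tprod_one_sub_pow_mul_ne_zero hq hw)))
  refine h.neg.congr fun N => ?_
  rw [norm_prod, ← Finset.prod_pow, Real.log_prod, ← Finset.sum_neg_distrib]
  · rfl
  · intro k _
    exact pow_ne_zero 2 (norm_ne_zero_iff.mpr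
      (one_sub_ne_zero_of_norm_lt ((norm_pow_mul_le hq k).trans_lt hw)))

/-- Rewriting 1 - w⁻¹ as -w⁻¹(1 - w) moves one factor between the two products, leaving arguments w
and p²/w, both inside the unit disc when p² is the nome and 0 < u < 1. -/
lemma triple_product_eq {p w : ℂ} (hp : p ≠ 0) (hp1 : ‖p‖ < 1) (hw0 : w ≠ 0) (hw : ‖w‖ < 1)
    (hsum : Summable fun n => ‖thetaTerm p w n‖) :
    (∏' n : ℕ, (1 - (p ^ 2) ^ (n + 1)))⁻¹ * ∑' n, thetaTerm p w n
      = -w⁻¹ * ((∏' k : ℕ, (1 - (p ^ 2) ^ k * w)) * ∏' k : ℕ, (1 - (p ^ 2) ^ k * (p ^ 2 / w))) := by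
  have hq : ‖p ^ 2‖ < 1 := by
    rw [norm_pow]; exact pow_lt_one₀ (norm_nonneg _) hp1 two_ne_zero
  have h1 := ((tendsto_triple_product hp hp1 hw0 hsum).comp (tendsto_add_atTop_nat 1))
  have hA := (tendsto_prod_one_sub_pow_mul hq w).comp (tendsto_add_atTop_nat 2)
  have hB := tendsto_prod_one_sub_pow_mul hq (p ^ 2 / w)
  refine tendsto_nhds_unique h1 (((hA.mul hB).const_mul (-w⁻¹)).congr fun N => ?_)
  simp only [Function.comp_apply]
  have hne := one_sub_ne_zero_of_norm_lt hw
  rw [Finset.prod_mul_distrib, Finset.prod_range_succ' (fun k => 1 - (p ^ 2) ^ k * w) (N + 1),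
    Finset.prod_range_succ' (fun k => 1 - (p ^ 2) ^ k * w⁻¹) N]
  have e : ∀ k ∈ Finset.range N, 1 - (p ^ 2) ^ k * (p ^ 2 / w) = 1 - (p ^ 2) ^ (k + 1) * w⁻¹ :=
    fun k _ => by ring
  rw [Finset.prod_congr rfl e]
  generalize (∏ k ∈ Finset.range N, (1 - (p ^ 2) ^ (k + 1) * w⁻¹)) = B
  generalize (∏ k ∈ Finset.range (N + 1), (1 - (p ^ 2) ^ (k + 1) * w)) = A
  field_simp
  ring

lemma summable_thetaTerm (τ : ℍ) (z : ℂ) :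
    Summable fun n => ‖thetaTerm (Complex.exp (Real.pi * Complex.I * τ))
      (Complex.exp (2 * Real.pi * Complex.I * z)) n‖ := by
  have h := ((summable_jacobiTheta₂_term_iff (z + τ / 2) τ).mpr τ.im_pos).norm
  refine h.congr fun n => ?_
  rw [thetaTerm, norm_mul, norm_mul, norm_zpow, norm_neg, norm_one, one_zpow, one_mul, ← norm_mul,
    jacobiTheta₂_term, ← Complex.exp_int_mul, ← Complex.exp_int_mul, ← Complex.exp_add]
  congr 2
  push_cast
  ring

lemma jacobiThetaOne_eq (τ : ℍ) (z : ℂ) : jacobiThetaOne z τ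
    = -Complex.I * Complex.exp (Real.pi * Complex.I * τ / 4 + Real.pi * Complex.I * z)
      * ∑' n, thetaTerm (Complex.exp (Real.pi * Complex.I * τ))
        (Complex.exp (2 * Real.pi * Complex.I * z)) n := by
  rw [jacobiThetaOne, mul_assoc]
  congr 1
  rw [← tsum_mul_left]
  refine tsum_congr fun n => ?_
  rw [thetaTerm, ← Complex.exp_int_mul, ← Complex.exp_int_mul, mul_assoc ((-1 : ℂ) ^ n),
    ← Complex.exp_add, mul_left_comm, ← Complex.exp_add]
  congr 2
  push_cast
  ring

/-- The nome `e^{2πiτ}`. -/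
def nome (τ : ℍ) : ℂ := Complex.exp (2 * Real.pi * Complex.I * τ)

/-- The coordinate `e^{2πi(uτ + v)}`. -/
def torusExp (τ : ℍ) (u v : ℝ) : ℂ := Complex.exp (2 * Real.pi * Complex.I * (u * τ + v))

lemma norm_nome (τ : ℍ) : ‖nome τ‖ = Real.exp (-(2 * Real.pi * τ.im)) := by
  rw [nome, Complex.norm_exp]
  congr 1
  simp

lemma norm_torusExp (τ : ℍ) (u v : ℝ) :
    ‖torusExp τ u v‖ = Real.exp (-(u * (2 * Real.pi * τ.im))) := by
  rw [torusExp, Complex.norm_exp]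
  congr 1
  simp
  ring

lemma norm_nome_lt_one (τ : ℍ) : ‖nome τ‖ < 1 := by
  rw [norm_nome, Real.exp_lt_one_iff]
  have := τ.im_pos
  have := Real.pi_pos
  simp only [Left.neg_neg_iff]
  positivity

lemma norm_torusExp_lt_one (τ : ℍ) {u : ℝ} (hu : 0 < u) (v : ℝ) : ‖torusExp τ u v‖ < 1 := by
  rw [norm_torusExp, Real.exp_lt_one_iff]
  have := τ.im_pos
  have := Real.pi_pos
  simp only [Left.neg_neg_iff]
  positivity

lemma nome_div_torusExp (τ : ℍ) (u v : ℝ) : nome τ / torusExp τ u v = torusExp τ (1 - u) (-v) := by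
  rw [nome, torusExp, torusExp, ← Complex.exp_sub]
  congr 1
  push_cast
  ring

theorem torusGreen_eq (τ : ℍ) {u : ℝ} (hu : 0 < u) (hu1 : u < 1) (v : ℝ) :
    torusGreen ((u : ℂ) * τ + v) τ = 2 * Real.pi * τ.im * (u ^ 2 - u + 1 / 6)
      + (∑' k : ℕ, logGreen (nome τ ^ k * torusExp τ u v)
        + ∑' k : ℕ, logGreen (nome τ ^ k * torusExp τ (1 - u) (-v))) := by
  have hq := norm_nome_lt_one τ
  have hw := norm_torusExp_lt_one τ hu v
  have hw' := norm_torusExp_lt_one τ (show 0 < 1 - u by linarith) (-v)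
  rw [tsum_logGreen_pow_mul hq hw, tsum_logGreen_pow_mul hq hw']
  set p : ℂ := Complex.exp (Real.pi * Complex.I * τ) with hp
  have hp2 : p ^ 2 = nome τ := by
    rw [hp, nome, ← Complex.exp_nat_mul]; congr 1; push_cast; ring
  have hp1 : ‖p‖ < 1 := by
    have : ‖p‖ ^ 2 < 1 := by rw [← norm_pow, hp2]; exact hq
    exact (pow_lt_one_iff_of_nonneg (norm_nonneg p) two_ne_zero).mp this
  have hT := triple_product_eq (w := torusExp τ u v) (Complex.exp_ne_zero _) hp1
    (Complex.exp_ne_zero _) hw (summable_thetaTerm τ _)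
  rw [hp2, nome_div_torusExp] at hT
  set A := ∏' k : ℕ, (1 - nome τ ^ k * torusExp τ u v) with hA
  set B := ∏' k : ℕ, (1 - nome τ ^ k * torusExp τ (1 - u) (-v)) with hB
  have hA0 : A ≠ 0 := tprod_one_sub_pow_mul_ne_zero hq hw
  have hB0 : B ≠ 0 := tprod_one_sub_pow_mul_ne_zero hq hw'
  set Q := ∏' n : ℕ, (1 - nome τ ^ (n + 1)) with hQ
  have hQ0 : Q ≠ 0 := tprod_one_sub_pow_ne_zero hq
  have heta : ModularForm.eta (τ : ℂ) = Complex.exp (2 * Real.pi * Complex.I * τ / 24) * Q := by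
    rw [ModularForm.eta, hQ]
    congr 1
    exact tprod_congr fun n => by rw [ModularForm.eta_q_eq_pow, nome]
  -- The exponent collects q^{1/8} w^{1/2} from the prefactor of θ₁, w⁻¹ from the triple product and
  -- q^{1/24} from η. Its logarithm supplies the terms -u + 1/6 of the quadratic; u² comes from
  -- Im(z)².
  have hnorm : ‖jacobiThetaOne ((u : ℂ) * τ + v) τ / ModularForm.eta (τ : ℂ)‖
      = Real.exp (-(2 * Real.pi * τ.im) / 12 + u * (2 * Real.pi * τ.im) / 2) * (‖A‖ * ‖B‖) := by
    have hsum : ∑' n, thetaTerm p (torusExp τ u v) n = Q * (-(torusExp τ u v)⁻¹ * (A * B)) := by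
      rw [← hT, mul_inv_cancel_left₀ hQ0]
    rw [jacobiThetaOne_eq, heta]
    change ‖-Complex.I * _ * (∑' n, thetaTerm p (torusExp τ u v) n) / _‖ = _
    rw [hsum, norm_div, norm_mul, norm_mul, norm_mul, norm_mul, norm_mul, norm_mul, norm_neg,
      norm_neg, norm_inv, norm_torusExp, Complex.norm_I, Complex.norm_exp, Complex.norm_exp, one_mul,
      ← Real.exp_neg]
    have hQn : ‖Q‖ ≠ 0 := norm_ne_zero_iff.mpr hQ0
    have e1 : (Real.pi * Complex.I * τ / 4 + Real.pi * Complex.I * ((u : ℂ) * τ + v)).re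
        = -(2 * Real.pi * τ.im) / 8 - u * (2 * Real.pi * τ.im) / 2 := by
      simp
      ring
    have e2 : (2 * Real.pi * Complex.I * τ / 24 : ℂ).re = -(2 * Real.pi * τ.im) / 24 := by
      simp
    rw [e1, e2]
    have e3 : Real.exp (-(2 * Real.pi * τ.im) / 12 + u * (2 * Real.pi * τ.im) / 2)
        * Real.exp (-(2 * Real.pi * τ.im) / 24)
        = Real.exp (-(2 * Real.pi * τ.im) / 8 - u * (2 * Real.pi * τ.im) / 2)
          * Real.exp (-(-(u * (2 * Real.pi * τ.im)))) := by
      rw [← Real.exp_add, ← Real.exp_add]; congr 1; ring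
    rw [div_eq_iff (mul_ne_zero (Real.exp_ne_zero _) hQn)]
    linear_combination (-‖A‖ * ‖B‖ * ‖Q‖) * e3
  have him : ((u : ℂ) * τ + v).im = u * τ.im := by simp
  have hAn : ‖A‖ ≠ 0 := norm_ne_zero_iff.mpr hA0
  have hBn : ‖B‖ ≠ 0 := norm_ne_zero_iff.mpr hB0
  rw [torusGreen, hnorm, him, Real.log_pow, Real.log_pow, Real.log_pow,
    Real.log_mul (Real.exp_ne_zero _) (mul_ne_zero hAn hBn), Real.log_exp, Real.log_mul hAn hBn]
  have := τ.im_pos.ne'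
  push_cast
  field_simp
  ring

/-! ### Moments of -log |1 - w|² on circles. -/

/-- The formal power series of `-log (1 - X)`. -/
def logSeries : PowerSeries ℝ := PowerSeries.mk fun n => 1 / (n : ℝ)

/-- The Taylor coefficients of `(-log (1 - w))ⁱ`. -/
def logPowCoeff (i n : ℕ) : ℝ := PowerSeries.coeff n (logSeries ^ i)

/-- Coefficient form of (1 - w)(Lⁱ⁺¹)' = (i + 1)Lⁱ for L = -log(1 - w). -/
lemma logPowCoeff_rec (i n : ℕ) :
    (n + 1) * logPowCoeff (i + 1) (n + 1) = n * logPowCoeff (i + 1) n + (i + 1) * logPowCoeff i n := by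
  have hd : PowerSeries.derivative ℝ logSeries * (1 - PowerSeries.X) = 1 := by
    have : PowerSeries.derivative ℝ logSeries = PowerSeries.mk fun _ => 1 := by
      ext k
      rw [PowerSeries.coeff_derivative, logSeries, PowerSeries.coeff_mk, PowerSeries.coeff_mk]
      push_cast
      have : (k : ℝ) + 1 ≠ 0 := by positivity
      field_simp
    rw [this]
    exact PowerSeries.mk_one_mul_one_sub_eq_one ℝ
  have h : PowerSeries.derivative ℝ (logSeries ^ (i + 1)) * (1 - PowerSeries.X)
      = ((i : PowerSeries ℝ) + 1) * logSeries ^ i := by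
    rw [Derivation.leibniz_pow]
    simp only [Nat.add_sub_cancel, smul_eq_mul, nsmul_eq_mul]
    push_cast
    linear_combination (((i : PowerSeries ℝ) + 1) * logSeries ^ i) * hd
  have hc := congrArg (PowerSeries.coeff n) h
  rw [mul_sub, mul_one, map_sub, PowerSeries.coeff_derivative] at hc
  have hr : PowerSeries.coeff n (((i : PowerSeries ℝ) + 1) * logSeries ^ i)
      = ((i : ℝ) + 1) * logPowCoeff i n := by
    have : ((i : PowerSeries ℝ) + 1) = PowerSeries.C ((i : ℝ) + 1) := by simp
    rw [this, PowerSeries.coeff_C_mul]; rfl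
  rw [hr] at hc
  have hx : PowerSeries.coeff n (PowerSeries.derivative ℝ (logSeries ^ (i + 1)) * PowerSeries.X)
      = n * logPowCoeff (i + 1) n := by
    cases n with
    | zero => simp
    | succ n =>
      rw [PowerSeries.coeff_succ_mul_X, PowerSeries.coeff_derivative, logPowCoeff]
      push_cast; ring
  rw [hx] at hc
  simp only [logPowCoeff] at hc ⊢
  linear_combination hc

lemma logPowCoeff_zero_right (i : ℕ) : logPowCoeff (i + 1) 0 = 0 := by
  rw [logPowCoeff, PowerSeries.coeff_zero_eq_constantCoeff_apply, map_pow]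
  have : PowerSeries.constantCoeff (R := ℝ) logSeries = 0 := by
    rw [← PowerSeries.coeff_zero_eq_constantCoeff_apply, logSeries, PowerSeries.coeff_mk]; simp
  rw [this]; simp

/-- This is the expansion of (1 - w)^{-X} = exp(X L) in both X and w, proved by comparing the
recursion with the one for rising factorials. -/
lemma logPowCoeff_eq (i n : ℕ) :
    logPowCoeff i n = i.factorial * ((ascPochhammer ℝ n).coeff i / n.factorial) := by
  induction i generalizing n with
  | zero =>
    rw [logPowCoeff, pow_zero, PowerSeries.coeff_one, Polynomial.coeff_zero_eq_eval_zero,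
      ascPochhammer_eval_zero]
    split_ifs with h <;> simp [h]
  | succ i ih =>
    induction n with
    | zero => simp [logPowCoeff_zero_right, Polynomial.coeff_one]
    | succ n ihn =>
      have h := logPowCoeff_rec i n
      rw [ih, ihn] at h
      have hc : (ascPochhammer ℝ (n + 1)).coeff (i + 1)
          = (ascPochhammer ℝ n).coeff i + (ascPochhammer ℝ n).coeff (i + 1) * n := by
        rw [ascPochhammer_succ_right, mul_add, Polynomial.coeff_add, Polynomial.coeff_mul_X,
          Polynomial.coeff_mul_natCast]
      have hn : (n : ℝ) + 1 ≠ 0 := by positivity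
      have hf : (n.factorial : ℝ) ≠ 0 := by exact_mod_cast n.factorial_ne_zero
      rw [hc]
      apply mul_left_cancel₀ hn
      rw [h, Nat.factorial_succ, Nat.factorial_succ]
      push_cast
      field_simp
      ring

lemma hasSum_logPow {w : ℂ} (hw : ‖w‖ < 1) (i : ℕ) :
    HasSum (fun n => (logPowCoeff i n : ℂ) * w ^ n) ((-Complex.log (1 - w)) ^ i) ∧
      Summable fun n => ‖(logPowCoeff i n : ℂ) * w ^ n‖ := by
  have h1 : HasSum (fun n : ℕ => ((1 / (n : ℝ) : ℝ) : ℂ) * w ^ n) (-Complex.log (1 - w)) := by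
    refine hasSum_of_eq (Complex.hasSum_taylorSeries_neg_log hw) (fun n => ?_) rfl
    push_cast; ring
  have h1n : Summable fun n : ℕ => ‖((1 / (n : ℝ) : ℝ) : ℂ) * w ^ n‖ := by
    refine Summable.of_nonneg_of_le (fun n => norm_nonneg _) (fun n => ?_)
      (summable_geometric_of_lt_one (norm_nonneg w) hw)
    rw [norm_mul, norm_pow, Complex.norm_real, Real.norm_eq_abs,
      abs_of_nonneg (by positivity : (0 : ℝ) ≤ 1 / n)]
    refine mul_le_of_le_one_left (by positivity) ?_
    rcases Nat.eq_zero_or_pos n with rfl | hn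
    · simp
    · rw [div_le_one (by exact_mod_cast hn)]; exact_mod_cast hn
  induction i with
  | zero =>
    have : ∀ n, n ≠ 0 → (logPowCoeff 0 n : ℂ) * w ^ n = 0 := by
      intro n hn; simp [logPowCoeff, PowerSeries.coeff_one, hn]
    refine ⟨?_, summable_of_ne_finset_zero (s := {0}) fun n hn => ?_⟩
    · have h := hasSum_single 0 this
      simpa [logPowCoeff] using h
    · rw [this n (by simpa using hn), norm_zero]
  | succ i ih =>
    have hprod : ∀ n, (logPowCoeff (i + 1) n : ℂ) * w ^ n
        = ∑ x ∈ Finset.HasAntidiagonal.antidiagonal n, ((logPowCoeff i x.1 : ℂ) * w ^ x.1)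
          * (((1 / (x.2 : ℝ) : ℝ) : ℂ) * w ^ x.2) := by
      intro n
      rw [logPowCoeff, pow_succ, PowerSeries.coeff_mul, Complex.ofReal_sum, Finset.sum_mul]
      refine Finset.sum_congr rfl fun x hx => ?_
      rw [← Finset.HasAntidiagonal.mem_antidiagonal.mp hx, pow_add]
      simp only [logSeries, PowerSeries.coeff_mk, logPowCoeff]
      push_cast; ring
    have hs := summable_norm_sum_mul_antidiagonal_of_summable_norm ih.2 h1n
    have ht := tsum_mul_tsum_eq_tsum_sum_antidiagonal_of_summable_norm ih.2 h1n
    simp_rw [← hprod] at hs ht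
    rw [ih.1.tsum_eq, h1.tsum_eq, ← pow_succ] at ht
    exact ⟨by rw [ht]; exact hs.of_norm.hasSum, hs⟩

/-- The point `r e^{2πiv}`. -/
def circlePoint (r v : ℝ) : ℂ := r * Complex.exp (2 * Real.pi * Complex.I * v)

lemma norm_circlePoint {r : ℝ} (hr : 0 ≤ r) (v : ℝ) : ‖circlePoint r v‖ = r := by
  rw [circlePoint, norm_mul, Complex.norm_real, Complex.norm_exp, Real.norm_eq_abs, abs_of_nonneg hr]
  simp

lemma continuous_circlePoint (r : ℝ) : Continuous (circlePoint r) := by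
  unfold circlePoint; fun_prop

lemma logGreen_eq_add_conj {w : ℂ} :
    (logGreen w : ℂ) = -Complex.log (1 - w) + (starRingEnd ℂ) (-Complex.log (1 - w)) := by
  rw [Complex.add_conj, Complex.neg_re, Complex.log_re, logGreen, Real.log_pow]
  push_cast; ring

lemma integral_exp_int (k : ℤ) :
    ∫ v in (0 : ℝ)..1, Complex.exp (2 * Real.pi * Complex.I * k * v) = if k = 0 then 1 else 0 := by
  split_ifs with h
  · simp [h]
  · have hc : 2 * Real.pi * Complex.I * (k : ℂ) ≠ 0 :=
      mul_ne_zero Complex.two_pi_I_ne_zero (by exact_mod_cast h)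
    rw [integral_exp_mul_complex hc]
    have : Complex.exp (2 * Real.pi * Complex.I * k * ((1 : ℝ) : ℂ)) = 1 := by
      rw [Complex.exp_eq_one_iff]; exact ⟨k, by push_cast; ring⟩
    rw [this]; simp

/-- The absolutely convergent double series is integrated termwise; orthogonality of characters
leaves the diagonal. -/
lemma hasSum_parseval {a b : ℕ → ℝ} {r : ℝ} (hr : 0 ≤ r) {f g : ℝ → ℂ}
    (hf : ∀ v, HasSum (fun n => (a n : ℂ) * circlePoint r v ^ n) (f v))
    (hg : ∀ v, HasSum (fun n => (b n : ℂ) * circlePoint r v ^ n) (g v))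
    (ha : Summable fun n => |a n| * r ^ n) (hb : Summable fun n => |b n| * r ^ n) :
    HasSum (fun n => ((a n * b n * (r ^ 2) ^ n : ℝ) : ℂ))
      (∫ v in (0 : ℝ)..1, f v * (starRingEnd ℂ) (g v)) := by
  let F : ℕ × ℕ → ℝ → ℂ := fun x v => ((a x.1 : ℂ) * circlePoint r v ^ x.1)
    * (starRingEnd ℂ) ((b x.2 : ℂ) * circlePoint r v ^ x.2)
  have hFc : ∀ x, Continuous (F x) := fun x =>
    ((continuous_const.mul ((continuous_circlePoint r).pow _)).mul
      (Complex.continuous_conj.comp (continuous_const.mul ((continuous_circlePoint r).pow _))))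
  have hFn : ∀ x v, ‖F x v‖ = (|a x.1| * r ^ x.1) * (|b x.2| * r ^ x.2) := by
    intro x v
    simp only [F, norm_mul, norm_pow, RCLike.norm_conj, Complex.norm_real, Real.norm_eq_abs,
      norm_circlePoint hr]
  have hab : Summable fun x : ℕ × ℕ => (|a x.1| * r ^ x.1) * (|b x.2| * r ^ x.2) :=
    ha.mul_of_nonneg hb (fun n => by positivity) (fun n => by positivity)
  have hFs : ∀ v, HasSum (fun x => F x v) (f v * (starRingEnd ℂ) (g v)) := by
    intro v
    have hc : HasSum (fun n => (starRingEnd ℂ) ((b n : ℂ) * circlePoint r v ^ n))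
        ((starRingEnd ℂ) (g v)) := Complex.hasSum_conj'.mpr (hg v)
    have hs : Summable fun x : ℕ × ℕ => F x v :=
      Summable.of_norm_bounded hab fun x => (hFn x v).le
    exact HasSum.mul (f := fun n => (a n : ℂ) * circlePoint r v ^ n)
      (g := fun n => (starRingEnd ℂ) ((b n : ℂ) * circlePoint r v ^ n)) (hf v) hc hs
  have hint := intervalIntegral.hasSum_integral_of_dominated_convergence (μ := volume)
    (a := 0) (b := 1) (F := F) (f := fun v => f v * (starRingEnd ℂ) (g v))
    (fun x _ => (|a x.1| * r ^ x.1) * (|b x.2| * r ^ x.2))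
    (fun x => (hFc x).aestronglyMeasurable) (fun x => Eventually.of_forall fun v _ => (hFn x v).le)
    (Eventually.of_forall fun v _ => hab) (by simp)
    (Eventually.of_forall fun v _ => hFs v)
  have hval : ∀ x, ∫ v in (0 : ℝ)..1, F x v
      = if x.1 = x.2 then ((a x.1 * b x.2 * (r ^ 2) ^ x.1 : ℝ) : ℂ) else 0 := by
    intro x
    have e : ∀ v : ℝ, F x v = ((a x.1 * b x.2 * r ^ (x.1 + x.2) : ℝ) : ℂ)
        * Complex.exp (2 * Real.pi * Complex.I * ((x.1 : ℤ) - x.2 : ℤ) * v) := by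
      intro v
      simp only [F, circlePoint, map_mul, map_pow, Complex.conj_ofReal, mul_pow]
      rw [← Complex.exp_conj, ← Complex.exp_nat_mul, ← Complex.exp_nat_mul]
      have : 2 * Real.pi * Complex.I * (((x.1 : ℤ) - x.2 : ℤ) : ℂ) * v
          = x.1 * (2 * Real.pi * Complex.I * v)
            + x.2 * (starRingEnd ℂ) (2 * Real.pi * Complex.I * v) := by
        simp only [map_mul, map_ofNat, Complex.conj_ofReal, Complex.conj_I]
        push_cast
        ring
      rw [this, Complex.exp_add]
      push_cast
      ring
    simp_rw [e]
    rw [intervalIntegral.integral_const_mul, integral_exp_int]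
    by_cases h : x.1 = x.2
    · rw [if_pos h, if_pos (by omega), h, mul_one, ← pow_mul, two_mul]
    · rw [if_neg h, if_neg (by omega), mul_zero]
  simp_rw [hval] at hint
  have hinj : Function.Injective fun n : ℕ => (n, n) := fun m n h => (Prod.mk.inj h).1
  have := (hinj.hasSum_iff (f := fun x : ℕ × ℕ => if x.1 = x.2 then
    ((a x.1 * b x.2 * (r ^ 2) ^ x.1 : ℝ) : ℂ) else 0) (fun x hx => if_neg fun h => hx
      ⟨x.1, Prod.ext rfl h⟩)).mpr hint
  refine hasSum_of_eq this (fun n => ?_) rfl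
  simp

open Polynomial in
/-- The normalized rising factorial `X (X + 1) ⋯ (X + n - 1) / n!`. -/
def risingPoly (n : ℕ) : ℝ[X] := C ((n.factorial : ℝ)⁻¹) * ascPochhammer ℝ n

-- The factor X² makes the first moment vanish and gives every moment of order j + 2 the harmonic
-- coefficient of order j.
open Polynomial in
lemma risingPoly_succ_sq (n : ℕ) :
    risingPoly (n + 1) ^ 2 = C (1 / ((n : ℝ) + 1) ^ 2) * (harmonicPoly n * X ^ 2) := by
  have h : ascPochhammer ℝ (n + 1) = C (n.factorial : ℝ) * X
      * ∏ k ∈ Finset.range n, (1 + C (1 / ((k : ℝ) + 1)) * X) := by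
    induction n with
    | zero => simp
    | succ n ih =>
      rw [ascPochhammer_succ_right, ih, Finset.prod_range_succ, Nat.factorial_succ]
      have : ((n + 1 : ℕ) : ℝ[X]) = C ((n : ℝ) + 1) := by simp
      have h1 : (C ((n : ℝ) + 1) : ℝ[X]) * C (1 / ((n : ℝ) + 1)) = 1 := by
        rw [← C_mul, mul_one_div_cancel (by positivity), C_1]
      rw [this]
      push_cast
      rw [C_mul]
      linear_combination (-(C (n.factorial : ℝ) * X
        * ∏ k ∈ Finset.range n, (1 + C (1 / ((k : ℝ) + 1)) * X)) * X) * h1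
  have hf : (n.factorial : ℝ) ≠ 0 := by exact_mod_cast n.factorial_ne_zero
  have hc : (C (((n + 1).factorial : ℝ)⁻¹) * C (n.factorial : ℝ) : ℝ[X]) ^ 2
      = C (1 / ((n : ℝ) + 1) ^ 2) := by
    rw [← C_mul, ← C_pow, Nat.factorial_succ]
    congr 1
    push_cast
    field_simp
  rw [risingPoly, h, harmonicPoly, Finset.prod_pow, ← hc]
  ring

/-- The factorials in `logPowCoeff_eq` cancel the binomial coefficients, so the binomial sum becomes
the coefficient of a square. -/
lemma sum_choose_logPowCoeff (j n : ℕ) :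
    ∑ i ∈ Finset.range (j + 1), logPowCoeff i n * logPowCoeff (j - i) n * (j.choose i)
      = j.factorial * (risingPoly n ^ 2).coeff j := by
  rw [sq, Polynomial.coeff_mul, Finset.Nat.sum_antidiagonal_eq_sum_range_succ_mk, Finset.mul_sum]
  refine Finset.sum_congr rfl fun i hi => ?_
  have hi' : i ≤ j := Nat.lt_succ_iff.mp (Finset.mem_range.mp hi)
  have hch : ((j.choose i : ℕ) : ℝ) * (i.factorial * (j - i).factorial) = j.factorial := by
    rw [← mul_assoc]; exact_mod_cast Nat.choose_mul_factorial_mul_factorial hi'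
  simp only [risingPoly, Polynomial.coeff_C_mul]
  rw [logPowCoeff_eq, logPowCoeff_eq, ← hch]
  ring

lemma continuous_log_circlePoint {r : ℝ} (hr : 0 ≤ r) (hr1 : r < 1) :
    Continuous fun v => -Complex.log (1 - circlePoint r v) := by
  refine (Continuous.clog (continuous_const.sub (continuous_circlePoint r)) fun v => ?_).neg
  rw [sub_eq_add_neg]
  refine Complex.mem_slitPlane_of_norm_lt_one ?_
  change ‖-(circlePoint r v)‖ < 1
  rwa [norm_neg, norm_circlePoint hr]

/-- The integrand is (L + L̄)ʲ with L = -log(1 - w). Expand binomially and apply Parseval to each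
LⁱL̄ʲ⁻ⁱ. -/
lemma hasSum_integral_logGreen_pow {r : ℝ} (hr : 0 ≤ r) (hr1 : r < 1) (j : ℕ) :
    HasSum (fun n => j.factorial * (risingPoly n ^ 2).coeff j * (r ^ 2) ^ n)
      (∫ v in (0 : ℝ)..1, logGreen (circlePoint r v) ^ j) := by
  have hw : ∀ v, ‖circlePoint r v‖ < 1 := fun v => by rwa [norm_circlePoint hr]
  have hsum : ∀ i, Summable fun n => |logPowCoeff i n| * r ^ n := fun i => by
    simpa [norm_circlePoint hr] using (hasSum_logPow (hw 0) i).2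
  have hc := continuous_log_circlePoint hr hr1
  have hpar : ∀ i k, HasSum (fun n => ((logPowCoeff i n * logPowCoeff k n * (r ^ 2) ^ n : ℝ) : ℂ))
      (∫ v in (0 : ℝ)..1, (-Complex.log (1 - circlePoint r v)) ^ i
        * (starRingEnd ℂ) ((-Complex.log (1 - circlePoint r v)) ^ k)) := fun i k =>
    hasSum_parseval hr (fun v => (hasSum_logPow (hw v) i).1) (fun v => (hasSum_logPow (hw v) k).1)
      (hsum i) (hsum k)
  have hint : ((∫ v in (0 : ℝ)..1, logGreen (circlePoint r v) ^ j : ℝ) : ℂ)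
      = ∑ i ∈ Finset.range (j + 1), (∫ v in (0 : ℝ)..1, (-Complex.log (1 - circlePoint r v)) ^ i
        * (starRingEnd ℂ) ((-Complex.log (1 - circlePoint r v)) ^ (j - i))) * (j.choose i : ℂ) := by
    rw [← intervalIntegral.integral_ofReal]
    have e : ∀ v : ℝ, ((logGreen (circlePoint r v) ^ j : ℝ) : ℂ)
        = ∑ i ∈ Finset.range (j + 1), (-Complex.log (1 - circlePoint r v)) ^ i
        * (starRingEnd ℂ) ((-Complex.log (1 - circlePoint r v)) ^ (j - i)) * (j.choose i : ℂ) := by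
      intro v
      rw [Complex.ofReal_pow, logGreen_eq_add_conj, add_pow]
      simp only [map_pow]
    simp_rw [e]
    rw [intervalIntegral.integral_finsetSum]
    · simp_rw [intervalIntegral.integral_mul_const]
    · intro i _
      exact (((hc.pow i).mul (Complex.continuous_conj.comp (hc.pow (j - i)))).mul
        continuous_const).intervalIntegrable _ _
  have htot : HasSum (fun n => ((j.factorial * (risingPoly n ^ 2).coeff j * (r ^ 2) ^ n : ℝ) : ℂ))
      ((∫ v in (0 : ℝ)..1, logGreen (circlePoint r v) ^ j : ℝ) : ℂ) := by
    rw [hint]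
    refine hasSum_of_eq (hasSum_sum fun i _ => (hpar i (j - i)).mul_right (j.choose i : ℂ))
      (fun n => ?_) rfl
    rw [← sum_choose_logPowCoeff, Finset.sum_mul]
    push_cast
    exact Finset.sum_congr rfl fun i _ => by ring
  have := Complex.hasSum_re htot
  simpa only [Complex.ofReal_re] using this

lemma hasSum_integral_logGreen_pow_add_two {r : ℝ} (hr : 0 ≤ r) (hr1 : r < 1) (j : ℕ) :
    HasSum (fun n : ℕ => (j + 2).factorial * (harmonicCoeff n j / ((n : ℝ) + 1) ^ 2)
        * (r ^ 2) ^ (n + 1))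
      (∫ v in (0 : ℝ)..1, logGreen (circlePoint r v) ^ (j + 2)) := by
  have h := (hasSum_nat_add_iff' 1).mpr (hasSum_integral_logGreen_pow hr hr1 (j + 2))
  refine hasSum_of_eq h (fun n => ?_) ?_
  · rw [risingPoly_succ_sq, Polynomial.coeff_C_mul, Polynomial.coeff_mul_X_pow, harmonicCoeff]
    ring
  · simp [risingPoly, Polynomial.coeff_one]

lemma integral_logGreen_circle {r : ℝ} (hr : 0 ≤ r) (hr1 : r < 1) :
    ∫ v in (0 : ℝ)..1, logGreen (circlePoint r v) = 0 := by
  have h := hasSum_integral_logGreen_pow hr hr1 1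
  simp only [pow_one] at h
  refine h.unique (hasSum_of_eq hasSum_zero (fun n => ?_) rfl)
  cases n with
  | zero => simp [risingPoly, Polynomial.coeff_one]
  | succ n =>
    rw [risingPoly_succ_sq, Polynomial.coeff_C_mul, Polynomial.coeff_mul_X_pow']
    simp

/-! ### Measurability, rotation invariance and bounds for moments. -/

lemma continuous_jacobiThetaOne (τ : ℍ) : Continuous fun z => jacobiThetaOne z τ := by
  have h : ∀ z, jacobiThetaOne z τ
      = -Complex.I * (Complex.exp (Real.pi * Complex.I * τ / 4 + Real.pi * Complex.I * z)
        * jacobiTheta₂ (z + τ / 2 + 1 / 2) τ) := by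
    intro z
    rw [jacobiThetaOne]
    congr 1
    rw [jacobiTheta₂, ← tsum_mul_left]
    refine tsum_congr fun n => ?_
    have : (-1 : ℂ) ^ n = Complex.exp (n * (Real.pi * Complex.I)) := by
      rw [Complex.exp_int_mul, Complex.exp_pi_mul_I]
    rw [this, jacobiTheta₂_term, ← Complex.exp_add, ← Complex.exp_add]
    congr 1
    ring
  simp_rw [h]
  refine continuous_const.mul ((by fun_prop : Continuous fun z : ℂ => Complex.exp
    (Real.pi * Complex.I * τ / 4 + Real.pi * Complex.I * z)).mul ?_)
  refine continuous_iff_continuousAt.mpr fun z => ?_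
  have h1 : ContinuousAt (fun z => jacobiTheta₂ z τ) (z + τ / 2 + 1 / 2) :=
    (differentiableAt_jacobiTheta₂_fst _ τ.im_pos).continuousAt
  exact h1.comp (f := fun z : ℂ => z + τ / 2 + 1 / 2) (by fun_prop)

lemma measurable_torusGreen (τ : ℍ) :
    Measurable fun p : ℝ × ℝ => torusGreen ((p.1 : ℂ) * (τ : ℂ) + (p.2 : ℂ)) τ := by
  have hz : Continuous fun p : ℝ × ℝ => (p.1 : ℂ) * (τ : ℂ) + (p.2 : ℂ) := by fun_prop
  have h1 : Measurable fun p : ℝ × ℝ => ‖jacobiThetaOne ((p.1 : ℂ) * (τ : ℂ) + (p.2 : ℂ)) τ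
      / ModularForm.eta (τ : ℂ)‖ ^ 2 :=
    ((((continuous_jacobiThetaOne τ).comp hz).div_const _).norm.pow 2).measurable
  have h2 : Measurable fun p : ℝ × ℝ => 2 * Real.pi * ((p.1 : ℂ) * (τ : ℂ) + (p.2 : ℂ)).im ^ 2 / τ.im :=
    ((continuous_const.mul ((Complex.continuous_im.comp hz).pow 2)).div_const _).measurable
  exact (Real.measurable_log.comp h1).neg.add h2

lemma measurable_logGreen : Measurable logGreen :=
  (Real.measurable_log.comp
    (((continuous_const.sub continuous_id).norm.pow 2).measurable)).neg

lemma continuous_torusExp (τ : ℍ) : Continuous fun p : ℝ × ℝ => torusExp τ p.1 p.2 := by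
  unfold torusExp; fun_prop

lemma logGreen_conj (w : ℂ) : logGreen ((starRingEnd ℂ) w) = logGreen w := by
  rw [logGreen, logGreen]
  congr 3
  rw [← Complex.norm_conj (1 - w)]
  simp

lemma circlePoint_periodic (r : ℝ) : Function.Periodic (circlePoint r) 1 := by
  intro v
  rw [circlePoint, circlePoint]
  congr 1
  rw [Complex.exp_eq_exp_iff_exists_int]
  exact ⟨1, by push_cast; ring⟩

lemma mul_exp_eq_circlePoint (c : ℂ) (v : ℝ) :
    c * Complex.exp (2 * Real.pi * Complex.I * v) = circlePoint ‖c‖ (v + c.arg / (2 * Real.pi)) := by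
  conv_lhs => rw [← Complex.norm_mul_exp_arg_mul_I c]
  rw [circlePoint, mul_assoc, ← Complex.exp_add]
  congr 2
  have : (Real.pi : ℂ) ≠ 0 := by exact_mod_cast Real.pi_ne_zero
  push_cast
  field_simp
  ring

/-- The `j`-th moment of `-log |1 - w|²` on the circle of radius `r`. -/
def greenMoment (j : ℕ) (r : ℝ) : ℝ := ∫ v in (0 : ℝ)..1, logGreen (circlePoint r v) ^ j

/-- The argument of c only translates v, which does not change the integral over a period. -/
lemma integral_logGreen_mul_exp (c : ℂ) (j : ℕ) :
    ∫ v in (0 : ℝ)..1, logGreen (c * Complex.exp (2 * Real.pi * Complex.I * v)) ^ j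
      = greenMoment j ‖c‖ := by
  simp_rw [mul_exp_eq_circlePoint]
  rw [intervalIntegral.integral_comp_add_right (fun v => logGreen (circlePoint ‖c‖ v) ^ j),
    greenMoment]
  have hp : Function.Periodic (fun v => logGreen (circlePoint ‖c‖ v) ^ j) 1 := fun v => by
    simp only [circlePoint_periodic ‖c‖ v]
  have := hp.intervalIntegral_add_eq (c.arg / (2 * Real.pi)) 0
  rw [zero_add] at this ⊢
  rw [← this, add_comm]

lemma integral_logGreen_mul_exp_neg (c : ℂ) (j : ℕ) :
    ∫ v in (0 : ℝ)..1, logGreen (c * Complex.exp (-(2 * Real.pi * Complex.I * v))) ^ j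
      = greenMoment j ‖c‖ := by
  rw [← Complex.norm_conj c, ← integral_logGreen_mul_exp]
  refine intervalIntegral.integral_congr fun v _ => ?_
  rw [← logGreen_conj]
  congr 2
  rw [map_mul, ← Complex.exp_conj]
  congr 2
  simp only [map_neg, map_mul, map_ofNat, Complex.conj_ofReal, Complex.conj_I]
  ring

lemma torusExp_eq_mul (τ : ℍ) (u v : ℝ) :
    torusExp τ u v = torusExp τ u 0 * Complex.exp (2 * Real.pi * Complex.I * v) := by
  rw [torusExp, torusExp, ← Complex.exp_add]
  congr 1; push_cast; ring

lemma torusExp_neg_eq_mul (τ : ℍ) (u v : ℝ) :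
    torusExp τ u (-v) = torusExp τ u 0 * Complex.exp (-(2 * Real.pi * Complex.I * v)) := by
  rw [torusExp_eq_mul]
  congr 2; push_cast; ring

lemma greenMoment_one {r : ℝ} (hr : 0 ≤ r) (hr1 : r < 1) : greenMoment 1 r = 0 := by
  simpa [greenMoment] using integral_logGreen_circle hr hr1

lemma hasSum_greenMoment {r : ℝ} (hr : 0 ≤ r) (hr1 : r < 1) (j : ℕ) :
    HasSum (fun n : ℕ => (j + 2).factorial * (harmonicCoeff n j / ((n : ℝ) + 1) ^ 2)
        * (r ^ 2) ^ (n + 1)) (greenMoment (j + 2) r) :=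
  hasSum_integral_logGreen_pow_add_two hr hr1 j

/-- A bound for the moments, uniform in the radius. -/
def momentBound (j : ℕ) : ℝ :=
  ∑' n : ℕ, (j + 2).factorial * (harmonicCoeff n j / ((n : ℝ) + 1) ^ 2)

lemma summable_momentBound (j : ℕ) :
    Summable fun n : ℕ => (j + 2).factorial * (harmonicCoeff n j / ((n : ℝ) + 1) ^ 2) :=
  (summable_harmonicCoeff_div 0 j).mul_left _

lemma momentBound_nonneg (j : ℕ) : 0 ≤ momentBound j :=
  tsum_nonneg fun n => mul_nonneg (by positivity)
    (div_nonneg (harmonicCoeff_nonneg n j) (by positivity))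

lemma greenMoment_nonneg {r : ℝ} (hr : 0 ≤ r) (hr1 : r < 1) (j : ℕ) :
    0 ≤ greenMoment (j + 2) r :=
  (hasSum_greenMoment hr hr1 j).nonneg fun n => mul_nonneg (mul_nonneg (by positivity)
    (div_nonneg (harmonicCoeff_nonneg n j) (by positivity))) (by positivity)

/-- Every term of the series carries at least r², and the coefficients remain summable at r = 1. The
bound thus persists up to the logarithmic singularity. -/
lemma greenMoment_le {r : ℝ} (hr : 0 ≤ r) (hr1 : r < 1) (j : ℕ) :
    greenMoment (j + 2) r ≤ momentBound j * r ^ 2 := by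
  refine hasSum_le (fun n => ?_) (hasSum_greenMoment hr hr1 j)
    ((summable_momentBound j).hasSum.mul_right (r ^ 2))
  refine mul_le_mul_of_nonneg_left ?_ (mul_nonneg (by positivity)
    (div_nonneg (harmonicCoeff_nonneg n j) (by positivity)))
  rw [pow_succ]
  exact mul_le_of_le_one_left (by positivity) (pow_le_one₀ (by positivity) (by nlinarith))

/-! ### Powers of a sum of two factors that are never both large. -/

/-- For ‖w‖ ≤ 1/2 the summand 4 suffices, otherwise 2‖w‖ ≥ 1. Pulling out ‖w‖ even near the
singularity lets the product of two such bounds gain the product of the radii. -/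
lemma abs_logGreen_le_norm_mul {w : ℂ} (h : ‖w‖ < 1) : |logGreen w| ≤ ‖w‖ * (4 + 2 * |logGreen w|) := by
  rcases le_or_gt ‖w‖ (1 / 2) with h2 | h2
  · have h3 := abs_logGreen_le h
    have : 2 * ‖w‖ / (1 - ‖w‖) ≤ 4 * ‖w‖ := by
      rw [div_le_iff₀ (by linarith)]; nlinarith [norm_nonneg w]
    nlinarith [norm_nonneg w, abs_nonneg (logGreen w)]
  · nlinarith [norm_nonneg w, abs_nonneg (logGreen w)]

lemma abs_add_pow_sub_le (x y : ℝ) (j : ℕ) :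
    |(x + y) ^ (j + 1) - x ^ (j + 1) - y ^ (j + 1)|
      ≤ 2 * j * (|x| * |y|) * (1 + |x| + |y|) ^ (j + 1) := by
  induction j with
  | zero => simp
  | succ j ih =>
    set s := 1 + |x| + |y| with hs
    have hx0 := abs_nonneg x
    have hy0 := abs_nonneg y
    have hs1 : 1 ≤ s := by linarith
    have e : (x + y) ^ (j + 1 + 1) - x ^ (j + 1 + 1) - y ^ (j + 1 + 1)
        = (x + y) * ((x + y) ^ (j + 1) - x ^ (j + 1) - y ^ (j + 1)) + x * y * (y ^ j + x ^ j) := by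
      ring
    have h1 : |x + y| ≤ s := (abs_add_le x y).trans (by linarith)
    have h2 : |y ^ j + x ^ j| ≤ 2 * s ^ (j + 1 + 1) := by
      have hx : |x ^ j| ≤ s ^ (j + 1 + 1) := by
        rw [abs_pow]
        exact (pow_le_pow_left₀ hx0 (by linarith) j).trans (pow_le_pow_right₀ hs1 (by omega))
      have hy : |y ^ j| ≤ s ^ (j + 1 + 1) := by
        rw [abs_pow]
        exact (pow_le_pow_left₀ hy0 (by linarith) j).trans (pow_le_pow_right₀ hs1 (by omega))
      linarith [abs_add_le (y ^ j) (x ^ j)]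
    rw [e]
    calc _ ≤ |x + y| * |(x + y) ^ (j + 1) - x ^ (j + 1) - y ^ (j + 1)|
          + |x| * |y| * |y ^ j + x ^ j| := by
          refine (abs_add_le _ _).trans ?_
          rw [abs_mul, abs_mul, abs_mul]
      _ ≤ s * (2 * j * (|x| * |y|) * s ^ (j + 1)) + |x| * |y| * (2 * s ^ (j + 1 + 1)) := by gcongr
      _ = _ := by push_cast; ring

/-- The doubled exponent is even, which removes the absolute values later and leaves moments of g
itself. -/
lemma one_add_add_pow_le {a b : ℝ} (ha : 0 ≤ a) (hb : 0 ≤ b) (m : ℕ) :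
    (1 + a + b) ^ m ≤ 3 ^ m * (1 + a ^ (2 * m) + b ^ (2 * m)) := by
  set M := max 1 (max a b) with hM
  have h1 : 1 ≤ M := le_max_left _ _
  have h2 : a ≤ M := (le_max_left a b).trans (le_max_right _ _)
  have h3 : b ≤ M := (le_max_right a b).trans (le_max_right _ _)
  have h4 : M ^ (2 * m) ≤ 1 + a ^ (2 * m) + b ^ (2 * m) := by
    have ha' : 0 ≤ a ^ (2 * m) := by positivity
    have hb' : 0 ≤ b ^ (2 * m) := by positivity
    rcases max_choice 1 (max a b) with h | h
    · rw [hM, h, one_pow]; linarith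
    · rcases max_choice a b with h' | h' <;> rw [hM, h, h'] <;> linarith
  calc (1 + a + b) ^ m ≤ (3 * M) ^ m := by gcongr; linarith
    _ = 3 ^ m * M ^ m := mul_pow _ _ _
    _ ≤ 3 ^ m * M ^ (2 * m) := by
      gcongr ?_ * ?_
      exact pow_le_pow_right₀ h1 (by omega)
    _ ≤ _ := by gcongr

/-- If `Q₁` and `Q₂` are small at complementary places and `E` is small, the powers of
`Q₁ + Q₂ + E` are close to `Q₁ʲ + Q₂ʲ`. -/
lemma abs_pow_sub_pow_sub_pow_le {x y e r s ε : ℝ} (j : ℕ) (hr : 0 ≤ r) (hs : 0 ≤ s)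
    (hrs : r * s = ε) (hε1 : ε ≤ 1) (hx : |x| ≤ r * (4 + 2 * |x|))
    (hy : |y| ≤ s * (4 + 2 * |y|)) (he : |e| ≤ 16 * ε) :
    |(x + y + e) ^ (j + 1) - x ^ (j + 1) - y ^ (j + 1)|
      ≤ ε * ((16 * (j + 1) * 17 ^ j + 32 * j) * (1 + |x| + |y|) ^ (j + 3)) := by
  have hx0 := abs_nonneg x
  have hy0 := abs_nonneg y
  have hε : 0 ≤ ε := hrs ▸ mul_nonneg hr hs
  set t := 1 + |x| + |y| with ht
  have ht1 : 1 ≤ t := by linarith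
  have h1 : |(x + y + e) ^ (j + 1) - (x + y) ^ (j + 1)| ≤ ε * (16 * (j + 1) * 17 ^ j * t ^ (j + 3)) := by
    have h := abs_pow_sub_pow_le (x + y + e) (x + y) (j + 1)
    rw [add_sub_cancel_left, Nat.add_sub_cancel] at h
    -- As |e| ≤ 16ε ≤ 16, the constant is 1 + 16.
    have hmax : max |x + y + e| |x + y| ≤ 17 * t := by
      have h1 : |x + y| ≤ |x| + |y| := abs_add_le x y
      have h2 : |x + y + e| ≤ |x + y| + |e| := abs_add_le _ _
      exact max_le (by linarith) (by linarith)
    calc _ ≤ |e| * ((j + 1 : ℕ) : ℝ) * max |x + y + e| |x + y| ^ j := h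
      _ ≤ (16 * ε) * ((j + 1 : ℕ) : ℝ) * (17 * t) ^ j := by gcongr
      _ = ε * (16 * (j + 1) * 17 ^ j * t ^ j) := by rw [mul_pow]; push_cast; ring
      _ ≤ _ := by gcongr; omega
  have h2 : |(x + y) ^ (j + 1) - x ^ (j + 1) - y ^ (j + 1)| ≤ ε * (32 * j * t ^ (j + 3)) := by
    have h := abs_add_pow_sub_le x y j
    -- Both 4 + 2|x| and 4 + 2|y| are at most 4t.
    have hxy : |x| * |y| ≤ ε * (16 * t ^ 2) := by
      calc |x| * |y| ≤ (r * (4 + 2 * |x|)) * (s * (4 + 2 * |y|)) := by gcongr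
        _ = ε * ((4 + 2 * |x|) * (4 + 2 * |y|)) := by rw [← hrs]; ring
        _ ≤ ε * (16 * t ^ 2) := by
          refine mul_le_mul_of_nonneg_left ?_ hε
          rw [ht]; nlinarith
    calc _ ≤ 2 * j * (|x| * |y|) * t ^ (j + 1) := h
      _ ≤ 2 * j * (ε * (16 * t ^ 2)) * t ^ (j + 1) := by gcongr
      _ = _ := by ring
  calc _ = |((x + y + e) ^ (j + 1) - (x + y) ^ (j + 1))
        + ((x + y) ^ (j + 1) - x ^ (j + 1) - y ^ (j + 1))| := by congr 1; ring
    _ ≤ _ := (abs_add_le _ _).trans (add_le_add h1 h2)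
    _ = _ := by ring

lemma intervalIntegrable_of_abs_le {f : ℝ → ℝ} (hf : Measurable f) {C : ℝ} (h : ∀ v, |f v| ≤ C)
    (a b : ℝ) : IntervalIntegrable f volume a b :=
  (intervalIntegrable_const (c := C)).mono_fun' hf.aestronglyMeasurable
    (Eventually.of_forall h)

/-- Each summand has mean zero on its circle, and the geometric bound permits termwise integration.
-/
lemma integral_tsum_logGreen_eq_zero {q : ℂ} (hq : ‖q‖ < 1) {c : ℂ} (hc : ‖c‖ < 1) {e : ℝ → ℂ}
    (he : Continuous e) (he1 : ∀ v, ‖e v‖ = 1)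
    (hint : ∀ c, ∫ v in (0 : ℝ)..1, logGreen (c * e v) ^ 1 = greenMoment 1 ‖c‖) :
    ∫ v in (0 : ℝ)..1, ∑' k : ℕ, logGreen (q ^ k * (c * e v)) = 0 := by
  have hn : ∀ v, ‖c * e v‖ = ‖c‖ := fun v => by rw [norm_mul, he1, mul_one]
  have h := intervalIntegral.hasSum_integral_of_dominated_convergence (μ := volume)
    (a := 0) (b := 1) (F := fun (k : ℕ) v => logGreen (q ^ k * (c * e v)))
    (f := fun v => ∑' k : ℕ, logGreen (q ^ k * (c * e v)))
    (fun k _ => 2 * ‖c‖ / (1 - ‖c‖) * ‖q‖ ^ k)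
    (fun k => (measurable_logGreen.comp (by fun_prop : Continuous fun v =>
      q ^ k * (c * e v)).measurable).aestronglyMeasurable)
    (fun k => Eventually.of_forall fun v _ => by
      have := abs_logGreen_pow_mul_le hq ((hn v).trans_lt hc) k
      rwa [hn] at this)
    (Eventually.of_forall fun v _ =>
      (summable_geometric_of_lt_one (norm_nonneg q) hq).mul_left _)
    intervalIntegrable_const
    (Eventually.of_forall fun v _ =>
      (summable_logGreen_pow_mul hq ((hn v).trans_lt hc)).hasSum)
  refine h.unique (hasSum_of_eq hasSum_zero (fun k => ?_) rfl)
  have h1 := hint (q ^ k * c)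
  rw [greenMoment_one (norm_nonneg _) ((norm_pow_mul_le hq k).trans_lt hc)] at h1
  simp only [pow_one, mul_assoc] at h1
  exact h1.symm

lemma abs_tsum_logGreen_le {q w : ℂ} (hq : ‖q‖ < 1) (hw : ‖w‖ ≤ ‖q‖) :
    |∑' k : ℕ, logGreen (q ^ k * w)| ≤ 2 * ‖q‖ / (1 - ‖q‖) ^ 2 := by
  have hw1 : ‖w‖ < 1 := hw.trans_lt hq
  have h := tsum_of_norm_bounded (f := fun k : ℕ => logGreen (q ^ k * w))
    ((hasSum_geometric_of_lt_one (norm_nonneg q) hq).mul_left (2 * ‖w‖ / (1 - ‖w‖)))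
    (fun k => abs_logGreen_pow_mul_le hq hw1 k)
  refine h.trans ?_
  have h1 : 0 < 1 - ‖q‖ := by linarith
  rw [pow_two, ← div_div, ← div_eq_mul_inv]
  gcongr

/-! ### Averages of the fluctuation over a circle. -/

/-- The part of the Green's function coming from the exponentially small factors of the
product, the main quadratic term being removed. -/
def greenFluct (τ : ℍ) (u v : ℝ) : ℝ :=
  torusGreen (u * τ + v) τ - 2 * Real.pi * τ.im * (u ^ 2 - u + 1 / 6)

/-- What is left of `greenFluct` when its two leading factors are removed. -/
def greenTail (τ : ℍ) (u v : ℝ) : ℝ :=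
  ∑' k : ℕ, logGreen (nome τ ^ k * (nome τ * torusExp τ u v))
    + ∑' k : ℕ, logGreen (nome τ ^ k * (nome τ * torusExp τ (1 - u) (-v)))

lemma greenFluct_eq (τ : ℍ) {u : ℝ} (hu : 0 < u) (hu1 : u < 1) (v : ℝ) :
    greenFluct τ u v = logGreen (torusExp τ u v) + logGreen (torusExp τ (1 - u) (-v))
      + greenTail τ u v := by
  rw [greenFluct, torusGreen_eq τ hu hu1,
    (summable_logGreen_pow_mul (norm_nome_lt_one τ) (norm_torusExp_lt_one τ hu v)).tsum_eq_zero_add,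
    (summable_logGreen_pow_mul (norm_nome_lt_one τ)
      (norm_torusExp_lt_one τ (sub_pos.2 hu1) (-v))).tsum_eq_zero_add, greenTail]
  simp only [pow_zero, one_mul, pow_succ, mul_assoc]
  ring

lemma abs_greenTail_le (τ : ℍ) {u : ℝ} (hu : 0 < u) (hu1 : u < 1) (v : ℝ) :
    |greenTail τ u v| ≤ 4 * ‖nome τ‖ / (1 - ‖nome τ‖) ^ 2 := by
  have hq := norm_nome_lt_one τ
  have h : ∀ w : ℂ, ‖w‖ < 1 → ‖nome τ * w‖ ≤ ‖nome τ‖ := fun w hw => by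
    rw [norm_mul]; exact mul_le_of_le_one_right (norm_nonneg _) hw.le
  calc _ ≤ _ := abs_add_le _ _
    _ ≤ _ := add_le_add (abs_tsum_logGreen_le hq (h _ (norm_torusExp_lt_one τ hu v)))
      (abs_tsum_logGreen_le hq (h _ (norm_torusExp_lt_one τ (sub_pos.2 hu1) (-v))))
    _ = _ := by ring

lemma abs_greenTail_le_exp (τ : ℍ) (hY : 1 ≤ 2 * Real.pi * τ.im) {u : ℝ} (hu : 0 < u)
    (hu1 : u < 1) (v : ℝ) : |greenTail τ u v| ≤ 16 * Real.exp (-(2 * Real.pi * τ.im)) := by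
  refine (abs_greenTail_le τ hu hu1 v).trans ?_
  rw [norm_nome]
  have h : Real.exp (-(2 * Real.pi * τ.im)) ≤ 1 / 2 := by
    rw [Real.exp_neg, one_div]
    refine inv_anti₀ two_pos ?_
    linarith [Real.add_one_le_exp (2 * Real.pi * τ.im)]
  have h0 := Real.exp_pos (-(2 * Real.pi * τ.im))
  set x := Real.exp (-(2 * Real.pi * τ.im))
  rw [div_le_iff₀ (by nlinarith)]
  have : (1 : ℝ) / 4 ≤ (1 - x) ^ 2 := by nlinarith
  nlinarith

lemma measurable_greenFluct (τ : ℍ) : Measurable fun p : ℝ × ℝ => greenFluct τ p.1 p.2 :=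
  (measurable_torusGreen τ).sub (by fun_prop)

lemma measurable_tsum_logGreen {q : ℂ} (hq : ‖q‖ < 1) {c : ℝ → ℂ} (hc : Measurable c)
    (hc1 : ∀ v, ‖c v‖ < 1) : Measurable fun v => ∑' k : ℕ, logGreen (q ^ k * c v) :=
  measurable_of_tendsto_metrizable
    (fun n => Finset.measurable_sum (Finset.range n) fun k _ =>
      measurable_logGreen.comp (hc.const_mul (q ^ k)))
    (tendsto_pi_nhds.2 fun v => (by
      simpa using (summable_logGreen_pow_mul hq (hc1 v)).hasSum.tendsto_sum_nat))

lemma integral_logGreen_torusExp (τ : ℍ) (u : ℝ) (j : ℕ) :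
    ∫ v in (0 : ℝ)..1, logGreen (torusExp τ u v) ^ j
      = greenMoment j (Real.exp (-(u * (2 * Real.pi * τ.im)))) := by
  rw [← norm_torusExp τ u 0, ← integral_logGreen_mul_exp]
  simp only [← torusExp_eq_mul]

lemma integral_logGreen_torusExp_neg (τ : ℍ) (u : ℝ) (j : ℕ) :
    ∫ v in (0 : ℝ)..1, logGreen (torusExp τ u (-v)) ^ j
      = greenMoment j (Real.exp (-(u * (2 * Real.pi * τ.im)))) := by
  rw [← norm_torusExp τ u 0, ← integral_logGreen_mul_exp_neg]
  simp only [← torusExp_neg_eq_mul]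

lemma norm_exp_two_pi_mul_I (v : ℝ) : ‖Complex.exp (2 * Real.pi * Complex.I * v)‖ = 1 := by
  rw [Complex.norm_exp]; simp

lemma norm_exp_neg_two_pi_mul_I (v : ℝ) : ‖Complex.exp (-(2 * Real.pi * Complex.I * v))‖ = 1 := by
  rw [Complex.norm_exp]; simp

lemma integral_greenTail (τ : ℍ) {u : ℝ} (hu : 0 < u) (hu1 : u < 1) :
    ∫ v in (0 : ℝ)..1, greenTail τ u v = 0 := by
  have hq := norm_nome_lt_one τ
  have hc : ∀ {u : ℝ}, 0 < u → ∀ v, ‖nome τ * torusExp τ u v‖ < ‖nome τ‖ := fun hu v => by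
    rw [norm_mul]
    refine mul_lt_of_lt_one_right ?_ (norm_torusExp_lt_one τ hu v)
    rw [norm_nome]; positivity
  have hu' := sub_pos.2 hu1
  have m1 : Measurable fun v => torusExp τ u v :=
    ((continuous_torusExp τ).comp (by fun_prop : Continuous fun v : ℝ => (u, v))).measurable
  have m2 : Measurable fun v => torusExp τ (1 - u) (-v) :=
    ((continuous_torusExp τ).comp (by fun_prop : Continuous fun v : ℝ => (1 - u, -v))).measurable
  unfold greenTail
  rw [intervalIntegral.integral_add
    (intervalIntegrable_of_abs_le (measurable_tsum_logGreen hq (m1.const_mul _)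
      fun v => (hc hu v).trans hq) (fun v => abs_tsum_logGreen_le hq (hc hu v).le) _ _)
    (intervalIntegrable_of_abs_le (measurable_tsum_logGreen hq (m2.const_mul _)
      fun v => (hc hu' (-v)).trans hq) (fun v => abs_tsum_logGreen_le hq (hc hu' (-v)).le) _ _)]
  have h1 := integral_tsum_logGreen_eq_zero hq ((hc hu 0).trans hq)
    (e := fun v : ℝ => Complex.exp (2 * Real.pi * Complex.I * v)) (by fun_prop)
    norm_exp_two_pi_mul_I fun c => integral_logGreen_mul_exp c 1
  have h2 := integral_tsum_logGreen_eq_zero hq ((hc hu' 0).trans hq)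
    (e := fun v : ℝ => Complex.exp (-(2 * Real.pi * Complex.I * v))) (by fun_prop)
    norm_exp_neg_two_pi_mul_I fun c => integral_logGreen_mul_exp_neg c 1
  simp only [mul_assoc (nome τ), ← torusExp_eq_mul, ← torusExp_neg_eq_mul] at h1 h2
  rw [h1, h2, add_zero]

lemma exp_neg_mul_lt_one (τ : ℍ) {u : ℝ} (hu : 0 < u) :
    Real.exp (-(u * (2 * Real.pi * τ.im))) < 1 := by
  rw [← norm_torusExp τ u 0]; exact norm_torusExp_lt_one τ hu 0

section

variable (τ : ℍ) {u : ℝ}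

lemma measurable_logGreen_torusExp (u : ℝ) : Measurable fun v => logGreen (torusExp τ u v) :=
  measurable_logGreen.comp
    ((continuous_torusExp τ).comp (by fun_prop : Continuous fun v : ℝ => (u, v))).measurable

lemma measurable_logGreen_torusExp_neg (u : ℝ) :
    Measurable fun v => logGreen (torusExp τ u (-v)) :=
  (measurable_logGreen_torusExp τ u).comp measurable_neg

lemma exists_abs_logGreen_torusExp_le (hu : 0 < u) :
    ∃ C, ∀ v, |logGreen (torusExp τ u v)| ≤ C := by
  refine ⟨2 * Real.exp (-(u * (2 * Real.pi * τ.im))) /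
    (1 - Real.exp (-(u * (2 * Real.pi * τ.im)))), fun v => ?_⟩
  have := abs_logGreen_le (norm_torusExp_lt_one τ hu v)
  rwa [norm_torusExp] at this

lemma intervalIntegrable_logGreen_pow (hu : 0 < u) (j : ℕ) :
    IntervalIntegrable (fun v => logGreen (torusExp τ u v) ^ j) volume 0 1 := by
  obtain ⟨C, hC⟩ := exists_abs_logGreen_torusExp_le τ hu
  refine intervalIntegrable_of_abs_le ((measurable_logGreen_torusExp τ u).pow_const j)
    (C := C ^ j) (fun v => ?_) _ _
  rw [abs_pow]; gcongr; exact hC v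

lemma intervalIntegrable_logGreen_neg_pow (hu : 0 < u) (j : ℕ) :
    IntervalIntegrable (fun v => logGreen (torusExp τ u (-v)) ^ j) volume 0 1 := by
  obtain ⟨C, hC⟩ := exists_abs_logGreen_torusExp_le τ hu
  refine intervalIntegrable_of_abs_le ((measurable_logGreen_torusExp_neg τ u).pow_const j)
    (C := C ^ j) (fun v => ?_) _ _
  rw [abs_pow]; gcongr; exact hC (-v)

lemma measurable_greenFluct_right (u : ℝ) : Measurable fun v => greenFluct τ u v :=
  Measurable.of_uncurry_left (f := greenFluct τ) (measurable_greenFluct τ)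

lemma intervalIntegrable_greenFluct_pow (hu : 0 < u) (hu1 : u < 1) (j : ℕ) :
    IntervalIntegrable (fun v => greenFluct τ u v ^ j) volume 0 1 := by
  obtain ⟨C, hC⟩ := exists_abs_logGreen_torusExp_le τ hu
  obtain ⟨D, hD⟩ := exists_abs_logGreen_torusExp_le τ (sub_pos.2 hu1)
  refine intervalIntegrable_of_abs_le ((measurable_greenFluct_right τ u).pow_const j)
    (C := (C + D + 4 * ‖nome τ‖ / (1 - ‖nome τ‖) ^ 2) ^ j) (fun v => ?_) _ _
  rw [abs_pow, greenFluct_eq τ hu hu1]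
  gcongr
  exact (abs_add_three _ _ _).trans (add_le_add_three (hC v) (hD (-v))
    (abs_greenTail_le τ hu hu1 v))

lemma integral_greenFluct (hu : 0 < u) (hu1 : u < 1) :
    ∫ v in (0 : ℝ)..1, greenFluct τ u v = 0 := by
  have hu' := sub_pos.2 hu1
  have i1 := intervalIntegrable_logGreen_pow τ hu 1
  have i2 := intervalIntegrable_logGreen_neg_pow τ hu' 1
  have i3 := intervalIntegrable_greenFluct_pow τ hu hu1 1
  have e1 := integral_logGreen_torusExp τ u 1
  have e2 := integral_logGreen_torusExp_neg τ (1 - u) 1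
  have e3 := integral_greenTail τ hu hu1
  rw [greenMoment_one (Real.exp_pos _).le (exp_neg_mul_lt_one τ hu)] at e1
  rw [greenMoment_one (Real.exp_pos _).le (exp_neg_mul_lt_one τ hu')] at e2
  simp only [pow_one] at i1 i2 i3 e1 e2
  have h : ∀ v, greenTail τ u v = greenFluct τ u v - logGreen (torusExp τ u v)
      - logGreen (torusExp τ (1 - u) (-v)) := fun v => by rw [greenFluct_eq τ hu hu1]; ring
  simp only [h] at e3
  rw [intervalIntegral.integral_sub (i3.sub i1) i2, intervalIntegral.integral_sub i3 i1, e1, e2]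
    at e3
  linarith

/-- Moments are bounded uniformly in the radius. -/
lemma exists_greenMoment_le (m : ℕ) :
    ∃ C : ℝ, 0 ≤ C ∧ ∀ r : ℝ, 0 ≤ r → r < 1 → greenMoment (2 * m) r ≤ C := by
  rcases m with _ | m
  · exact ⟨1, zero_le_one, fun r _ _ => by simp [greenMoment]⟩
  · refine ⟨momentBound (2 * m), momentBound_nonneg _, fun r hr hr1 => ?_⟩
    refine (greenMoment_le hr hr1 (2 * m)).trans (mul_le_of_le_one_right (momentBound_nonneg _) ?_)
    exact pow_le_one₀ hr hr1.le

/-- The power is dominated by even moments of the two leading factors, and these are bounded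
uniformly in the radius; hence C depends neither on τ nor on u. -/
lemma exists_integral_one_add_pow_le (m : ℕ) :
    ∃ C : ℝ, 0 ≤ C ∧ ∀ (τ : ℍ) {u : ℝ}, 0 < u → u < 1 →
      IntervalIntegrable (fun v => (1 + |logGreen (torusExp τ u v)|
        + |logGreen (torusExp τ (1 - u) (-v))|) ^ m) volume 0 1 ∧
      ∫ v in (0 : ℝ)..1, (1 + |logGreen (torusExp τ u v)|
        + |logGreen (torusExp τ (1 - u) (-v))|) ^ m ≤ C := by
  obtain ⟨C, hC0, hC⟩ := exists_greenMoment_le m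
  refine ⟨3 ^ m * (1 + C + C), by positivity, fun τ {u} hu hu1 => ?_⟩
  have hu' := sub_pos.2 hu1
  have i1 := intervalIntegrable_logGreen_pow τ hu (2 * m)
  have i2 := intervalIntegrable_logGreen_neg_pow τ hu' (2 * m)
  have i3 : IntervalIntegrable (fun v : ℝ => 3 ^ m * (1 + logGreen (torusExp τ u v) ^ (2 * m)
      + logGreen (torusExp τ (1 - u) (-v)) ^ (2 * m))) volume 0 1 :=
    ((intervalIntegrable_const.add i1).add i2).const_mul _
  have hle : ∀ v : ℝ, (1 + |logGreen (torusExp τ u v)| + |logGreen (torusExp τ (1 - u) (-v))|) ^ m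
      ≤ 3 ^ m * (1 + logGreen (torusExp τ u v) ^ (2 * m)
      + logGreen (torusExp τ (1 - u) (-v)) ^ (2 * m)) := fun v => by
    have := one_add_add_pow_le (abs_nonneg (logGreen (torusExp τ u v)))
      (abs_nonneg (logGreen (torusExp τ (1 - u) (-v)))) m
    simpa only [(even_two_mul m).pow_abs] using this
  have i0 : IntervalIntegrable (fun v => (1 + |logGreen (torusExp τ u v)|
        + |logGreen (torusExp τ (1 - u) (-v))|) ^ m) volume 0 1 := by
    refine i3.mono_fun' (Measurable.aestronglyMeasurable ?_) (Eventually.of_forall fun v => ?_)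
    · exact (((measurable_logGreen_torusExp τ u).norm.const_add 1).add
        (measurable_logGreen_torusExp_neg τ (1 - u)).norm).pow_const m
    · exact (Real.norm_of_nonneg (by positivity)).trans_le (hle v)
  refine ⟨i0, (intervalIntegral.integral_mono zero_le_one i0 i3 hle).trans ?_⟩
  rw [intervalIntegral.integral_const_mul,
    intervalIntegral.integral_add (intervalIntegrable_const.add i1) i2,
    intervalIntegral.integral_add intervalIntegrable_const i1,
    integral_logGreen_torusExp, integral_logGreen_torusExp_neg]
  have h1 := hC _ (Real.exp_pos _).le (exp_neg_mul_lt_one τ hu)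
  have h2 := hC _ (Real.exp_pos _).le (exp_neg_mul_lt_one τ hu')
  simp only [intervalIntegral.integral_const, sub_zero, smul_eq_mul, mul_one]
  gcongr

/-- The moments of the Green's function on a circle split, up to an exponentially small error,
into the moments of the two leading factors. -/
lemma exists_abs_integral_greenFluct_pow_sub_le (j : ℕ) :
    ∃ K : ℝ, 0 ≤ K ∧ ∀ (τ : ℍ) {u : ℝ}, 1 ≤ 2 * Real.pi * τ.im → 0 < u → u < 1 →
      |(∫ v in (0 : ℝ)..1, greenFluct τ u v ^ (j + 1))
        - greenMoment (j + 1) (Real.exp (-(u * (2 * Real.pi * τ.im))))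
        - greenMoment (j + 1) (Real.exp (-((1 - u) * (2 * Real.pi * τ.im))))|
      ≤ Real.exp (-(2 * Real.pi * τ.im)) * K := by
  obtain ⟨C, hC0, hC⟩ := exists_integral_one_add_pow_le (j + 3)
  refine ⟨(16 * (j + 1) * 17 ^ j + 32 * j) * C, by positivity, fun τ {u} hY hu hu1 => ?_⟩
  obtain ⟨i0, hle⟩ := hC τ hu hu1
  have hu' := sub_pos.2 hu1
  have i1 := intervalIntegrable_logGreen_pow τ hu (j + 1)
  have i2 := intervalIntegrable_logGreen_neg_pow τ hu' (j + 1)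
  have i3 := intervalIntegrable_greenFluct_pow τ hu hu1 (j + 1)
  rw [← integral_logGreen_torusExp, ← integral_logGreen_torusExp_neg,
    ← intervalIntegral.integral_sub i3 i1, ← intervalIntegral.integral_sub (i3.sub i1) i2]
  set ε := Real.exp (-(2 * Real.pi * τ.im)) with hε
  have hε0 : 0 < ε := Real.exp_pos _
  have hpt : ∀ v : ℝ, ‖greenFluct τ u v ^ (j + 1) - logGreen (torusExp τ u v) ^ (j + 1)
      - logGreen (torusExp τ (1 - u) (-v)) ^ (j + 1)‖
      ≤ ε * ((16 * (j + 1) * 17 ^ j + 32 * j) * (1 + |logGreen (torusExp τ u v)|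
        + |logGreen (torusExp τ (1 - u) (-v))|) ^ (j + 3)) := fun v => by
    rw [greenFluct_eq τ hu hu1, Real.norm_eq_abs]
    refine abs_pow_sub_pow_sub_pow_le j (norm_nonneg (torusExp τ u v))
      (norm_nonneg (torusExp τ (1 - u) (-v))) ?_ ?_
      (abs_logGreen_le_norm_mul (norm_torusExp_lt_one τ hu v))
      (abs_logGreen_le_norm_mul (norm_torusExp_lt_one τ hu' (-v)))
      (abs_greenTail_le_exp τ hY hu hu1 v)
    -- The radii e^{-uY} and e^{-(1-u)Y} multiply to e^{-Y} for every u: this is the source of the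
    -- exponential gain.
    · rw [norm_torusExp, norm_torusExp, ← Real.exp_add, hε]
      congr 1; ring
    · exact Real.exp_le_one_iff.2 (by linarith)
  refine (intervalIntegral.norm_integral_le_of_norm_le zero_le_one
    (Eventually.of_forall fun v _ => hpt v) ((i0.const_mul _).const_mul _)).trans ?_
  rw [intervalIntegral.integral_const_mul, intervalIntegral.integral_const_mul]
  gcongr

end

/-! ### Averages of powers of the Green's function over a circle. -/

/-- The quadratic main term of the Green's function, as a function of `Y = 2π Im τ` and `u`. -/
def greenMain (Y u : ℝ) : ℝ := Y * (u ^ 2 - u + 1 / 6)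

/-- The contribution to the average of `Gˡ` over a circle coming from one of the two leading
factors. -/
def collarSum (l : ℕ) (Y u : ℝ) : ℝ :=
  ∑ j ∈ Finset.range (l - 1), (l.choose (j + 2) : ℝ) * greenMain Y u ^ (l - 2 - j)
    * greenMoment (j + 2) (Real.exp (-(u * Y)))

lemma abs_greenMain_le {Y u : ℝ} (hY : 0 ≤ Y) (hu : 0 ≤ u) (hu1 : u ≤ 1) : |greenMain Y u| ≤ Y := by
  rw [greenMain, abs_mul, abs_of_nonneg hY]
  refine mul_le_of_le_one_right hY (abs_le.2 ⟨?_, ?_⟩) <;> nlinarith [sq_nonneg (u - 1 / 2)]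

lemma add_pow_eq_sum_range_add_two (x a : ℝ) {l : ℕ} (hl : 1 ≤ l) :
    (x + a) ^ l = ∑ j ∈ Finset.range (l - 1), (l.choose (j + 2) : ℝ) * a ^ (l - 2 - j)
      * x ^ (j + 2) + l * a ^ (l - 1) * x + a ^ l := by
  obtain ⟨l, rfl⟩ := Nat.exists_eq_add_of_le' hl
  rw [add_pow, Finset.sum_range_succ', Finset.sum_range_succ']
  congr 1
  · congr 1
    · refine Finset.sum_congr (by simp) fun j _ => ?_
      rw [show l + 1 - (j + 1 + 1) = l + 1 - 2 - j by omega]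
      ring
    · simp; ring
  · simp

/-- In the binomial expansion about the main term A the linear term integrates to zero and each
higher moment of the fluctuation splits. The error is multiplied by at most |A|^(l-2) ≤ Y^(l-2); for
l ≤ 1 there are no higher terms and no error. -/
lemma exists_abs_integral_torusGreen_pow_sub_le (l : ℕ) :
    ∃ K : ℝ, 0 ≤ K ∧ ∀ (τ : ℍ) {u : ℝ}, 1 ≤ 2 * Real.pi * τ.im → 0 < u → u < 1 →
      |(∫ v in (0 : ℝ)..1, torusGreen (u * τ + v) τ ^ l)
        - (greenMain (2 * Real.pi * τ.im) u ^ l + (collarSum l (2 * Real.pi * τ.im) u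
          + collarSum l (2 * Real.pi * τ.im) (1 - u)))|
      ≤ K * ((2 * Real.pi * τ.im) ^ (l - 2) * Real.exp (-(2 * Real.pi * τ.im))) := by
  choose K hK0 hK using fun j => exists_abs_integral_greenFluct_pow_sub_le (j + 1)
  refine ⟨∑ j ∈ Finset.range (l - 1), (l.choose (j + 2) : ℝ) * K j,
    Finset.sum_nonneg fun j _ => mul_nonneg (by positivity) (hK0 j), fun τ {u} hY hu hu1 => ?_⟩
  have hK' := fun j => hK j τ hY hu hu1
  have hi := intervalIntegrable_greenFluct_pow τ hu hu1
  have h1 := integral_greenFluct τ hu hu1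
  have hX : ∀ v : ℝ, torusGreen (u * τ + v) τ = greenFluct τ u v + greenMain (2 * Real.pi * τ.im) u :=
    fun v => by rw [greenFluct, greenMain]; ring
  simp only [hX]
  have hsymm : greenMain (2 * Real.pi * τ.im) (1 - u) = greenMain (2 * Real.pi * τ.im) u := by
    rw [greenMain, greenMain]; ring
  simp only [collarSum, hsymm]
  set Y := 2 * Real.pi * τ.im with hYdef
  set A := greenMain Y u
  have hA : |A| ≤ Y := abs_greenMain_le (by linarith) hu.le hu1.le
  rcases Nat.eq_zero_or_pos l with rfl | hl
  · simp
  have i1 : IntervalIntegrable (fun v => l * A ^ (l - 1) * greenFluct τ u v) volume 0 1 := by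
    have := (hi 1).const_mul (l * A ^ (l - 1))
    simpa only [pow_one] using this
  have i2 : ∀ j : ℕ, IntervalIntegrable (fun v => (l.choose (j + 2) : ℝ) * A ^ (l - 2 - j)
      * greenFluct τ u v ^ (j + 2)) volume 0 1 := fun j => (hi (j + 2)).const_mul _
  have i3 : IntervalIntegrable (fun v => ∑ j ∈ Finset.range (l - 1), (l.choose (j + 2) : ℝ)
      * A ^ (l - 2 - j) * greenFluct τ u v ^ (j + 2)) volume 0 1 :=
    by simpa only [Finset.sum_fn] using
      IntervalIntegrable.sum (Finset.range (l - 1)) (fun j _ => i2 j)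
  have e : ∫ v in (0 : ℝ)..1, (greenFluct τ u v + A) ^ l
      = ∑ j ∈ Finset.range (l - 1), (l.choose (j + 2) : ℝ) * A ^ (l - 2 - j)
        * (∫ v in (0 : ℝ)..1, greenFluct τ u v ^ (j + 2)) + A ^ l := by
    simp only [add_pow_eq_sum_range_add_two _ A hl]
    rw [intervalIntegral.integral_add (i3.add i1) intervalIntegrable_const,
      intervalIntegral.integral_add i3 i1, intervalIntegral.integral_const_mul, h1,
      intervalIntegral.integral_finsetSum (fun j _ => i2 j)]
    simp only [intervalIntegral.integral_const_mul]
    simp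
  rw [e, ← Finset.sum_add_distrib]
  have e' : ∀ s t a : ℝ, s + a - (a + t) = s - t := fun s t a => by ring
  rw [e', ← Finset.sum_sub_distrib, Finset.sum_mul]
  refine (Finset.abs_sum_le_sum_abs _ _).trans (Finset.sum_le_sum fun j hj => ?_)
  rw [← mul_add, ← mul_sub, ← sub_sub, abs_mul, abs_mul, Nat.abs_cast, abs_pow, mul_assoc,
    mul_assoc]
  refine mul_le_mul_of_nonneg_left ?_ (Nat.cast_nonneg _)
  have hp : |A| ^ (l - 2 - j) ≤ Y ^ (l - 2) :=
    (pow_le_pow_left₀ (abs_nonneg _) hA _).trans (pow_le_pow_right₀ hY (Nat.sub_le _ _))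
  calc _ ≤ Y ^ (l - 2) * (Real.exp (-Y) * K j) :=
        mul_le_mul hp (hK' j) (abs_nonneg _) (pow_nonneg (by linarith) _)
    _ = _ := by ring

/-- Here Y may be small, so the tail is bounded by a constant depending on τ; uniformity in u is all
that integrability requires. -/
lemma exists_integral_abs_torusGreen_pow_le (l : ℕ) (τ : ℍ) :
    ∃ C : ℝ, ∀ u : ℝ, 0 < u → u < 1 →
      IntervalIntegrable (fun v : ℝ => torusGreen (u * τ + v) τ ^ l) volume 0 1 ∧
      ∫ v in (0 : ℝ)..1, |torusGreen (u * τ + v) τ ^ l| ≤ C := by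
  obtain ⟨C, hC0, hC⟩ := exists_integral_one_add_pow_le l
  set B := 1 + 2 * Real.pi * τ.im + 4 * ‖nome τ‖ / (1 - ‖nome τ‖) ^ 2 with hB
  have hY : 0 < 2 * Real.pi * τ.im := by have := τ.im_pos; have := Real.pi_pos; positivity
  have hE : 0 ≤ 4 * ‖nome τ‖ / (1 - ‖nome τ‖) ^ 2 := by positivity
  refine ⟨B ^ l * C, fun u hu hu1 => ?_⟩
  obtain ⟨i0, hle⟩ := hC τ hu hu1
  have hpt : ∀ v : ℝ, |torusGreen (u * τ + v) τ ^ l| ≤ B ^ l * (1 + |logGreen (torusExp τ u v)|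
        + |logGreen (torusExp τ (1 - u) (-v))|) ^ l := fun v => by
    rw [abs_pow, ← mul_pow]
    gcongr
    have h1 : torusGreen (u * τ + v) τ = greenMain (2 * Real.pi * τ.im) u
        + (logGreen (torusExp τ u v) + logGreen (torusExp τ (1 - u) (-v)) + greenTail τ u v) := by
      rw [← greenFluct_eq τ hu hu1, greenFluct, greenMain]; ring
    have h2 := abs_greenTail_le τ hu hu1 v
    have h3 := abs_greenMain_le hY.le hu.le hu1.le
    have h4 := abs_add_three (logGreen (torusExp τ u v)) (logGreen (torusExp τ (1 - u) (-v)))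
      (greenTail τ u v)
    have h5 := abs_add_le (greenMain (2 * Real.pi * τ.im) u) (logGreen (torusExp τ u v)
      + logGreen (torusExp τ (1 - u) (-v)) + greenTail τ u v)
    rw [h1]
    have h6 := abs_nonneg (logGreen (torusExp τ u v))
    have h7 := abs_nonneg (logGreen (torusExp τ (1 - u) (-v)))
    nlinarith
  have m0 : Measurable fun v : ℝ => torusGreen (u * τ + v) τ ^ l :=
    (Measurable.of_uncurry_left (f := fun u v : ℝ => torusGreen (u * τ + v) τ)
      (measurable_torusGreen τ)).pow_const l
  have i1 : IntervalIntegrable (fun v : ℝ => torusGreen (u * τ + v) τ ^ l) volume 0 1 :=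
    (i0.const_mul _).mono_fun' m0.aestronglyMeasurable (Eventually.of_forall hpt)
  refine ⟨i1, (intervalIntegral.integral_mono zero_le_one i1.abs (i0.const_mul _) hpt).trans ?_⟩
  rw [intervalIntegral.integral_const_mul]
  gcongr

/-! ### Absolute convergence and Fubini. -/

/-- Discarding u = 0 costs a null set and leaves only circles on which the product formula holds. -/
lemma volume_restrict_unitSquare : (volume : Measure (ℝ × ℝ)).restrict unitSquare
    = (volume.restrict (Set.Ioo (0 : ℝ) 1)).prod (volume.restrict (Set.Ioc (0 : ℝ) 1)) := by
  rw [unitSquare, Measure.volume_eq_prod, ← Measure.prod_restrict,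
    ← Measure.restrict_congr_set (Ioo_ae_eq_Ico (a := (0 : ℝ)) (b := 1)),
    ← Measure.restrict_congr_set (Ioo_ae_eq_Ioc (a := (0 : ℝ)) (b := 1))]

lemma measurable_torusGreenPow (l : ℕ) (τ : ℍ) : Measurable (torusGreenPow l τ) :=
  (measurable_torusGreen τ).pow_const l

lemma integrable_torusGreenPow (l : ℕ) (τ : ℍ) : Integrable (torusGreenPow l τ)
    ((volume.restrict (Set.Ioo (0 : ℝ) 1)).prod (volume.restrict (Set.Ioc (0 : ℝ) 1))) := by
  obtain ⟨C, hC⟩ := exists_integral_abs_torusGreen_pow_le l τ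
  have hm := (measurable_torusGreenPow l τ).stronglyMeasurable
  rw [integrable_prod_iff hm.aestronglyMeasurable]
  constructor
  · refine (ae_restrict_iff' measurableSet_Ioo).2 (Eventually.of_forall fun u hu => ?_)
    have := (hC u hu.1 hu.2).1
    rwa [intervalIntegrable_iff_integrableOn_Ioc_of_le zero_le_one] at this
  · refine Integrable.mono' (integrable_const C)
      hm.norm.integral_prod_right.aestronglyMeasurable
      ((ae_restrict_iff' measurableSet_Ioo).2 (Eventually.of_forall fun u hu => ?_))
    rw [Real.norm_of_nonneg (integral_nonneg fun v => norm_nonneg _)]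
    have := (hC u hu.1 hu.2).2
    rwa [intervalIntegral.integral_of_le zero_le_one] at this

lemma integrableOn_torusGreenPow (l : ℕ) (τ : ℍ) :
    IntegrableOn (torusGreenPow l τ) unitSquare := by
  rw [IntegrableOn, volume_restrict_unitSquare]
  exact integrable_torusGreenPow l τ

lemma modularGraphD_eq (l : ℕ) (τ : ℍ) :
    modularGraphD l τ = ∫ u in Set.Ioo (0 : ℝ) 1, ∫ v in (0 : ℝ)..1,
      torusGreen (u * τ + v) τ ^ l := by
  rw [modularGraphD, volume_restrict_unitSquare, integral_prod _ (integrable_torusGreenPow l τ)]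
  simp only [intervalIntegral.integral_of_le zero_le_one]
  rfl

lemma integrableOn_integral_torusGreen (l : ℕ) (τ : ℍ) :
    IntegrableOn (fun u : ℝ => ∫ v in (0 : ℝ)..1, torusGreen (u * τ + v) τ ^ l)
      (Set.Ioo (0 : ℝ) 1) := by
  simp only [intervalIntegral.integral_of_le zero_le_one]
  exact (integrable_torusGreenPow l τ).integral_prod_left

/-! ### Integration over u and the Laurent polynomial. -/

lemma integral_sub_sq_pow (n : ℕ) :
    ∫ u in (0 : ℝ)..1, (u - u ^ 2) ^ n = (1 / 4) ^ n * (n.factorial / risingProd (3 / 2) n) := by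
  induction n with
  | zero => simp [risingProd]
  | succ n ih =>
    -- This primitive vanishes at both ends, and (2u - 1)² = 1 - 4(u - u²) turns its derivative into
    -- a recursion in n.
    have hd : ∀ u ∈ Set.uIcc (0 : ℝ) 1, HasDerivAt (fun u : ℝ => (2 * u - 1) * (u - u ^ 2) ^ (n + 1))
        ((4 * n + 6) * (u - u ^ 2) ^ (n + 1) - (n + 1) * (u - u ^ 2) ^ n) u := fun u _ => by
      have h1 : HasDerivAt (fun u : ℝ => 2 * u - 1) 2 u := by
        simpa using ((hasDerivAt_id u).const_mul 2).sub_const 1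
      have h2 : HasDerivAt (fun u : ℝ => u - u ^ 2) (1 - 2 * u) u := by
        exact ((hasDerivAt_id u).sub (hasDerivAt_pow 2 u)).congr_deriv (by simp)
      refine (h1.mul (h2.pow (n + 1))).congr_deriv ?_
      simp only [Pi.pow_apply, Nat.add_sub_cancel]
      push_cast
      ring
    have hc : ∀ (m : ℕ) (c : ℝ), IntervalIntegrable (fun u : ℝ => c * (u - u ^ 2) ^ m) volume 0 1 :=
      fun m c => (by fun_prop : Continuous fun u : ℝ => c * (u - u ^ 2) ^ m).intervalIntegrable _ _
    have h := intervalIntegral.integral_eq_sub_of_hasDerivAt hd ((hc _ _).sub (hc _ _))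
    rw [intervalIntegral.integral_sub (hc _ _) (hc _ _), intervalIntegral.integral_const_mul,
      intervalIntegral.integral_const_mul, ih] at h
    have hp := risingProd_pos (s := 3 / 2) (by norm_num) n
    rw [risingProd_succ, Nat.factorial_succ]
    have h0 : (2 * (1 : ℝ) - 1) * (1 - 1 ^ 2) ^ (n + 1) - (2 * 0 - 1) * (0 - 0 ^ 2) ^ (n + 1) = 0 := by
      simp
    rw [h0] at h
    have h4 : (4 * (n : ℝ) + 6) ≠ 0 := by positivity
    have h5 : (3 / 2 + (n : ℝ)) ≠ 0 := by positivity
    rw [sub_eq_zero, mul_comm, ← eq_div_iff h4] at h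
    rw [h]
    push_cast
    field_simp
    ring

/-- Expand (Y/6)ˡ(1 - 6(u - u²))ˡ; the argument 3/2 is 6 times the 1/4 of `integral_sub_sq_pow`. -/
lemma integral_greenMain_pow (l : ℕ) (Y : ℝ) :
    ∫ u in (0 : ℝ)..1, greenMain Y u ^ l
      = (1 / 6 : ℝ) ^ l * ₂F₁ (1 : ℝ) (-(l : ℝ)) (3 / 2) (3 / 2 : ℝ) * Y ^ l := by
  have e : ∀ u : ℝ, greenMain Y u ^ l = (1 / 6 : ℝ) ^ l * Y ^ l
      * ∑ n ∈ Finset.range (l + 1), ((-6) ^ n * (l.choose n : ℝ)) * (u - u ^ 2) ^ n := fun u => by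
    have : greenMain Y u = 1 / 6 * Y * ((-6) * (u - u ^ 2) + 1) := by rw [greenMain]; ring
    rw [this, mul_pow, mul_pow, add_pow]
    congr 1
    refine Finset.sum_congr rfl fun n _ => ?_
    rw [mul_pow, one_pow]; ring
  simp only [e]
  rw [intervalIntegral.integral_const_mul, intervalIntegral.integral_finsetSum
    (fun n _ => (by fun_prop : Continuous fun u : ℝ => (-6) ^ n * (l.choose n : ℝ)
      * (u - u ^ 2) ^ n).intervalIntegrable _ _), hypergeometric_neg_nat_eq_sum, mul_right_comm]
  congr 2
  refine Finset.sum_congr rfl fun n _ => ?_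
  rw [intervalIntegral.integral_const_mul, integral_sub_sq_pow,
    show (-6 : ℝ) = (-1) * (3 / 2) * 4 by norm_num, mul_pow, mul_pow, one_div, inv_pow]
  field_simp

/-- The multinomial expansion, with the powers of the last variable replaced by an arbitrary
sequence. -/
lemma sum_choose_mul_eq_sum_antidiagonalTuple (x y z : ℝ) (μ : ℕ → ℝ) (l : ℕ) :
    ∑ i ∈ Finset.range (l + 1), (l.choose i : ℝ) * (x + y + z) ^ (l - i) * μ i
      = ∑ p ∈ Finset.Nat.antidiagonalTuple 4 l, (l.factorial : ℝ) / ((p 0).factorial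
          * (p 1).factorial * (p 2).factorial * (p 3).factorial)
        * (x ^ p 0 * y ^ p 1 * z ^ p 2) * μ (p 3) := by
  -- The linear functional sending Xⁱ to μ i is applied to two expansions of one polynomial, the
  -- binomial and the multinomial.
  let φ : Polynomial ℝ →ₗ[ℝ] ℝ := Polynomial.lsum fun i => μ i • LinearMap.id
  have hφ : ∀ (c : ℝ) (i : ℕ), φ (Polynomial.C c * Polynomial.X ^ i) = c * μ i := fun c i => by
    rw [Polynomial.C_mul_X_pow_eq_monomial]
    simp [φ, mul_comm]
  have h1 : (Polynomial.X + Polynomial.C (x + y + z)) ^ l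
      = ∑ i ∈ Finset.range (l + 1), Polynomial.C ((l.choose i : ℝ) * (x + y + z) ^ (l - i))
        * Polynomial.X ^ i := by
    rw [add_pow]
    refine Finset.sum_congr rfl fun i _ => ?_
    simp only [map_mul, map_pow, map_natCast]
    ring
  have h2 : (Polynomial.X + Polynomial.C (x + y + z)) ^ l
      = ∑ p ∈ Finset.Nat.antidiagonalTuple 4 l, Polynomial.C ((l.factorial : ℝ) / ((p 0).factorial
          * (p 1).factorial * (p 2).factorial * (p 3).factorial) * (x ^ p 0 * y ^ p 1 * z ^ p 2))
        * Polynomial.X ^ p 3 := by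
    have h := Finset.sum_pow_eq_sum_piAntidiag (Finset.univ : Finset (Fin 4))
      ![Polynomial.C x, Polynomial.C y, Polynomial.C z, Polynomial.X] l
    rw [Finset.piAntidiag_univ_fin_eq_antidiagonalTuple] at h
    have e : ∑ i, ![Polynomial.C x, Polynomial.C y, Polynomial.C z, Polynomial.X] i
        = Polynomial.X + Polynomial.C (x + y + z) := by
      simp [Fin.sum_univ_four]; ring
    rw [← e, h]
    refine Finset.sum_congr rfl fun p hp => ?_
    have hs := Nat.multinomial_spec Finset.univ p
    rw [Finset.Nat.mem_antidiagonalTuple.1 hp, Fin.prod_univ_four] at hs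
    have hm : (Nat.multinomial Finset.univ p : ℝ) = (l.factorial : ℝ) / ((p 0).factorial
          * (p 1).factorial * (p 2).factorial * (p 3).factorial) := by
      rw [eq_div_iff (by positivity), mul_comm]
      exact_mod_cast hs
    rw [← hm, Fin.prod_univ_four]
    simp [mul_assoc]
  have h := congrArg φ (h1.symm.trans h2)
  simpa only [map_sum, hφ] using h

/-- The three variables are Yu², -Yu and Y/6, with exponents a, b, c; the sequence of moments is cut
off below order 2. -/
lemma collarSum_eq (l : ℕ) (Y u : ℝ) :
    collarSum l Y u = ∑ p ∈ Finset.Nat.antidiagonalTuple 4 l with 2 ≤ p 3,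
      (l.factorial : ℝ) / ((p 0).factorial * (p 1).factorial * (p 2).factorial * (p 3).factorial)
        * ((-1) ^ p 1 / 6 ^ p 2 * Y ^ (p 0 + p 1 + p 2))
        * (u ^ (2 * p 0 + p 1) * greenMoment (p 3) (Real.exp (-(u * Y)))) := by
  have h := sum_choose_mul_eq_sum_antidiagonalTuple (Y * u ^ 2) (-(Y * u)) (Y / 6)
    (fun i => if 2 ≤ i then greenMoment i (Real.exp (-(u * Y))) else 0) l
  have e : Y * u ^ 2 + -(Y * u) + Y / 6 = greenMain Y u := by rw [greenMain]; ring
  rw [e] at h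
  simp only [mul_ite, mul_zero, ← Finset.sum_filter] at h
  have e2 : collarSum l Y u = ∑ i ∈ Finset.range (l + 1) with 2 ≤ i,
      (l.choose i : ℝ) * greenMain Y u ^ (l - i) * greenMoment i (Real.exp (-(u * Y))) := by
    have hf : (Finset.range (l + 1)).filter (2 ≤ ·) = Finset.Ico 2 (l + 1) := by
      ext i; simp; omega
    rw [hf, Finset.sum_Ico_eq_sum_range, collarSum]
    refine Finset.sum_congr (by congr 1) fun j _ => ?_
    rw [add_comm 2 j, Nat.sub_sub, add_comm 2 j]
  rw [e2, h]
  refine Finset.sum_congr rfl fun p _ => ?_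
  rw [mul_assoc, mul_assoc (_ / _)]
  congr 1
  rw [neg_pow (Y * u), div_pow, mul_pow, mul_pow]
  ring

lemma integral_pow_mul_exp_neg {r : ℝ} (hr : 0 < r) (n : ℕ) :
    ∫ t in Set.Ioi (0 : ℝ), t ^ n * Real.exp (-(r * t)) = n.factorial / r ^ (n + 1) := by
  have h := Real.integral_rpow_mul_exp_neg_mul_Ioi (a := n + 1) (by positivity) hr
  rw [Real.Gamma_nat_eq_factorial] at h
  simp only [add_sub_cancel_right, Real.rpow_natCast] at h
  rw [h, ← Nat.cast_succ, Real.rpow_natCast, one_div, inv_pow, div_eq_inv_mul]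

lemma integrableOn_pow_mul_exp_neg {r : ℝ} (hr : 0 < r) (n : ℕ) :
    IntegrableOn (fun t : ℝ => t ^ n * Real.exp (-(r * t))) (Set.Ioi 0) := by
  -- A non-integrable function would have integral 0 by convention, against the positive value just
  -- found.
  by_contra h
  have := integral_pow_mul_exp_neg hr n
  rw [integral_undef h] at this
  exact absurd this.symm (by positivity)

lemma measurable_greenMoment (j : ℕ) : Measurable (greenMoment j) := by
  have hc : Continuous fun p : ℝ × ℝ => circlePoint p.1 p.2 := by unfold circlePoint; fun_prop
  have h : StronglyMeasurable fun p : ℝ × ℝ => logGreen (circlePoint p.1 p.2) ^ j :=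
    ((measurable_logGreen.comp hc.measurable).pow_const j).stronglyMeasurable
  have h2 := (h.integral_prod_right' (ν := volume.restrict (Set.Ioc (0 : ℝ) 1))).measurable
  have e : greenMoment j = fun r => ∫ v in Set.Ioc (0 : ℝ) 1, logGreen (circlePoint r v) ^ j := by
    funext r; rw [greenMoment, intervalIntegral.integral_of_le zero_le_one]
  rw [e]; exact h2

lemma measurable_greenMoment_exp (j : ℕ) (Y : ℝ) :
    Measurable fun u : ℝ => greenMoment j (Real.exp (-(u * Y))) :=
  (measurable_greenMoment j).comp (by fun_prop)

lemma exp_neg_mul_lt_one' {Y u : ℝ} (hY : 0 < Y) (hu : 0 < u) : Real.exp (-(u * Y)) < 1 := by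
  rw [Real.exp_lt_one_iff, neg_lt_zero]; positivity

lemma greenMoment_exp_le {Y u : ℝ} (hY : 0 < Y) (hu : 0 < u) (r : ℕ) :
    greenMoment (r + 2) (Real.exp (-(u * Y))) ≤ momentBound r * Real.exp (-(2 * Y * u)) := by
  refine (greenMoment_le (Real.exp_pos _).le (exp_neg_mul_lt_one' hY hu) r).trans_eq ?_
  rw [← Real.exp_nat_mul]
  congr 2; push_cast; ring

lemma integrableOn_pow_mul_greenMoment {Y : ℝ} (hY : 0 < Y) (n r : ℕ) :
    IntegrableOn (fun u : ℝ => u ^ n * greenMoment (r + 2) (Real.exp (-(u * Y)))) (Set.Ioi 0) := by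
  refine Integrable.mono'
    ((integrableOn_pow_mul_exp_neg (r := 2 * Y) (by positivity) n).const_mul (momentBound r))
    ((by fun_prop : Measurable fun u : ℝ => u ^ n).mul
      (measurable_greenMoment_exp _ Y)).aestronglyMeasurable
    ((ae_restrict_iff' measurableSet_Ioi).2 (Eventually.of_forall fun u (hu : 0 < u) => ?_))
  have h := greenMoment_nonneg (Real.exp_pos _).le (exp_neg_mul_lt_one' hY hu) r
  rw [Real.norm_of_nonneg (by positivity), mul_left_comm]
  gcongr
  exact greenMoment_exp_le hY hu r

/-- Termwise, uⁿ against e^{-2Y(k+1)u} gives n!/(2Y(k+1))^(n+1), which raises the exponent of k + 1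
from 2 to n + 3. All terms are nonnegative, so summability of the integrals justifies the exchange.
-/
lemma integral_pow_mul_greenMoment {Y : ℝ} (hY : 0 < Y) (n r : ℕ) :
    ∫ u in Set.Ioi (0 : ℝ), u ^ n * greenMoment (r + 2) (Real.exp (-(u * Y)))
      = (r + 2).factorial * n.factorial / (2 * Y) ^ (n + 1) * specialZ (n + 3) r := by
  set c : ℕ → ℝ := fun k => (r + 2).factorial * (harmonicCoeff k r / ((k : ℝ) + 1) ^ 2) with hc
  have hc0 : ∀ k, 0 ≤ c k := fun k => mul_nonneg (by positivity)
    (div_nonneg (harmonicCoeff_nonneg k r) (by positivity))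
  have hr : ∀ k : ℕ, 0 < 2 * Y * ((k : ℝ) + 1) := fun k => by positivity
  let F : ℕ → ℝ → ℝ := fun k u => c k * (u ^ n * Real.exp (-(2 * Y * ((k : ℝ) + 1) * u)))
  have hFint : ∀ k, IntegrableOn (F k) (Set.Ioi 0) := fun k =>
    (integrableOn_pow_mul_exp_neg (hr k) n).const_mul _
  have hFval : ∀ k, ∫ u in Set.Ioi (0 : ℝ), F k u
      = (r + 2).factorial * n.factorial / (2 * Y) ^ (n + 1)
        * (harmonicCoeff k r / ((k : ℝ) + 1) ^ (n + 1 + 2)) := fun k => by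
    rw [integral_const_mul, integral_pow_mul_exp_neg (hr k), hc]
    have : (k : ℝ) + 1 ≠ 0 := by positivity
    rw [mul_pow]
    field_simp
    ring
  have hFnorm : ∀ k, ∫ u in Set.Ioi (0 : ℝ), ‖F k u‖ = ∫ u in Set.Ioi (0 : ℝ), F k u := fun k =>
    setIntegral_congr_fun measurableSet_Ioi fun u (hu : 0 < u) =>
      Real.norm_of_nonneg (mul_nonneg (hc0 k) (by positivity))
  have h := hasSum_integral_of_summable_integral_norm hFint (by
    simp only [hFnorm, hFval]
    exact (summable_harmonicCoeff_div (n + 1) r).mul_left _)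
  have e : ∫ u in Set.Ioi (0 : ℝ), u ^ n * greenMoment (r + 2) (Real.exp (-(u * Y)))
      = ∫ u in Set.Ioi (0 : ℝ), ∑' k, F k u := by
    refine setIntegral_congr_fun measurableSet_Ioi fun u (hu : 0 < u) => ?_
    refine (HasSum.tsum_eq (hasSum_of_eq ((hasSum_greenMoment (Real.exp_pos _).le
      (exp_neg_mul_lt_one' hY hu) r).mul_left (u ^ n)) (fun k => ?_) rfl)).symm
    have : (Real.exp (-(u * Y)) ^ 2) ^ (k + 1) = Real.exp (-(2 * Y * ((k : ℝ) + 1) * u)) := by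
      rw [← pow_mul, ← Real.exp_nat_mul]; congr 1; push_cast; ring
    rw [this]
    simp only [F, hc]
    ring
  rw [e, ← h.tsum_eq]
  simp only [hFval]
  rw [tsum_mul_left, show n + 3 = n + 1 + 2 by ring, specialZ_eq_poisedZeta]
  rfl

lemma laurentValue_add (f g : ℝ[T;T⁻¹]) (y : ℝ) :
    laurentValue (f + g) y = laurentValue f y + laurentValue g y := by
  rw [laurentValue, AddMonoidAlgebra.coeff_add]
  exact Finsupp.sum_add_index' (by simp) (by intros; ring)

lemma laurentValue_zero (y : ℝ) : laurentValue 0 y = 0 := by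
  simp [laurentValue]

lemma laurentValue_sum {ι : Type*} (s : Finset ι) (f : ι → ℝ[T;T⁻¹]) (y : ℝ) :
    laurentValue (∑ i ∈ s, f i) y = ∑ i ∈ s, laurentValue (f i) y := by
  induction s using Finset.cons_induction with
  | empty => simp [laurentValue_zero]
  | cons i s hi ih => rw [Finset.sum_cons, Finset.sum_cons, laurentValue_add, ih]

lemma laurentValue_C_mul_T (a : ℝ) (n : ℤ) (y : ℝ) :
    laurentValue (LaurentPolynomial.C a * LaurentPolynomial.T n) y = a * y ^ n := by
  rw [← LaurentPolynomial.single_eq_C_mul_T, laurentValue]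
  exact Finsupp.sum_single_index (by simp)

lemma integrableOn_collarSum (l : ℕ) {Y : ℝ} (hY : 0 < Y) :
    IntegrableOn (collarSum l Y) (Set.Ioi 0) := by
  have e : collarSum l Y = fun u => _ := funext fun u => collarSum_eq l Y u
  rw [e]
  refine integrable_finsetSum _ fun p hp => Integrable.const_mul ?_ _
  obtain ⟨r, hr⟩ := Nat.exists_eq_add_of_le' (Finset.mem_filter.1 hp).2
  rw [hr]
  exact integrableOn_pow_mul_greenMoment hY _ r

lemma two_mul_integral_collarSum (l : ℕ) {Y : ℝ} (hY : 0 < Y) :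
    2 * ∫ u in Set.Ioi (0 : ℝ), collarSum l Y u
      = ∑ p ∈ Finset.Nat.antidiagonalTuple 4 l with 2 ≤ p 3,
        ((l.factorial : ℝ) * ((2 * p 0 + p 1).factorial : ℝ)
              / (((p 0).factorial : ℝ) * ((p 1).factorial : ℝ) * ((p 2).factorial : ℝ))
            * ((-1) ^ p 1 / (2 ^ (2 * p 0 + p 1) * 6 ^ p 2))
            * specialZ (2 * p 0 + p 1 + 3) (p 3 - 2)) * Y ^ ((p 2 : ℤ) - (p 0 : ℤ) - 1) := by
  simp only [collarSum_eq]
  rw [integral_finsetSum, Finset.mul_sum]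
  · refine Finset.sum_congr rfl fun p hp => ?_
    obtain ⟨r, hr⟩ := Nat.exists_eq_add_of_le' (Finset.mem_filter.1 hp).2
    rw [hr, integral_const_mul, integral_pow_mul_greenMoment hY, Nat.add_sub_cancel]
    -- The numerator comes from the multinomial expansion, the denominator from the u-integral; the
    -- prefactor 2 absorbs one of the 2a + b + 1 factors 1/2.
    have hz : Y ^ ((p 2 : ℤ) - (p 0 : ℤ) - 1) = Y ^ (p 0 + p 1 + p 2) / Y ^ (2 * p 0 + p 1 + 1) := by
      rw [eq_div_iff (by positivity), ← zpow_natCast, ← zpow_natCast, ← zpow_add₀ hY.ne']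
      congr 1; push_cast; ring
    rw [hz, mul_pow]
    field_simp
    ring
  · intro p hp
    refine Integrable.const_mul ?_ _
    obtain ⟨r, hr⟩ := Nat.exists_eq_add_of_le' (Finset.mem_filter.1 hp).2
    rw [hr]
    exact integrableOn_pow_mul_greenMoment hY _ r

lemma laurentValue_laurentD (l : ℕ) {Y : ℝ} (hY : 0 < Y) :
    laurentValue (laurentD l) Y = (∫ u in (0 : ℝ)..1, greenMain Y u ^ l)
      + 2 * ∫ u in Set.Ioi (0 : ℝ), collarSum l Y u := by
  rw [laurentD, laurentValue_add, laurentValue_sum, two_mul_integral_collarSum l hY,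
    integral_greenMain_pow]
  simp only [laurentValue_C_mul_T, zpow_natCast]

/-- The contribution of `u > 1` to the integral of `collarSum` is exponentially small. -/
lemma exists_abs_integral_Ioi_one_collarSum_le (l : ℕ) :
    ∃ K : ℝ, 0 ≤ K ∧ ∀ Y : ℝ, 1 ≤ Y →
      |∫ u in Set.Ioi (1 : ℝ), collarSum l Y u| ≤ K * (Y ^ (l - 2) * Real.exp (-Y)) := by
  set K := ∑ j ∈ Finset.range (l - 1), (l.choose (j + 2) : ℝ) * momentBound j with hK
  have hK0 : 0 ≤ K := Finset.sum_nonneg fun j _ => mul_nonneg (by positivity) (momentBound_nonneg j)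
  refine ⟨K * (2 * l).factorial, by positivity, fun Y hY => ?_⟩
  have hY0 : 0 < Y := by linarith
  have hi : IntegrableOn (fun u : ℝ => u ^ (2 * l) * Real.exp (-(1 * u))) (Set.Ioi 0) :=
    integrableOn_pow_mul_exp_neg one_pos _
  have hsub : Set.Ioi (1 : ℝ) ⊆ Set.Ioi 0 := Set.Ioi_subset_Ioi zero_le_one
  have hpt : ∀ u ∈ Set.Ioi (1 : ℝ), ‖collarSum l Y u‖
      ≤ K * (Y ^ (l - 2) * Real.exp (-Y)) * (u ^ (2 * l) * Real.exp (-(1 * u))) := by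
    intro u hu
    have hu1 : 1 < u := hu
    have hA : |greenMain Y u| ≤ Y * u ^ 2 := by
      rw [greenMain, abs_mul, abs_of_pos hY0]
      gcongr
      rw [abs_le]; constructor <;> nlinarith
    -- As Y and u are both at least 1, 2Yu ≥ Y + u. One part gives the decay in Y, the other a
    -- convergent integral independent of Y.
    have hexp : Real.exp (-(2 * Y * u)) ≤ Real.exp (-Y) * Real.exp (-(1 * u)) := by
      rw [← Real.exp_add, Real.exp_le_exp]
      nlinarith
    rw [collarSum, hK, Real.norm_eq_abs, Finset.sum_mul, Finset.sum_mul]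
    refine (Finset.abs_sum_le_sum_abs _ _).trans (Finset.sum_le_sum fun j _ => ?_)
    have hm0 := greenMoment_nonneg (Real.exp_pos _).le
      (exp_neg_mul_lt_one' hY0 (zero_lt_one.trans hu1)) j
    have hm : greenMoment (j + 2) (Real.exp (-(u * Y)))
        ≤ momentBound j * (Real.exp (-Y) * Real.exp (-(1 * u))) :=
      (greenMoment_exp_le hY0 (zero_lt_one.trans hu1) j).trans
        (mul_le_mul_of_nonneg_left hexp (momentBound_nonneg j))
    have hp : |greenMain Y u| ^ (l - 2 - j) ≤ Y ^ (l - 2) * u ^ (2 * l) := by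
      calc _ ≤ (Y * u ^ 2) ^ (l - 2 - j) := pow_le_pow_left₀ (abs_nonneg _) hA _
        _ = Y ^ (l - 2 - j) * u ^ (2 * (l - 2 - j)) := by rw [mul_pow, ← pow_mul]
        _ ≤ _ := mul_le_mul (pow_le_pow_right₀ hY (by omega))
          (pow_le_pow_right₀ hu1.le (by omega)) (by positivity) (by positivity)
    rw [abs_mul, abs_mul, Nat.abs_cast, abs_pow, abs_of_nonneg hm0]
    calc _ ≤ (l.choose (j + 2) : ℝ) * (Y ^ (l - 2) * u ^ (2 * l))
          * (momentBound j * (Real.exp (-Y) * Real.exp (-(1 * u)))) := by gcongr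
      _ = _ := by ring
  rw [← Real.norm_eq_abs]
  refine (norm_integral_le_of_norm_le ((hi.mono_set hsub).const_mul _)
    ((ae_restrict_iff' measurableSet_Ioi).2 (Eventually.of_forall hpt))).trans ?_
  rw [integral_const_mul]
  have hle : ∫ u in Set.Ioi (1 : ℝ), u ^ (2 * l) * Real.exp (-(1 * u)) ≤ (2 * l).factorial := by
    have h0 := integral_pow_mul_exp_neg one_pos (2 * l)
    rw [one_pow, div_one] at h0
    rw [← h0]
    exact setIntegral_mono_set hi ((ae_restrict_iff' measurableSet_Ioi).2
      (Eventually.of_forall fun u (hu : 0 < u) => by positivity)) hsub.eventuallyLE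
  calc _ ≤ K * (Y ^ (l - 2) * Real.exp (-Y)) * (2 * l).factorial := by gcongr
    _ = _ := by ring

/-! ### The asymptotic expansion. -/

/-- The reflection u ↦ 1 - u makes the two collar integrals equal, and completing them to (0, ∞)
gives the Laurent polynomial. The truncated subtraction l - 2 is max(l - 2, 0). -/
lemma exists_abs_modularGraphD_sub_le (l : ℕ) :
    ∃ K : ℝ, ∀ τ : ℍ, 1 ≤ 2 * Real.pi * τ.im →
      |modularGraphD l τ - laurentValue (laurentD l) (2 * Real.pi * τ.im)|
        ≤ K * ((2 * Real.pi * τ.im) ^ (l - 2) * Real.exp (-(2 * Real.pi * τ.im))) := by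
  obtain ⟨K₁, _, hK₁⟩ := exists_abs_integral_torusGreen_pow_sub_le l
  obtain ⟨K₂, _, hK₂⟩ := exists_abs_integral_Ioi_one_collarSum_le l
  refine ⟨K₁ + 2 * K₂, fun τ hY => ?_⟩
  have hpt := fun u (hu : u ∈ Set.Ioo (0 : ℝ) 1) => hK₁ τ hY hu.1 hu.2
  have h2 := hK₂ _ hY
  have iD := integrableOn_integral_torusGreen l τ
  rw [modularGraphD_eq]
  set Y := 2 * Real.pi * τ.im with hYdef
  have hY0 : 0 < Y := by linarith
  rw [laurentValue_laurentD l hY0]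
  have iC : IntegrableOn (collarSum l Y) (Set.Ioi 0) := integrableOn_collarSum l hY0
  have iC1 : IntervalIntegrable (collarSum l Y) volume 0 1 :=
    (intervalIntegrable_iff_integrableOn_Ioc_of_le zero_le_one).2
      (iC.mono_set Set.Ioc_subset_Ioi_self)
  have iC2 : IntervalIntegrable (fun u => collarSum l Y (1 - u)) volume 0 1 := by
    simpa using (iC1.comp_sub_left 1).symm
  have iA : IntervalIntegrable (fun u => greenMain Y u ^ l) volume 0 1 :=
    (by unfold greenMain; fun_prop : Continuous fun u => greenMain Y u ^ l).intervalIntegrable _ _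
  have iM := iA.add (iC1.add iC2)
  have hsplit := intervalIntegral.integral_interval_add_Ioi iC
    (iC.mono_set (Set.Ioi_subset_Ioi zero_le_one))
  have hM : ∫ u in Set.Ioo (0 : ℝ) 1, (greenMain Y u ^ l + (collarSum l Y u
      + collarSum l Y (1 - u))) = (∫ u in (0 : ℝ)..1, greenMain Y u ^ l)
        + 2 * ∫ u in (0 : ℝ)..1, collarSum l Y u := by
    rw [← integral_Ioc_eq_integral_Ioo, ← intervalIntegral.integral_of_le zero_le_one,
      intervalIntegral.integral_add iA (iC1.add iC2), intervalIntegral.integral_add iC1 iC2,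
      intervalIntegral.integral_comp_sub_left (collarSum l Y)]
    simp only [sub_self, sub_zero]
    ring
  have iM' : IntegrableOn (fun u => greenMain Y u ^ l + (collarSum l Y u
      + collarSum l Y (1 - u))) (Set.Ioo (0 : ℝ) 1) :=
    ((intervalIntegrable_iff_integrableOn_Ioc_of_le zero_le_one).1 iM).mono_set
      Set.Ioo_subset_Ioc_self
  have h1 : |(∫ u in Set.Ioo (0 : ℝ) 1, ∫ v in (0 : ℝ)..1, torusGreen (u * τ + v) τ ^ l)
      - ∫ u in Set.Ioo (0 : ℝ) 1, (greenMain Y u ^ l + (collarSum l Y u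
      + collarSum l Y (1 - u)))| ≤ K₁ * (Y ^ (l - 2) * Real.exp (-Y)) := by
    rw [← integral_sub iD iM', ← Real.norm_eq_abs]
    refine le_of_le_of_eq (norm_setIntegral_le_of_norm_le_const
      (C := K₁ * (Y ^ (l - 2) * Real.exp (-Y))) measure_Ioo_lt_top hpt) ?_
    simp
  rw [hM] at h1
  rw [← hsplit]
  rw [abs_le] at h1 h2 ⊢
  constructor <;> linarith [h1.1, h1.2, h2.1, h2.2]

end

theorem theoremA (l : ℕ) :
    (∀ τ : ℍ, IntegrableOn (torusGreenPow l τ) unitSquare) ∧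
    ((fun τ : ℍ => modularGraphD l τ - laurentValue (laurentD l) (2 * Real.pi * τ.im))
      =O[atImInfty]
        fun τ : ℍ => (2 * Real.pi * τ.im) ^ (l - 2) * Real.exp (-(2 * Real.pi * τ.im))) ∧
    (∀ n : ℤ, (laurentD l).coeff n ∈ oddZetaRing) := by
  refine ⟨integrableOn_torusGreenPow l, ?_, laurentD_coeff_mem l⟩
  obtain ⟨K, hK⟩ := exists_abs_modularGraphD_sub_le l
  refine IsBigO.of_bound K ?_
  filter_upwards [(atImInfty_mem {τ : ℍ | 1 ≤ τ.im}).2 ⟨1, fun τ h => h⟩] with τ hτ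
  have h1 : 1 ≤ τ.im := hτ
  have hY : 1 ≤ 2 * Real.pi * τ.im := by nlinarith [Real.pi_gt_three]
  rw [Real.norm_eq_abs, Real.norm_of_nonneg (by positivity)]
  exact hK τ hY
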